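/- Let $q\in(0,1)$, $c\in(1,q^{-1})$, $\kappa_0=\left(\frac{1-qc}{c-q}\right)^2$, $\kappa\in(\kappa_0,1)$, and put $$\sigma_1=\frac{q^{1/3}(q+\sqrt\kappa)^{5/3}}{\kappa^{1/6}(1-q^2)(1+q\sqrt\kappa)^{1/3}},\quad f_1=\frac{q^{1/3}}{2\kappa^{2/3}(q+\sqrt\kappa)^{1/3}(1+q\sqrt\kappa)^{1/3}},\quad z_c=\frac{1+q\sqrt\kappa}{q+\sqrt\kappa},$$ $$p_1=\frac{q(1+q\sqrt\kappa)}{(1-q^2)\sqrt\kappa},\qquad h_1=\frac{q(q+2\sqrt\kappa+q\kappa)}{1-q^2}.$$ With principal logarithms let $S_1(z)=\log(1-q/z)-\kappa\log(1-qz)-h_1\log z$, $G_1(z)=-\log(1-qz)-p_1\log z$, $\bar S_1=S_1-S_1(z_c)$, $\bar G_1=G_1-G_1(z_c)$. (Thus $S_1'''(z_c)=2\sigma_1^3$ and $G_1''(z_c)=2f_1\sigma_1^2$.) *Contours.* For $x,R>0$, $r\ge0$, $\theta\in(0,\pi)$ let $z^\pm=x+re^{\pm i\theta}$ and let $\zeta^\pm$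 be the first points where the rays $\{x+ue^{\pm i\theta}:u\ge0\}$ meet the circle $|z|=R$. The closed contour $C(x,\theta,R,r)$ consists of the oriented segments $\zeta^-\to z^-\to z^+\to\zeta^+$ and the counterclockwise arc of $|z|=R$ from $\zeta^+$ to $\zeta^-$. Call $(\theta,R)$ a *descent pair* if $\theta\in(\pi/4,\pi/2)$, $R>q^{-1}$, and there is $\psi:(0,\infty)\to(0,\infty)$ such that $\mathrm{Re}\,\bar S_1(z)\le-\psi(\varepsilon)$ for all $\varepsilon>0$ and all $z\in C(z_c,\theta,R,0)$ with $|z-z_c|\ge\varepsilon$. For a descent pair $(\theta,R)$ and $N\in\mathbb N$ let $$\Gamma_N=C\big(z_c,\theta,R,\sec(\theta)N^{-1/3}\big),\quad \gamma_N=C\Big(z_c,\tfrac{2\pi}3,\sqrt{z_c^2+N^{-1/6}-z_cN^{-1/12}},0\Big),\quad \tilde\gamma_N=C\Big(z_c,\tfrac\pi2,\sqrt{z_c^2+N^{-1/6}},0\Big).$$ *Prelimit kernel.* Write $T_t=\lfloor tN^{2/3}\rfloor$, $\lambda_N=\sigma_1z_cN^{1/3}$, $g(z)=(1-qz)^{\kappa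 N-\lfloor\kappa N\rfloor}$ (principal branch), and $E_{s,x}(z)=\exp\big(N\bar S_1(z)+T_s\bar G_1(z)-\lambda_N x\log(z/z_c)\big)$. For $s,t,x,y\in\mathbb R$ set $$I^N_{11}(s,x;t,y)=\frac{\lambda_N}{(2\pi i)^2}\oint_{\Gamma_N}\!dz\oint_{\Gamma_N}\!dw\,E_{s,x}(z)E_{t,y}(w)\frac{(z-w)(1-c/z)(1-c/w)\,g(z)g(w)}{(z^2-1)(w^2-1)(zw-1)},$$ $$I^N_{12}(s,x;t,y)=\frac{\lambda_N}{(2\pi i)^2}\oint_{\Gamma_N}\!dz\oint_{\gamma_N}\!dw\,\frac{E_{s,x}(z)}{E_{t,y}(w)}\cdot\frac{(zw-1)(z-c)\,g(z)}{z(z-w)(z^2-1)(w-c)\,g(w)},$$ $$I^N_{22}(s,x;t,y)=\frac{\lambda_N}{(2\pi i)^2}\oint_{\gamma_N}\!dz\oint_{\gamma_N}\!dw\,\frac{1}{E_{s,x}(z)E_{t,y}(w)}\cdot\frac{z-w}{(zw-1)(z-c)(w-c)\,g(z)g(w)},$$ $$R^N_{12}(s,x;t,y)=-\frac{\mathbf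 1\{s>t\}\lambda_N}{2\pi i}\oint_{\tilde\gamma_N}\frac{dz}{z}e^{(T_s-T_t)\bar G_1(z)+\lambda_N(y-x)\log(z/z_c)}+\frac{\lambda_N}{2\pi i}\oint_{\Gamma_N}\!dz\,\frac{E_{s,x}(z)}{E_{t,y}(c)}\cdot\frac{(zc-1)\,g(z)}{z(z^2-1)\,g(c)},$$ $$R^N_{22}(s,x;t,y)=\frac{\lambda_N}{2\pi i}\oint_{\gamma_N}\frac{dz}{E_{s,x}(z)E_{t,y}(c)(cz-1)g(z)g(c)}-\frac{\lambda_N}{2\pi i}\oint_{\gamma_N}\frac{dw}{E_{s,x}(c)E_{t,y}(w)(cw-1)g(c)g(w)},$$ and $K^N_{11}=I^N_{11}$, $K^N_{12}=I^N_{12}+R^N_{12}$, $K^N_{21}(s,x;t,y)=-K^N_{12}(t,y;s,x)$, $K^N_{22}=I^N_{22}+R^N_{22}$. *Extended Airy kernel.* For $t_1,x_1,t_2,x_2\in\mathbb R$, $$K^{\mathrm{Airy}}(t_1,x_1;t_2,x_2)=-\frac{\mathbf 1\{t_2>t_1\}}{\sqrt{4\pi(t_2-t_1)}}e^{-\frac{(x_2-x_1)^2}{4(t_2-t_1)}-\frac{(t_2-t_1)(x_2+x_1)}2+\frac{(t_2-t_1)^3}{12}}+\frac1{(2\pi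 i)^2}\int_{\mathcal C_\alpha^{\pi/3}}\!dz\int_{\mathcal C_\beta^{2\pi/3}}\!dw\,\frac{e^{z^3/3-x_1z-w^3/3+x_2w}}{z+t_1-w-t_2},$$ where $\alpha,\beta\in\mathbb R$ are arbitrary with $\alpha+t_1>\beta+t_2$ and $\mathcal C_a^\varphi=\{a+|u|e^{\mathrm{sgn}(u)i\varphi}:u\in\mathbb R\}$ is oriented from $a+\infty e^{-i\varphi}$ to $a+\infty e^{i\varphi}$. **Statement.** Descent pairs exist, and for every descent pair $(\theta,R)$, all $s,t\in\mathbb R$, and all real sequences $x_N\to x$, $y_N\to y$, as $N\to\infty$, $$K^N_{11}(s,x_N;t,y_N)\to0,\qquad K^N_{22}(s,x_N;t,y_N)\to0,$$ $$K^N_{12}(s,x_N;t,y_N)\to e^{\frac23f_1^3s^3-\frac23f_1^3t^3+f_1sx-f_1ty}\,K^{\mathrm{Airy}}\big(-f_1s,\,x+f_1^2s^2;\,-f_1t,\,y+f_1^2t^2\big),$$ the last limit holding with every admissible choice of $\alpha,\beta$ in $K^{\mathrm{Airy}}$. -/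

import Mathlib

noncomputable section

namespace BulkScaling

/-! ### Parameters -/

/-- The lower end `κ₀ = ((1 - qc)/(c - q))²` of the range of `κ`. -/
def kappaZero (q c : ℝ) : ℝ := ((1 - q * c) / (c - q)) ^ 2

/-- `σ₁`: the third derivative of `S₁` at `z_c` is `2 σ₁³`. -/
def sigmaOne (q κ : ℝ) : ℝ :=
  q ^ (1 / 3 : ℝ) * (q + √κ) ^ (5 / 3 : ℝ) /
    (κ ^ (1 / 6 : ℝ) * (1 - q ^ 2) * (1 + q * √κ) ^ (1 / 3 : ℝ))

/-- `f₁`: the second derivative of `G₁` at `z_c` is `2 f₁ σ₁²`. -/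
def fOne (q κ : ℝ) : ℝ :=
  q ^ (1 / 3 : ℝ) /
    (2 * κ ^ (2 / 3 : ℝ) * (q + √κ) ^ (1 / 3 : ℝ) * (1 + q * √κ) ^ (1 / 3 : ℝ))

/-- The critical point `z_c`. -/
def zCrit (q κ : ℝ) : ℝ := (1 + q * √κ) / (q + √κ)

def pOne (q κ : ℝ) : ℝ := q * (1 + q * √κ) / ((1 - q ^ 2) * √κ)

def hOne (q κ : ℝ) : ℝ := q * (q + 2 * √κ + q * κ) / (1 - q ^ 2)

/-- `T_t(N) = ⌊t N^{2/3}⌋`. -/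
def bigT (N : ℕ) (t : ℝ) : ℤ := ⌊t * (N : ℝ) ^ (2 / 3 : ℝ)⌋

/-- The spatial scale `σ₁ z_c N^{1/3}`. -/
def scale (q κ : ℝ) (N : ℕ) : ℝ := sigmaOne q κ * zCrit q κ * (N : ℝ) ^ (1 / 3 : ℝ)

/-! ### The functions `S₁`, `G₁` (principal logarithms) -/

def SOne (q κ : ℝ) (z : ℂ) : ℂ :=
  Complex.log (1 - q / z) - κ * Complex.log (1 - q * z) - hOne q κ * Complex.log z

def SOneBar (q κ : ℝ) (z : ℂ) : ℂ := SOne q κ z - SOne q κ (zCrit q κ)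

def GOne (q κ : ℝ) (z : ℂ) : ℂ :=
  -Complex.log (1 - q * z) - pOne q κ * Complex.log z

def GOneBar (q κ : ℝ) (z : ℂ) : ℂ := GOne q κ z - GOne q κ (zCrit q κ)

/-! ### The closed contours `C(x, θ, R, r)` -/

/-- Distance from `x` at which the ray `{x + t e^{iθ} : t ≥ 0}` first meets the circle of radius
`R` centered at `0`. -/
def rayDist (x θ R : ℝ) : ℝ :=
  sInf {t : ℝ | 0 ≤ t ∧ ‖(x : ℂ) + t * Complex.exp (θ * Complex.I)‖ = R}

/-- The point at distance `t` from `x` on the ray from `x` of angle `θ`. -/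
def rayPoint (x θ t : ℝ) : ℂ := (x : ℂ) + t * Complex.exp (θ * Complex.I)

/-- The oriented segment from `a` to `b`, parametrized by `[0, 1]`. -/
def segmentPath (a b : ℂ) (u : ℝ) : ℂ := a + u * (b - a)

/-- The counterclockwise arc of the circle of radius `R` centered at `0`, from angle `φ` to angle
`2π - φ`, parametrized by `[0, 1]`. -/
def arcPath (R φ u : ℝ) : ℂ :=
  R * Complex.exp ((φ + u * (2 * Real.pi - 2 * φ) : ℝ) * Complex.I)

/-- The four oriented pieces of the contour `C(x, θ, R, r)`: with `ζ^±` the points where the rays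
from `x` of angles `±θ` meet the circle `|z| = R` and `z^± = x + r e^{±iθ}`, these are the segments
`ζ⁻ → z⁻`, `z⁻ → z⁺`, `z⁺ → ζ⁺` and the counterclockwise arc of `|z| = R` from `ζ⁺` to `ζ⁻`. -/
def contourPiece (x θ R r : ℝ) : Fin 4 → ℝ → ℂ :=
  ![segmentPath (rayPoint x (-θ) (rayDist x (-θ) R)) (rayPoint x (-θ) r),
    segmentPath (rayPoint x (-θ) r) (rayPoint x θ r),
    segmentPath (rayPoint x θ r) (rayPoint x θ (rayDist x θ R)),
    arcPath R (Complex.arg (rayPoint x θ (rayDist x θ R)))]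

/-- The set of points of `C(x, θ, R, r)`. -/
def contourSet (x θ R r : ℝ) : Set ℂ :=
  ⋃ i : Fin 4, contourPiece x θ R r i '' Set.Icc 0 1

/-- The integral `∮ f(z) dz` along a contour given by four oriented pieces, each parametrized by
`[0, 1]`. -/
def contourIntegral (γ : Fin 4 → ℝ → ℂ) (f : ℂ → ℂ) : ℂ :=
  ∑ i : Fin 4, ∫ u in (0 : ℝ)..1, f (γ i u) * deriv (γ i) u

/-- `Γ_N = C(z_c, θ, R, sec(θ) N^{-1/3})`. -/
def GammaN (q κ θ R : ℝ) (N : ℕ) : Fin 4 → ℝ → ℂ :=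
  contourPiece (zCrit q κ) θ R ((Real.cos θ)⁻¹ * (N : ℝ) ^ (-(1 / 3) : ℝ))

/-- `γ_N = C(z_c, 2π/3, √(z_c² + N^{-1/6} - z_c N^{-1/12}), 0)`. -/
def gammaN (q κ : ℝ) (N : ℕ) : Fin 4 → ℝ → ℂ :=
  contourPiece (zCrit q κ) (2 * Real.pi / 3)
    (√(zCrit q κ ^ 2 + (N : ℝ) ^ (-(1 / 6) : ℝ) - zCrit q κ * (N : ℝ) ^ (-(1 / 12) : ℝ))) 0

/-- `γ̃_N = C(z_c, π/2, √(z_c² + N^{-1/6}), 0)`. -/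
def gammaTildeN (q κ : ℝ) (N : ℕ) : Fin 4 → ℝ → ℂ :=
  contourPiece (zCrit q κ) (Real.pi / 2) (√(zCrit q κ ^ 2 + (N : ℝ) ^ (-(1 / 6) : ℝ))) 0

/-- `θ ∈ (π/4, π/2)` and `R > q⁻¹` are such that the real part of `S₁ - S₁(z_c)` along
`C(z_c, θ, R, 0)` is bounded above by a negative constant away from any neighborhood of `z_c`. -/
def IsDescentContour (q κ θ R : ℝ) : Prop :=
  θ ∈ Set.Ioo (Real.pi / 4) (Real.pi / 2) ∧ q⁻¹ < R ∧
    ∃ ψ : ℝ → ℝ, ∀ ε > 0, 0 < ψ ε ∧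
      ∀ z ∈ contourSet (zCrit q κ) θ R 0, ε ≤ ‖z - zCrit q κ‖ →
        (SOne q κ z - SOne q κ (zCrit q κ)).re ≤ -ψ ε

/-! ### The prelimit kernel -/

/-- `(1 - qz)^{κN - ⌊κN⌋}` (principal branch). -/
def fracPow (q κ : ℝ) (N : ℕ) (z : ℂ) : ℂ :=
  (1 - q * z) ^ ((κ * N - (⌊κ * N⌋ : ℝ) : ℝ) : ℂ)

def F11 (q κ : ℝ) (N : ℕ) (s x t y : ℝ) (z w : ℂ) : ℂ :=
  Complex.exp (N * SOneBar q κ z + N * SOneBar q κ w) *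
    Complex.exp (bigT N s * GOneBar q κ z + bigT N t * GOneBar q κ w) *
    Complex.exp (-(scale q κ N * x * Complex.log (z / zCrit q κ)) -
      scale q κ N * y * Complex.log (w / zCrit q κ))

def H11 (q c κ : ℝ) (N : ℕ) (z w : ℂ) : ℂ :=
  scale q κ N * ((z - w) * (1 - c / z) * (1 - c / w) * fracPow q κ N z * fracPow q κ N w /
    ((z ^ 2 - 1) * (w ^ 2 - 1) * (z * w - 1)))

def F12 (q κ : ℝ) (N : ℕ) (s x t y : ℝ) (z w : ℂ) : ℂ :=
  Complex.exp (N * SOneBar q κ z - N * SOneBar q κ w) *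
    Complex.exp (bigT N s * GOneBar q κ z - bigT N t * GOneBar q κ w) *
    Complex.exp (-(scale q κ N * x * Complex.log (z / zCrit q κ)) +
      scale q κ N * y * Complex.log (w / zCrit q κ))

def H12 (q c κ : ℝ) (N : ℕ) (z w : ℂ) : ℂ :=
  scale q κ N * ((z * w - 1) * (z - c) * fracPow q κ N z /
    (z * (z - w) * (z ^ 2 - 1) * (w - c) * fracPow q κ N w))

def F22 (q κ : ℝ) (N : ℕ) (s x t y : ℝ) (z w : ℂ) : ℂ :=
  Complex.exp (-(N * SOneBar q κ z) - N * SOneBar q κ w) *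
    Complex.exp (-(bigT N s * GOneBar q κ z) - bigT N t * GOneBar q κ w) *
    Complex.exp (scale q κ N * x * Complex.log (z / zCrit q κ) +
      scale q κ N * y * Complex.log (w / zCrit q κ))

def H22 (q c κ : ℝ) (N : ℕ) (z w : ℂ) : ℂ :=
  scale q κ N * ((z - w) /
    ((z * w - 1) * (z - c) * (w - c) * fracPow q κ N z * fracPow q κ N w))

def I11 (q c κ θ R : ℝ) (N : ℕ) (s x t y : ℝ) : ℂ :=
  1 / (2 * Real.pi * Complex.I) ^ 2 *
    contourIntegral (GammaN q κ θ R N) fun z =>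
      contourIntegral (GammaN q κ θ R N) fun w => F11 q κ N s x t y z w * H11 q c κ N z w

def I12 (q c κ θ R : ℝ) (N : ℕ) (s x t y : ℝ) : ℂ :=
  1 / (2 * Real.pi * Complex.I) ^ 2 *
    contourIntegral (GammaN q κ θ R N) fun z =>
      contourIntegral (gammaN q κ N) fun w => F12 q κ N s x t y z w * H12 q c κ N z w

def I22 (q c κ : ℝ) (N : ℕ) (s x t y : ℝ) : ℂ :=
  1 / (2 * Real.pi * Complex.I) ^ 2 *
    contourIntegral (gammaN q κ N) fun z =>
      contourIntegral (gammaN q κ N) fun w => F22 q κ N s x t y z w * H22 q c κ N z w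

open Classical in
def R12 (q c κ θ R : ℝ) (N : ℕ) (s x t y : ℝ) : ℂ :=
  -(if t < s then 1 else 0) * scale q κ N / (2 * Real.pi * Complex.I) *
      (contourIntegral (gammaTildeN q κ N) fun z =>
        1 / z * Complex.exp ((bigT N s - bigT N t) * GOneBar q κ z) *
          Complex.exp (scale q κ N * (y - x) * Complex.log (z / zCrit q κ))) +
    scale q κ N / (2 * Real.pi * Complex.I) *
      contourIntegral (GammaN q κ θ R N) fun z =>
        F12 q κ N s x t y z c * (z * c - 1) * fracPow q κ N z /
          (z * (z ^ 2 - 1) * fracPow q κ N c)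

def R22 (q c κ : ℝ) (N : ℕ) (s x t y : ℝ) : ℂ :=
  scale q κ N / (2 * Real.pi * Complex.I) *
      (contourIntegral (gammaN q κ N) fun z =>
        F22 q κ N s x t y z c / ((c * z - 1) * fracPow q κ N z * fracPow q κ N c)) -
    scale q κ N / (2 * Real.pi * Complex.I) *
      contourIntegral (gammaN q κ N) fun w =>
        F22 q κ N s x t y c w / ((c * w - 1) * fracPow q κ N c * fracPow q κ N w)

/-- The prelimit matrix kernel `K^N(s, x; t, y)`; its entry `K^N_{ij}` is the matrix entry
with (zero-based) indices `i - 1`, `j - 1`. -/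
def kernelN (q c κ θ R : ℝ) (N : ℕ) (s x t y : ℝ) : Matrix (Fin 2) (Fin 2) ℂ :=
  !![I11 q c κ θ R N s x t y, I12 q c κ θ R N s x t y + R12 q c κ θ R N s x t y;
    -I12 q c κ θ R N t y s x - R12 q c κ θ R N t y s x, I22 q c κ N s x t y + R22 q c κ N s x t y]

/-! ### The extended Airy kernel -/

/-- The integral of `f` along `{a + |s| e^{sgn(s) iφ} : s ∈ ℝ}`, oriented from
`a + ∞ e^{-iφ}` to `a + ∞ e^{iφ}`. -/
def wedgeIntegral (a φ : ℝ) (f : ℂ → ℂ) : ℂ :=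
  (∫ s in Set.Ioi (0 : ℝ), f (rayPoint a φ s) * Complex.exp (φ * Complex.I)) -
    ∫ s in Set.Ioi (0 : ℝ), f (rayPoint a (-φ) s) * Complex.exp (-(φ * Complex.I))

open Classical in
/-- The extended Airy kernel `K^Airy(t₁, x₁; t₂, x₂)`, written with contours through `α` and `β`,
where `α + t₁ > β + t₂`; its value does not depend on the choice of such `α`, `β`. -/
def airyKernel (α β t₁ x₁ t₂ x₂ : ℝ) : ℂ :=
  -(((if t₁ < t₂ then 1 else 0) / √(4 * Real.pi * (t₂ - t₁)) *
      Real.exp (-(x₂ - x₁) ^ 2 / (4 * (t₂ - t₁)) - (t₂ - t₁) * (x₂ + x₁) / 2 +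
        (t₂ - t₁) ^ 3 / 12) : ℝ) : ℂ) +
    1 / (2 * Real.pi * Complex.I) ^ 2 *
      wedgeIntegral α (Real.pi / 3) fun z =>
        wedgeIntegral β (2 * Real.pi / 3) fun w =>
          Complex.exp (z ^ 3 / 3 - x₁ * z - w ^ 3 / 3 + x₂ * w) / (z + t₁ - w - t₂)

end BulkScaling

end

namespace BulkScaling
open Filter Topology MeasureTheory Set

/-! ### Contour deformation in a half-plane -/

/-! The kernel is analysed by steepest descent at `z_c`. The constants `h₁` and `p₁` make `S₁'`
vanish to second order and `G₁'` to first order there (`hasDerivAt_SOne`, `hasDerivAt_GOne`). In the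
variable `Z = m (z - z_c)` with `m = σ₁ N^{1/3}`, the exponent of `E_{s,x}` therefore converges to
`Z³/3 + f₁ s Z² - x Z` (`tendsto_phase`).

To pass to the limit under the integrals, each contour is parametrized at scale `1/m`, and the
exponential factor is shown to be dominated by an integrable function (`DominatedFamily`). On the
rays of `Γ_N` the domination comes from the cubic Taylor term near `z_c` and from the descent
hypothesis farther out; on its arc the descent hypothesis suffices. The contour `γ_N` has
length-`N^{-1/12}` rays, where Taylor expansion alone is enough, and an arc on which `Re S₁` is at
least its value at the end of the ray, because on circles of radius at most `z_c` it decreases with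
`Re z` (`SOne_re_le_of_re_le`). The contour of the heat term is treated in the same way with `G₁` in
place of `S₁`.

What remains is to count powers of `m`. A double integral contributes `m⁻²` from `dz dw`. The
prefactors of `I₁₁` and `I₂₂` are `O(m)`, so these terms vanish. In `I₁₂` the factor `1/(z - w)`
supplies a second power of `m`, and the prefactor divided by `m²` tends to `1/(Z - W)`. The residue
terms at `c` carry `1/E(c)`, which is exponentially small because `S₁` increases on the real segment
from `z_c` to `c < 1/q` (`SOneBar_re_pos`). The remaining single integral becomes a Gaussian
integral over the imaginary axis (`tendsto_heat`).

The limiting double integral lives on a truncated wedge of angle `θ` and a wedge of angle `2π/3`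
with vertex `0`. Since the inner integral is a Cauchy transform, holomorphic and bounded to the
right of its contour, Cauchy's theorem moves both contours to the Airy contours
(`truncatedWedge_limitIntegrand`). The shifts `z = Z + f₁ s`, `w = W + f₁ t` complete the cube and
produce the conjugating exponential (`airy_doubleIntegral_eq`).

Existence of descent pairs: along a ray from `z_c`, the derivative of `Re S₁` is a positive multiple
of a real cubic in the distance (`re_ray_derivative`), and an angle can be chosen for which this
cubic is negative on the whole ray (`exists_cos_cubic_neg`). On large circles `Re S₁` tends to `-∞`.
-/

/-- The half-plane is the increasing union of discs tangent to its boundary line at `b`. Primitives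
on these discs, normalized at the centre of the smallest one, agree wherever two of them are
defined. -/
theorem exists_primitive_halfPlane {f : ℂ → ℂ} {b : ℝ}
    (hf : DifferentiableOn ℂ f {z | b < z.re}) :
    ∃ F : ℂ → ℂ, ∀ z : ℂ, b < z.re → HasDerivAt F (f z) z := by
  let ctr : ℕ → ℂ := fun n => ((b + (n + 1) : ℝ) : ℂ)
  let B : ℕ → Set ℂ := fun n => Metric.ball (ctr n) (n + 1)
  have hsub : ∀ n, B n ⊆ {z | b < z.re} := by
    intro n z hz
    have h1 : ‖z - ctr n‖ < n + 1 := by simpa [B, dist_eq_norm] using hz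
    have h2 := (Complex.abs_re_le_norm (z - ctr n)).trans_lt h1
    have h3 : (z - ctr n).re = z.re - (b + (n + 1)) := by
      simp [ctr, Complex.sub_re, Complex.ofReal_re]
    rw [h3, abs_lt] at h2
    simp only [mem_ofPred_eq]; linarith [h2.1]
  have hmono : ∀ {n m : ℕ}, n ≤ m → B n ⊆ B m := by
    intro n m hnm
    apply Metric.ball_subset_ball'
    have h : dist (ctr n) (ctr m) = (m : ℝ) - n := by
      rw [dist_eq_norm, ← Complex.ofReal_sub, Complex.norm_real, Real.norm_eq_abs]
      have : (n : ℝ) ≤ m := by exact_mod_cast hnm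
      rw [abs_sub_comm, abs_of_nonneg] <;> linarith
    rw [h]; linarith
  have hex : ∀ z : ℂ, b < z.re → ∃ n, z ∈ B n := by
    intro z hz
    -- Membership in the `n`-th disc reads `(Re z - b)² + (Im z)² < 2 (n + 1) (Re z - b)`.
    obtain ⟨n, hn⟩ := exists_nat_gt (((z.re - b) ^ 2 + z.im ^ 2) / (z.re - b))
    have hp : 0 < z.re - b := by linarith
    rw [div_lt_iff₀ hp] at hn
    refine ⟨n, ?_⟩
    have h1 : ‖z - ctr n‖ < n + 1 := by
      rw [Complex.norm_def, Real.sqrt_lt' (by positivity), Complex.normSq_apply]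
      simp only [Complex.sub_re, Complex.sub_im, ctr, Complex.ofReal_re, Complex.ofReal_im]
      nlinarith [mul_nonneg (Nat.cast_nonneg (α := ℝ) n) hp.le]
    simpa [B, dist_eq_norm] using h1
  have hg : ∀ n, ∃ g : ℂ → ℂ, g (ctr 0) = 0 ∧ ∀ z ∈ B n, HasDerivAt g (f z) z := fun n =>
    (DifferentiableOn.isExactOn_ball (hf.mono (hsub n))).with_val_at (ctr 0) 0
  choose g hg0 hgd using hg
  have h0 : ∀ n, ctr 0 ∈ B n := fun n => hmono (Nat.zero_le n) (by simp [B])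
  have hagree : ∀ {n m : ℕ}, n ≤ m → ∀ z ∈ B n, g n z = g m z := by
    intro n m hnm z hz
    have hd : ∀ w ∈ B n, HasDerivAt (fun w => g n w - g m w) 0 w := by
      intro w hw
      have h := (hgd n w hw).sub (hgd m w (hmono hnm hw))
      rwa [sub_self] at h
    have hb := (convex_ball (ctr n) (n + 1 : ℝ)).norm_image_sub_le_of_norm_hasDerivWithin_le
      (C := 0) (fun w hw => (hd w hw).hasDerivWithinAt) (by simp) (h0 n) hz
    simp only [hg0, sub_self, sub_zero, zero_mul, norm_le_zero_iff] at hb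
    exact sub_eq_zero.1 hb
  have hagree' : ∀ {n m : ℕ} (z : ℂ), z ∈ B n → z ∈ B m → g n z = g m z := by
    intro n m z hn hm
    rcases le_total n m with h | h
    · exact hagree h z hn
    · exact (hagree h z hm).symm
  classical
  choose! k hk using hex
  refine ⟨fun z => g (k z) z, fun z hz => ?_⟩
  refine (hgd (k z) z (hk z hz)).congr_of_eventuallyEq ?_
  filter_upwards [Metric.isOpen_ball.mem_nhds (hk z hz)] with w hw
  exact hagree' w (hk w (hsub _ hw)) hw

theorem rayPoint_re (x φ t : ℝ) : (rayPoint x φ t).re = x + t * Real.cos φ := by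
  simp [rayPoint, Complex.exp_ofReal_mul_I_re]

theorem rayPoint_im (x φ t : ℝ) : (rayPoint x φ t).im = t * Real.sin φ := by
  simp [rayPoint, Complex.exp_ofReal_mul_I_im]

/-- The point at distance `t` from `p` in the direction of angle `φ`. -/
noncomputable def ptRay (p : ℂ) (φ t : ℝ) : ℂ := p + t * Complex.exp (φ * Complex.I)

theorem ptRay_re (p : ℂ) (φ t : ℝ) : (ptRay p φ t).re = p.re + t * Real.cos φ := by
  simp [ptRay, Complex.exp_ofReal_mul_I_re]

theorem ptRay_im (p : ℂ) (φ t : ℝ) : (ptRay p φ t).im = p.im + t * Real.sin φ := by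
  simp [ptRay, Complex.exp_ofReal_mul_I_im]

theorem norm_exp_angle (φ : ℝ) : ‖Complex.exp (φ * Complex.I)‖ = 1 :=
  Complex.norm_exp_ofReal_mul_I φ

theorem continuous_ptRay (p : ℂ) (φ : ℝ) : Continuous (ptRay p φ) := by
  unfold ptRay; fun_prop

theorem hasDerivAt_ptRay (p : ℂ) (φ t : ℝ) :
    HasDerivAt (ptRay p φ) (Complex.exp (φ * Complex.I)) t := by
  unfold ptRay
  have := ((hasDerivAt_id t).ofReal_comp.mul_const (Complex.exp (φ * Complex.I))).const_add p
  simpa using this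

/-- The convex far part of a sector in the half-plane `ε Im z > 0`. -/
def farCone (b η ε T : ℝ) : Set ℂ :=
  {z | b + 1 ≤ z.re ∧ η * (ε * z.im) ≤ z.re ∧ z.re ≤ ε * z.im ∧ T ≤ ε * z.im}

theorem convex_farCone (b η ε T : ℝ) : Convex ℝ (farCone b η ε T) := by
  intro x hx y hy a c ha hc hac
  obtain ⟨h1, h2, h3, h4⟩ := hx
  obtain ⟨k1, k2, k3, k4⟩ := hy
  have hc' : c = 1 - a := by linarith
  subst hc'
  simp only [farCone, mem_ofPred_eq, Complex.add_re, Complex.add_im, Complex.real_smul,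
    Complex.mul_re, Complex.mul_im, Complex.ofReal_re, Complex.ofReal_im, zero_mul, sub_zero,
    add_zero]
  refine ⟨?_, ?_, ?_, ?_⟩ <;>
  nlinarith [mul_le_mul_of_nonneg_left h1 ha, mul_le_mul_of_nonneg_left h2 ha,
    mul_le_mul_of_nonneg_left h3 ha, mul_le_mul_of_nonneg_left h4 ha,
    mul_le_mul_of_nonneg_left k1 hc, mul_le_mul_of_nonneg_left k2 hc,
    mul_le_mul_of_nonneg_left k3 hc, mul_le_mul_of_nonneg_left k4 hc]

/-- The strict inequalities on `φ` leave room to absorb the base point `p`: since `cos φ < ε sin φ`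
forces `ε sin φ > 1/2`, the height eventually exceeds `s/2`, and `η < cos φ` gives the lower slope.
-/
theorem eventually_ptRay_mem_farCone (b ε : ℝ) (hε : ε = 1 ∨ ε = -1) (p : ℂ) {φ η : ℝ}
    (h0 : 0 < Real.cos φ) (h1 : Real.cos φ < ε * Real.sin φ) (hη0 : 0 < η)
    (hη : η < Real.cos φ) :
    ∀ᶠ s : ℝ in atTop, ptRay p φ s ∈ farCone b η ε (s / 2) := by
  have hsq : ε ^ 2 = 1 := by rcases hε with h | h <;> simp [h]
  have hs1 : ε * Real.sin φ ≤ 1 := by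
    rcases hε with h | h <;> simp [h]
    · exact Real.sin_le_one φ
    · linarith [Real.neg_one_le_sin φ]
  have hs2 : 1 / 2 < ε * Real.sin φ := by
    nlinarith [Real.sin_sq_add_cos_sq φ, mul_pow ε (Real.sin φ) 2]
  have e1 : ∀ᶠ s : ℝ in atTop, b + 1 - p.re ≤ s * Real.cos φ :=
    (tendsto_id.atTop_mul_const h0).eventually_ge_atTop _
  have e2 : ∀ᶠ s : ℝ in atTop, η * (ε * p.im) - p.re ≤ s * (Real.cos φ - η) :=
    (tendsto_id.atTop_mul_const (by linarith)).eventually_ge_atTop _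
  have e3 : ∀ᶠ s : ℝ in atTop, p.re - ε * p.im ≤ s * (ε * Real.sin φ - Real.cos φ) :=
    (tendsto_id.atTop_mul_const (by linarith)).eventually_ge_atTop _
  have e4 : ∀ᶠ s : ℝ in atTop, - (ε * p.im) ≤ s * (ε * Real.sin φ - 1 / 2) :=
    (tendsto_id.atTop_mul_const (by linarith)).eventually_ge_atTop _
  filter_upwards [e1, e2, e3, e4, eventually_ge_atTop 0] with s h1 h2 h3 h4 h5
  simp only [farCone, mem_ofPred_eq, ptRay_re, ptRay_im]
  refine ⟨by linarith, ?_, by nlinarith, by nlinarith⟩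
  have : η * (s * (ε * Real.sin φ)) ≤ η * s := by
    have := mul_le_mul_of_nonneg_left hs1 h5
    nlinarith
  nlinarith

theorem abs_im_of_mem_farCone {b η ε T : ℝ} (hε : ε = 1 ∨ ε = -1) (hT : 0 ≤ T) {z : ℂ}
    (hz : z ∈ farCone b η ε T) : |z.im| = ε * z.im := by
  obtain ⟨-, -, -, h⟩ := hz
  rcases hε with rfl | rfl
  · rw [one_mul] at h ⊢; exact abs_of_nonneg (hT.trans h)
  · rw [neg_one_mul] at h ⊢; exact abs_of_nonpos (by linarith)

/-- `f` decays in all sectors strictly between the diagonals and the imaginary axis. -/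
def DecaysInSectors (b : ℝ) (f : ℂ → ℂ) : Prop :=
  ∀ η > 0, ∃ K, ∀ z : ℂ, b + 1 ≤ z.re → η * |z.im| ≤ z.re → z.re ≤ |z.im| →
    ‖f z‖ ≤ K * Real.exp (-|z.im|)

theorem tendsto_mul_exp_neg_half (A : ℝ) :
    Tendsto (fun s : ℝ => A * Real.exp (-(s / 2)) * (A + 2 * s)) atTop (𝓝 0) := by
  have h1 : Tendsto (fun s : ℝ => s / 2) atTop atTop := tendsto_id.atTop_div_const (by norm_num)
  have h2 := (Real.tendsto_pow_mul_exp_neg_atTop_nhds_zero 0).comp h1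
  have h3 := (Real.tendsto_pow_mul_exp_neg_atTop_nhds_zero 1).comp h1
  have h4 := (h2.const_mul (A * A)).add (h3.const_mul (4 * A))
  simp only [mul_zero, add_zero] at h4
  refine h4.congr fun s => ?_
  simp only [Function.comp_apply]; ring

theorem norm_le_of_mem_farCone {f : ℂ → ℂ} {b η ε T K : ℝ} (hε : ε = 1 ∨ ε = -1)
    (hK : ∀ z : ℂ, b + 1 ≤ z.re → η * |z.im| ≤ z.re → z.re ≤ |z.im| →
      ‖f z‖ ≤ K * Real.exp (-|z.im|)) (hT : 0 ≤ T) {z : ℂ} (hz : z ∈ farCone b η ε T) :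
    ‖f z‖ ≤ |K| * Real.exp (-T) := by
  have ha := abs_im_of_mem_farCone hε hT hz
  obtain ⟨h1, h2, h3, h4⟩ := hz
  rw [← ha] at h2 h3 h4
  calc ‖f z‖ ≤ K * Real.exp (-|z.im|) := hK z h1 h2 h3
    _ ≤ |K| * Real.exp (-|z.im|) := by gcongr; exact le_abs_self K
    _ ≤ |K| * Real.exp (-T) := by gcongr

/-- Far points of both rays lie in one convex cone at height at least `s/2`, where `f =
O(e^{-s/2})`. Their distance is `O(s)`, so the mean value inequality makes the difference of the
primitives negligible; convexity of the cone is what allows this. -/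
theorem tendsto_primitive_sub {f F : ℂ → ℂ} {b ε : ℝ} (hε : ε = 1 ∨ ε = -1)
    (hF : ∀ z : ℂ, b < z.re → HasDerivAt F (f z) z) (hdec : DecaysInSectors b f)
    (p p' : ℂ) {φ φ' : ℝ} (h0 : 0 < Real.cos φ) (h1 : Real.cos φ < ε * Real.sin φ)
    (h0' : 0 < Real.cos φ') (h1' : Real.cos φ' < ε * Real.sin φ') :
    Tendsto (fun s : ℝ => F (ptRay p φ s) - F (ptRay p' φ' s)) atTop (𝓝 0) := by
  obtain ⟨η, hη0, hη⟩ := exists_between (lt_min h0 h0')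
  obtain ⟨K, hK⟩ := hdec η hη0
  set A := |K| + ‖p‖ + ‖p'‖ with hA
  refine squeeze_zero_norm' ?_ (tendsto_mul_exp_neg_half A)
  filter_upwards [eventually_ptRay_mem_farCone b ε hε p h0 h1 hη0 (hη.trans_le (min_le_left _ _)),
    eventually_ptRay_mem_farCone b ε hε p' h0' h1' hη0 (hη.trans_le (min_le_right _ _)),
    eventually_ge_atTop 0] with s hs hs' hs0
  have hb := (convex_farCone b η ε (s / 2)).norm_image_sub_le_of_norm_hasDerivWithin_le
    (C := |K| * Real.exp (-(s / 2)))
    (fun z hz => (hF z (by linarith [hz.1])).hasDerivWithinAt)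
    (fun z hz => norm_le_of_mem_farCone hε hK (by linarith) hz) hs' hs
  refine hb.trans ?_
  have hn : ∀ (a : ℂ) (ψ : ℝ), ‖ptRay a ψ s‖ ≤ ‖a‖ + s := by
    intro a ψ
    refine (norm_add_le _ _).trans ?_
    rw [norm_mul, norm_exp_angle, mul_one, Complex.norm_real, Real.norm_of_nonneg hs0]
  have hn2 : ‖ptRay p φ s - ptRay p' φ' s‖ ≤ A + 2 * s := by
    refine (norm_sub_le _ _).trans ?_
    linarith [hn p φ, hn p' φ', abs_nonneg K]
  have : |K| ≤ A := by linarith [norm_nonneg p, norm_nonneg p']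
  gcongr

theorem ptRay_re_gt {b : ℝ} {p : ℂ} (hp : b < p.re) {φ : ℝ} (h0 : 0 < Real.cos φ) {s : ℝ}
    (hs : 0 ≤ s) : b < (ptRay p φ s).re := by
  rw [ptRay_re]; nlinarith

theorem integrableOn_ptRay {f : ℂ → ℂ} {b ε : ℝ} (hε : ε = 1 ∨ ε = -1)
    (hf : DifferentiableOn ℂ f {z | b < z.re}) (hdec : DecaysInSectors b f)
    {p : ℂ} (hp : b < p.re) {φ : ℝ} (h0 : 0 < Real.cos φ) (h1 : Real.cos φ < ε * Real.sin φ) :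
    IntegrableOn (fun s : ℝ => f (ptRay p φ s)) (Ioi 0) := by
  have hcont : ContinuousOn (fun s : ℝ => f (ptRay p φ s)) (Ici 0) :=
    hf.continuousOn.comp (continuous_ptRay p φ).continuousOn
      fun s hs => ptRay_re_gt hp h0 hs
  rw [← integrableOn_Ici_iff_integrableOn_Ioi (by finiteness)]
  obtain ⟨η, hη0, hη⟩ := exists_between h0
  obtain ⟨K, hK⟩ := hdec η hη0
  refine (hcont.locallyIntegrableOn measurableSet_Ici).integrableOn_of_isBigO_atTop
    (g := fun s => Real.exp (-(1 / 2) * s)) ?_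
    ⟨Ioi 0, Ioi_mem_atTop 0, exp_neg_integrableOn_Ioi 0 (by norm_num)⟩
  refine Asymptotics.IsBigO.of_bound |K| ?_
  filter_upwards [eventually_ptRay_mem_farCone b ε hε p h0 h1 hη0 hη,
    eventually_ge_atTop 0] with s hs hs0
  have := norm_le_of_mem_farCone hε hK (by linarith) hs
  rw [Real.norm_of_nonneg (Real.exp_pos _).le]
  convert this using 3
  ring

theorem intervalIntegral_ptRay {f F : ℂ → ℂ} {b : ℝ}
    (hf : DifferentiableOn ℂ f {z | b < z.re})
    (hF : ∀ z : ℂ, b < z.re → HasDerivAt F (f z) z) {p : ℂ} (hp : b < p.re) {φ : ℝ}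
    (h0 : 0 < Real.cos φ) {s : ℝ} (hs : 0 ≤ s) :
    ∫ t in (0 : ℝ)..s, f (ptRay p φ t) * Complex.exp (φ * Complex.I) =
      F (ptRay p φ s) - F p := by
  have hF0 : F p = F (ptRay p φ 0) := by simp [ptRay]
  rw [hF0]
  refine intervalIntegral.integral_eq_sub_of_hasDerivAt (f := fun t => F (ptRay p φ t)) ?_ ?_
  · intro t ht
    rw [uIcc_of_le hs] at ht
    exact (hF _ (ptRay_re_gt hp h0 ht.1)).comp t (hasDerivAt_ptRay p φ t)
  · apply ContinuousOn.intervalIntegrable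
    rw [uIcc_of_le hs]
    refine ContinuousOn.mul (hf.continuousOn.comp (continuous_ptRay p φ).continuousOn ?_)
      continuousOn_const
    exact fun t ht => ptRay_re_gt hp h0 ht.1

/-- The integrals of a sectorially decaying function along all admissible rays on one side of the
real axis are given by one primitive and one value at infinity. -/
theorem exists_primitive_value_at_infinity {f F : ℂ → ℂ} {b ε : ℝ} (hε : ε = 1 ∨ ε = -1)
    (hf : DifferentiableOn ℂ f {z | b < z.re})
    (hF : ∀ z : ℂ, b < z.re → HasDerivAt F (f z) z) (hdec : DecaysInSectors b f) :
    ∃ L : ℂ, ∀ (p : ℂ) (φ : ℝ), b < p.re → 0 < Real.cos φ → Real.cos φ < ε * Real.sin φ →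
      ∫ s in Ioi (0 : ℝ), f (ptRay p φ s) * Complex.exp (φ * Complex.I) = L - F p := by
  have key : ∀ (p : ℂ) (φ : ℝ), b < p.re → 0 < Real.cos φ → Real.cos φ < ε * Real.sin φ →
      Tendsto (fun s : ℝ => F (ptRay p φ s) - F p) atTop
        (𝓝 (∫ s in Ioi (0 : ℝ), f (ptRay p φ s) * Complex.exp (φ * Complex.I))) := by
    intro p φ hp h0 h1
    refine (intervalIntegral_tendsto_integral_Ioi 0
      ((integrableOn_ptRay hε hf hdec hp h0 h1).mul_const _) tendsto_id).congr' ?_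
    filter_upwards [eventually_ge_atTop 0] with s hs
    exact intervalIntegral_ptRay hf hF hp h0 hs
  -- The value at infinity is read off from any one admissible ray; without such a ray the claim is
  -- vacuous.
  by_cases hne : ∃ (p : ℂ) (φ : ℝ), b < p.re ∧ 0 < Real.cos φ ∧ Real.cos φ < ε * Real.sin φ
  · obtain ⟨p, φ, hp, h0, h1⟩ := hne
    refine ⟨(∫ s in Ioi (0 : ℝ), f (ptRay p φ s) * Complex.exp (φ * Complex.I)) + F p,
      fun p' φ' hp' h0' h1' => ?_⟩
    have e1 := key p φ hp h0 h1
    have e2 := key p' φ' hp' h0' h1'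
    have e3 := tendsto_primitive_sub hε hF hdec p' p h0' h1' h0 h1
    refine tendsto_nhds_unique e2 ?_
    have e4 := (e1.add e3).add_const (F p - F p')
    refine (e4.congr fun s => ?_).trans (le_of_eq (by congr 1; ring))
    ring
  · push Not at hne
    exact ⟨0, fun p φ hp h0 h1 => absurd h1 (not_lt.2 (hne p φ hp h0))⟩

/-- The integral along the wedge with vertex `0` and angle `φ`, its part within distance `ρ` of the
vertex replaced by the vertical segment with the same end points. -/
noncomputable def truncatedWedgeIntegral (ρ φ : ℝ) (f : ℂ → ℂ) : ℂ :=
  -(∫ s in Ioi ρ, f (rayPoint 0 (-φ) s) * Complex.exp (-(φ * Complex.I))) +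
    (∫ u in Ioc (0 : ℝ) 1, f (segmentPath (rayPoint 0 (-φ) ρ) (rayPoint 0 φ ρ) u) *
      (rayPoint 0 φ ρ - rayPoint 0 (-φ) ρ)) +
    ∫ s in Ioi ρ, f (rayPoint 0 φ s) * Complex.exp (φ * Complex.I)

theorem setIntegral_Ioi_shift (g : ℝ → ℂ) (ρ : ℝ) :
    ∫ s in Ioi ρ, g s = ∫ s in Ioi (0 : ℝ), g (ρ + s) := by
  have h := (measurePreserving_add_left volume ρ).setIntegral_preimage_emb
    (measurableEmbedding_addLeft ρ) g (Ioi ρ)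
  rw [← h]
  congr 2
  ext s; simp

/-- Both sides equal the difference of the values of one primitive at infinity in the upper and in
the lower sector: the values at the finite corners telescope. -/
theorem wedgeIntegral_eq_truncated {f : ℂ → ℂ} {b : ℝ}
    (hf : DifferentiableOn ℂ f {z | b < z.re}) (hdec : DecaysInSectors b f)
    {a φ : ℝ} (ha : b < a) (h0 : 0 < Real.cos φ) (h1 : Real.cos φ < Real.sin φ)
    {ρ ψ : ℝ} (h0' : 0 < Real.cos ψ) (h1' : Real.cos ψ < Real.sin ψ) (hρ : b < ρ * Real.cos ψ) :
    wedgeIntegral a φ f = truncatedWedgeIntegral ρ ψ f := by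
  obtain ⟨F, hF⟩ := exists_primitive_halfPlane hf
  obtain ⟨L, hL⟩ := exists_primitive_value_at_infinity (Or.inl rfl) hf hF hdec
  obtain ⟨M, hM⟩ := exists_primitive_value_at_infinity (Or.inr rfl) hf hF hdec
  have r1 : ∀ (x θ s : ℝ), rayPoint x θ s = ptRay x θ s := fun _ _ _ => rfl
  have r2 : ∀ (θ s : ℝ), rayPoint 0 θ (ρ + s) = ptRay (rayPoint 0 θ ρ) θ s := by
    intro θ s; simp only [rayPoint, ptRay]; push_cast; ring
  have r3 : ∀ θ : ℝ, Complex.exp (-(θ * Complex.I)) = Complex.exp ((-θ : ℝ) * Complex.I) := by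
    intro θ; push_cast; ring_nf
  have hz : ∀ θ : ℝ, Real.cos θ = Real.cos ψ → b < (rayPoint 0 θ ρ).re := by
    intro θ hθ; rw [rayPoint_re, hθ]; linarith
  have hm : ∫ u in Ioc (0 : ℝ) 1, f (segmentPath (rayPoint 0 (-ψ) ρ) (rayPoint 0 ψ ρ) u) *
      (rayPoint 0 ψ ρ - rayPoint 0 (-ψ) ρ) = F (rayPoint 0 ψ ρ) - F (rayPoint 0 (-ψ) ρ) := by
    rw [← intervalIntegral.integral_of_le zero_le_one]
    have hre : ∀ u : ℝ, b < (segmentPath (rayPoint 0 (-ψ) ρ) (rayPoint 0 ψ ρ) u).re := by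
      intro u
      simp [segmentPath, rayPoint_re, hρ]
    have hd : ∀ u : ℝ, HasDerivAt (segmentPath (rayPoint 0 (-ψ) ρ) (rayPoint 0 ψ ρ))
        (rayPoint 0 ψ ρ - rayPoint 0 (-ψ) ρ) u := by
      intro u
      have h := ((hasDerivAt_id u).ofReal_comp.mul_const
        (rayPoint 0 ψ ρ - rayPoint 0 (-ψ) ρ)).const_add (rayPoint 0 (-ψ) ρ)
      rwa [Complex.ofReal_one, one_mul] at h
    rw [intervalIntegral.integral_eq_sub_of_hasDerivAt
      (f := fun u => F (segmentPath (rayPoint 0 (-ψ) ρ) (rayPoint 0 ψ ρ) u))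
      (fun u _ => (hF _ (hre u)).comp u (hd u))]
    · simp [segmentPath]
    · apply Continuous.intervalIntegrable
      refine Continuous.mul (hf.continuousOn.comp_continuous ?_ hre) continuous_const
      exact continuous_iff_continuousAt.2 fun u => (hd u).continuousAt
  unfold wedgeIntegral truncatedWedgeIntegral
  rw [hm, setIntegral_Ioi_shift _ ρ, setIntegral_Ioi_shift _ ρ]
  simp only [r2, r1 a, r3]
  rw [hL a φ (by simpa using ha) h0 (by simpa using h1),
    hM a (-φ) (by simpa using ha) (by simpa using h0) (by simpa using h1),
    hL _ ψ (hz ψ rfl) h0' (by simpa using h1'),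
    hM _ (-ψ) (hz (-ψ) (Real.cos_neg ψ)) (by simpa using h0') (by simpa using h1')]
  ring

theorem wedgeIntegral_eq_wedgeIntegral {f : ℂ → ℂ} {b : ℝ}
    (hf : DifferentiableOn ℂ f {z | b < z.re}) (hdec : DecaysInSectors b f)
    {a a' φ : ℝ} (ha : b < a) (ha' : b < a') (h0 : 0 < Real.cos φ)
    (h1 : Real.cos φ < Real.sin φ) :
    wedgeIntegral a φ f = wedgeIntegral a' φ f := by
  obtain ⟨ρ, hρ⟩ := exists_gt (b / Real.cos φ)
  rw [div_lt_iff₀ h0] at hρ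
  rw [wedgeIntegral_eq_truncated hf hdec ha h0 h1 h0 h1 hρ,
    wedgeIntegral_eq_truncated hf hdec ha' h0 h1 h0 h1 hρ]

/-- The reflection exchanges the upper and lower rays, which reverses the orientation, and `dw =
-dv` gives a second sign; the two cancel. This brings the left-opening contour under the half-plane
results above. -/
theorem wedgeIntegral_neg (a : ℝ) (f : ℂ → ℂ) :
    wedgeIntegral a (2 * Real.pi / 3) f = wedgeIntegral (-a) (Real.pi / 3) fun v => f (-v) := by
  have e1 : Complex.exp (((2 * Real.pi / 3 : ℝ) : ℂ) * Complex.I) =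
      -Complex.exp (-(((Real.pi / 3 : ℝ) : ℂ) * Complex.I)) := by
    have : (((2 * Real.pi / 3 : ℝ) : ℂ) * Complex.I) =
      -(((Real.pi / 3 : ℝ) : ℂ) * Complex.I) + Real.pi * Complex.I := by push_cast; ring
    rw [this, Complex.exp_add, Complex.exp_pi_mul_I]; ring
  have e2 : Complex.exp (-(((2 * Real.pi / 3 : ℝ) : ℂ) * Complex.I)) =
      -Complex.exp ((((Real.pi / 3 : ℝ) : ℂ) * Complex.I)) := by
    rw [Complex.exp_neg, e1, Complex.exp_neg, inv_neg, inv_inv]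
  have n1 : ∀ x : ℝ, (((-x : ℝ) : ℂ) * Complex.I) = -((x : ℂ) * Complex.I) := by
    intro x; push_cast; ring
  unfold wedgeIntegral rayPoint
  simp only [n1, e1, e2]
  have h1 : ∀ s : ℝ, (a : ℂ) + s * -Complex.exp (-(((Real.pi / 3 : ℝ) : ℂ) * Complex.I)) =
      -(((-a : ℝ) : ℂ) + s * Complex.exp (-(((Real.pi / 3 : ℝ) : ℂ) * Complex.I))) := by
    intro s; push_cast; ring
  have h2 : ∀ s : ℝ, (a : ℂ) + s * -Complex.exp ((((Real.pi / 3 : ℝ) : ℂ) * Complex.I)) =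
      -(((-a : ℝ) : ℂ) + s * Complex.exp ((((Real.pi / 3 : ℝ) : ℂ) * Complex.I))) := by
    intro s; push_cast; ring
  simp only [h1, h2]
  simp only [mul_neg, integral_neg]
  ring


/-! ### The limiting double integral -/

theorem exists_cubic_bound {c : ℝ} (hc : 0 < c) (A B : ℝ) :
    ∃ C, ∀ v : ℝ, 0 ≤ v → -c * v ^ 3 + A * v ^ 2 + B * v ≤ C := by
  -- Beyond `M` the cubic term alone outweighs the other two; `M ≥ 1` serves to compare `v` with
  -- `v²`.
  obtain ⟨M, hM⟩ : ∃ M, M = max 1 ((|A| + |B|) / c) := ⟨_, rfl⟩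
  have hM1 : 1 ≤ M := hM ▸ le_max_left _ _
  have hM2 : |A| + |B| ≤ c * M := by
    have : (|A| + |B|) / c ≤ M := hM ▸ le_max_right _ _
    rwa [div_le_iff₀ hc, mul_comm] at this
  refine ⟨|A| * M ^ 2 + |B| * M, fun v hv => ?_⟩
  have hA : A * v ^ 2 ≤ |A| * v ^ 2 := by gcongr; exact le_abs_self A
  have hB : B * v ≤ |B| * v := by gcongr; exact le_abs_self B
  rcases le_total v M with h | h
  · have h1 : |A| * v ^ 2 ≤ |A| * M ^ 2 := by gcongr
    have h2 : |B| * v ≤ |B| * M := by gcongr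
    have h3 : 0 ≤ c * v ^ 3 := by positivity
    linarith
  · have h1 : (|A| + |B|) * v ^ 2 ≤ c * M * v ^ 2 := by gcongr
    have h2 : c * M * v ^ 2 ≤ c * v * v ^ 2 := by gcongr
    have h3 : |B| * v ≤ |B| * v ^ 2 := by
      have : v ≤ v ^ 2 := by nlinarith
      gcongr
    have h4 : 0 ≤ |A| * M ^ 2 + |B| * M := by positivity
    nlinarith

/-- For `X = Re z` and `Y = |Im z|` with `ηY ≤ X ≤ Y`, one has `Re z³/3 = (X³ - 3XY²)/3 ≤ -(2/3) X
Y² ≤ -(2/3) η Y³`, which beats the quadratic and linear terms. -/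
theorem decaysInSectors_exp_cubic_mul (a d : ℝ) {b K : ℝ} {k : ℂ → ℂ}
    (hk : ∀ z : ℂ, b + 1 ≤ z.re → ‖k z‖ ≤ K) :
    DecaysInSectors b fun z => Complex.exp (z ^ 3 / 3 + a * z ^ 2 + d * z) * k z := by
  intro η hη
  -- The additional `1` in the linear coefficient produces the factor `exp (-|Im z|)`.
  obtain ⟨C, hC⟩ := exists_cubic_bound (c := 2 / 3 * η) (by positivity) (2 * |a|) (|d| + 1)
  refine ⟨Real.exp C * |K|, fun z h1 h2 h3 => ?_⟩
  rw [norm_mul, Complex.norm_exp]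
  have hre : (z ^ 3 / 3 + a * z ^ 2 + d * z).re =
      (z.re ^ 3 - 3 * z.re * z.im ^ 2) / 3 + a * (z.re ^ 2 - z.im ^ 2) + d * z.re := by
    simp only [pow_succ, pow_zero, one_mul, Complex.add_re, Complex.mul_re, Complex.ofReal_re,
      Complex.ofReal_im, Complex.mul_im, Complex.div_ofNat_re]
    ring
  have hb : (z ^ 3 / 3 + a * z ^ 2 + d * z).re ≤ C - |z.im| := by
    rw [hre]
    have hY := hC |z.im| (abs_nonneg _)
    rw [← sq_abs z.im]
    set Y := |z.im|
    set X := z.re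
    have hY0 : 0 ≤ Y := abs_nonneg _
    have hX0 : 0 ≤ X := le_trans (by positivity) h2
    have e1 : X ^ 2 ≤ Y ^ 2 := by gcongr
    have e2 : X ^ 3 ≤ X * Y ^ 2 := by nlinarith
    have e3 : η * Y * Y ^ 2 ≤ X * Y ^ 2 := by gcongr
    have e4 : a * (X ^ 2 - Y ^ 2) ≤ |a| * (2 * Y ^ 2) := by
      have : |a * (X ^ 2 - Y ^ 2)| ≤ |a| * (2 * Y ^ 2) := by
        rw [abs_mul]; gcongr; rw [abs_le]; constructor <;> nlinarith [sq_nonneg X, sq_nonneg Y]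
      exact (le_abs_self _).trans this
    have e5 : d * X ≤ |d| * Y := by
      have : |d * X| ≤ |d| * Y := by rw [abs_mul, abs_of_nonneg hX0]; gcongr
      exact (le_abs_self _).trans this
    nlinarith
  calc _ ≤ Real.exp (C - |z.im|) * |K| := by
        gcongr
        exact (hk z h1).trans (le_abs_self K)
    _ = Real.exp C * |K| * Real.exp (-|z.im|) := by rw [sub_eq_add_neg, Real.exp_add]; ring

/-- Differentiation under the integral sign: on a disc around `Z` of radius half its horizontal gap
to the curve, all denominators stay bounded below by that radius. -/
theorem cauchyTransform_differentiableOn {M W : ℝ → ℂ} {β : ℝ} (hM : IntegrableOn M (Ioi 0))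
    (hW : Continuous W) (hre : ∀ s > 0, (W s).re ≤ β) :
    DifferentiableOn ℂ (fun Z => ∫ s in Ioi (0 : ℝ), M s / (Z - W s)) {z | β < z.re} := by
  intro Z hZ
  simp only [mem_ofPred_eq] at hZ
  set δ := (Z.re - β) / 2 with hδ
  have hδ0 : 0 < δ := by rw [hδ]; linarith
  have hfar : ∀ s > 0, ∀ z ∈ Metric.ball Z δ, δ ≤ ‖z - W s‖ := by
    intro s hs z hz
    have h1 : |(z - Z).re| < δ :=
      (Complex.abs_re_le_norm _).trans_lt (by rw [← dist_eq_norm]; exact hz)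
    have h2 := Complex.abs_re_le_norm (z - W s)
    rw [Complex.sub_re, abs_lt] at h1
    rw [Complex.sub_re] at h2
    have h3 := le_abs_self (z.re - (W s).re)
    have h4 := hre s hs
    linarith [h1.1]
  have hmeas : ∀ z : ℂ, AEStronglyMeasurable (fun s => M s / (z - W s))
      (volume.restrict (Ioi 0)) := fun z =>
    (hM.aestronglyMeasurable.aemeasurable.div
      (measurable_const.sub hW.measurable).aemeasurable).aestronglyMeasurable
  have hmeas' : AEStronglyMeasurable (fun s => -M s / (Z - W s) ^ 2)
      (volume.restrict (Ioi 0)) :=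
    (hM.aestronglyMeasurable.aemeasurable.neg.div
      ((measurable_const.sub hW.measurable).pow_const 2).aemeasurable).aestronglyMeasurable
  refine (hasDerivAt_integral_of_dominated_loc_of_deriv_le
    (F := fun z s => M s / (z - W s)) (F' := fun z s => -M s / (z - W s) ^ 2)
    (bound := fun s => ‖M s‖ / δ ^ 2)
    (Metric.ball_mem_nhds Z hδ0) (Eventually.of_forall hmeas) ?_ hmeas' ?_ ?_ ?_).2
    |>.differentiableAt.differentiableWithinAt
  · refine (hM.norm.div_const δ).mono' (hmeas Z) ?_
    filter_upwards [ae_restrict_mem measurableSet_Ioi] with s hs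
    rw [norm_div]
    gcongr
    exact hfar s hs Z (Metric.mem_ball_self hδ0)
  · filter_upwards [ae_restrict_mem measurableSet_Ioi] with s hs z hz
    rw [norm_div, norm_neg, norm_pow]
    gcongr
    exact hfar s hs z hz
  · exact hM.norm.div_const _
  · filter_upwards [ae_restrict_mem measurableSet_Ioi] with s hs z hz
    have hne : z - W s ≠ 0 := norm_pos_iff.1 (hδ0.trans_le (hfar s hs z hz))
    have h := (hasDerivAt_const z (M s)).div ((hasDerivAt_id z).sub_const (W s)) hne
    rw [zero_mul, zero_sub, mul_one] at h
    exact h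

theorem cauchyTransform_norm_le {M W : ℝ → ℂ} {β : ℝ} (hM : IntegrableOn M (Ioi 0))
    (hre : ∀ s > 0, (W s).re ≤ β) {Z : ℂ} (hZ : β + 1 ≤ Z.re) :
    ‖∫ s in Ioi (0 : ℝ), M s / (Z - W s)‖ ≤ ∫ s in Ioi (0 : ℝ), ‖M s‖ := by
  refine norm_integral_le_of_norm_le hM.norm ?_
  filter_upwards [ae_restrict_mem measurableSet_Ioi] with s hs
  rw [norm_div]
  refine div_le_self (norm_nonneg _) ?_
  have h2 := Complex.abs_re_le_norm (Z - W s)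
  rw [Complex.sub_re] at h2
  have h3 := le_abs_self (Z.re - (W s).re)
  linarith [hre s hs]

theorem cos_lt_sin_pi_div_three : Real.cos (Real.pi / 3) < Real.sin (Real.pi / 3) := by
  rw [Real.cos_pi_div_three, Real.sin_pi_div_three]
  have : (1 : ℝ) < √3 := by
    rw [Real.lt_sqrt] <;> norm_num
  linarith

theorem cos_pi_div_three_pos : 0 < Real.cos (Real.pi / 3) := by
  rw [Real.cos_pi_div_three]; norm_num

/-- The inner contour integral of the limiting kernel, after the reflection `w ↦ -w`. -/
noncomputable def innerIntegral (a d β : ℝ) (Z : ℂ) : ℂ :=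
  wedgeIntegral β (Real.pi / 3) fun V =>
    Complex.exp (V ^ 3 / 3 + a * V ^ 2 + d * V) / (Z + V)

/-- Each ray contributes a Cauchy transform of an integrable density. Holomorphy and boundedness in
`Z` are what the deformation of the outer contour requires. -/
theorem innerIntegral_spec (a d β : ℝ) :
    DifferentiableOn ℂ (innerIntegral a d β) {z | -β < z.re} ∧
      ∃ K, ∀ z : ℂ, -β + 1 ≤ z.re → ‖innerIntegral a d β z‖ ≤ K := by
  set f : ℂ → ℂ := fun V => Complex.exp (V ^ 3 / 3 + a * V ^ 2 + d * V) with hf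
  have hdiff : DifferentiableOn ℂ f {z | β - 1 < z.re} := by
    apply Differentiable.differentiableOn; rw [hf]; fun_prop
  -- The half-plane starts at `β - 1` so that the vertex `β` is an interior point.
  have hdec : DecaysInSectors (β - 1) f := by
    have := decaysInSectors_exp_cubic_mul a d (b := β - 1) (K := 1) (k := fun _ => 1) (by simp)
    simpa only [mul_one] using this
  have hI : ∀ (ε φ : ℝ), (ε = 1 ∨ ε = -1) → 0 < Real.cos φ → Real.cos φ < ε * Real.sin φ →
      IntegrableOn (fun s : ℝ => f (ptRay β φ s) * Complex.exp (φ * Complex.I)) (Ioi 0) :=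
    fun ε φ hε h0 h1 =>
      (integrableOn_ptRay hε hdiff hdec (p := β) (by simp) h0 h1).mul_const _
  have hre : ∀ φ : ℝ, 0 < Real.cos φ → ∀ s > 0, (-ptRay β φ s).re ≤ -β := by
    intro φ h0 s hs
    rw [Complex.neg_re, ptRay_re]
    have := mul_pos hs h0
    simp only [Complex.ofReal_re]; linarith
  have hc : ∀ φ : ℝ, Continuous fun s => -ptRay β φ s := fun φ => (continuous_ptRay β φ).neg
  have c1 := cos_pi_div_three_pos
  have c2 := cos_lt_sin_pi_div_three
  have i1 := hI 1 (Real.pi / 3) (Or.inl rfl) c1 (by simpa using c2)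
  have i2 := hI (-1) (-(Real.pi / 3)) (Or.inr rfl) (by simp) (by simpa using c2)
  have heq : innerIntegral a d β = fun Z =>
      (∫ s in Ioi (0 : ℝ), (f (ptRay β (Real.pi / 3) s) *
        Complex.exp ((Real.pi / 3 : ℝ) * Complex.I)) / (Z - -ptRay β (Real.pi / 3) s)) -
      ∫ s in Ioi (0 : ℝ), (f (ptRay β (-(Real.pi / 3)) s) *
        Complex.exp ((-(Real.pi / 3) : ℝ) * Complex.I)) / (Z - -ptRay β (-(Real.pi / 3)) s) := by
    funext Z
    unfold innerIntegral wedgeIntegral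
    have r3 : Complex.exp (-((Real.pi / 3 : ℝ) * Complex.I)) =
        Complex.exp ((-(Real.pi / 3) : ℝ) * Complex.I) := by push_cast; ring_nf
    rw [r3]
    congr 1
    · refine setIntegral_congr_fun measurableSet_Ioi fun s _ => ?_
      simp only [hf, rayPoint, ptRay, sub_neg_eq_add]; ring
    · refine setIntegral_congr_fun measurableSet_Ioi fun s _ => ?_
      simp only [hf, rayPoint, ptRay, sub_neg_eq_add]; ring
  rw [heq]
  constructor
  · exact (cauchyTransform_differentiableOn i1 (hc _) (hre _ c1)).sub
      (cauchyTransform_differentiableOn i2 (hc _) (hre _ (by simp)))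
  · refine ⟨_, fun z hz => (norm_sub_le _ _).trans (add_le_add
      (cauchyTransform_norm_le i1 (hre _ c1) hz)
      (cauchyTransform_norm_le i2 (hre _ (by simp)) hz))⟩

/-- The only pole in `V` is at `-Z`, which lies to the left of both vertices. -/
theorem innerIntegral_indep (a d : ℝ) {β β' : ℝ} {Z : ℂ} (h : -β < Z.re) (h' : -β' < Z.re) :
    innerIntegral a d β Z = innerIntegral a d β' Z := by
  have hdiff : DifferentiableOn ℂ
      (fun V : ℂ => Complex.exp (V ^ 3 / 3 + a * V ^ 2 + d * V) * (Z + V)⁻¹)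
      {v | -Z.re < v.re} := by
    intro V hV
    simp only [mem_ofPred_eq] at hV
    have hne : Z + V ≠ 0 := by
      intro h0
      have := congrArg Complex.re h0
      simp only [Complex.add_re, Complex.zero_re] at this
      linarith
    have h1 : DifferentiableAt ℂ (fun V : ℂ => (Z + V)⁻¹) V :=
      ((differentiableAt_const Z).add differentiableAt_id).inv hne
    have h2 : DifferentiableAt ℂ
      (fun V : ℂ => Complex.exp (V ^ 3 / 3 + a * V ^ 2 + d * V)) V := by fun_prop
    exact (h2.mul h1).differentiableWithinAt
  have hdec := decaysInSectors_exp_cubic_mul a d (b := -Z.re) (K := 1) (k := fun V => (Z + V)⁻¹)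
    (by
      intro V hV
      rw [norm_inv]
      apply inv_le_one_of_one_le₀
      have h2 := Complex.abs_re_le_norm (Z + V)
      rw [Complex.add_re] at h2
      linarith [le_abs_self (Z.re + V.re)])
  unfold innerIntegral
  simp only [div_eq_mul_inv _ (Z + _)]
  exact wedgeIntegral_eq_wedgeIntegral hdiff hdec (by linarith) (by linarith)
    cos_pi_div_three_pos cos_lt_sin_pi_div_three

theorem wedgeIntegral_const_mul (a φ : ℝ) (k : ℂ) (f : ℂ → ℂ) :
    wedgeIntegral a φ (fun z => k * f z) = k * wedgeIntegral a φ f := by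
  unfold wedgeIntegral
  simp only [mul_assoc, integral_const_mul]
  ring

theorem wedgeIntegral_congr {a φ : ℝ} {f g : ℂ → ℂ} (h0 : 0 < Real.cos φ)
    (h : ∀ z : ℂ, a ≤ z.re → f z = g z) : wedgeIntegral a φ f = wedgeIntegral a φ g := by
  have hr : ∀ ψ s : ℝ, Real.cos ψ = Real.cos φ → 0 < s → a ≤ (rayPoint a ψ s).re := by
    intro ψ s hψ hs
    rw [rayPoint_re, hψ]
    linarith [mul_pos hs h0]
  unfold wedgeIntegral
  congr 1
  · exact setIntegral_congr_fun measurableSet_Ioi fun s hs => by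
      simp only [h _ (hr φ s rfl hs)]
  · exact setIntegral_congr_fun measurableSet_Ioi fun s hs => by
      simp only [h _ (hr (-φ) s (Real.cos_neg φ) hs)]

/-- The integrand of the limiting double contour integral. -/
noncomputable def limitIntegrand (a b x y : ℝ) (Z W : ℂ) : ℂ :=
  Complex.exp (Z ^ 3 / 3 + a * Z ^ 2 - x * Z) *
    Complex.exp (-(W ^ 3 / 3 + b * W ^ 2 - y * W)) / (Z - W)

theorem wedgeIntegral_limitIntegrand (a b x y β : ℝ) (Z : ℂ) :
    wedgeIntegral β (2 * Real.pi / 3) (limitIntegrand a b x y Z) =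
      Complex.exp (Z ^ 3 / 3 + a * Z ^ 2 + (-x : ℝ) * Z) * innerIntegral (-b) (-y) (-β) Z := by
  rw [wedgeIntegral_neg, innerIntegral, ← wedgeIntegral_const_mul]
  congr 1
  funext V
  unfold limitIntegrand
  rw [sub_neg_eq_add, mul_div_assoc]
  congr 3
  · push_cast; ring
  · push_cast; ring

/-- The contours are moved one at a time so that the pole `Z = W` is never crossed: the outer vertex
goes to some `A` to the right of everything, the inner vertex then moves from `0` to `β`, and the
outer one returns from `A` to `α`. -/
theorem truncatedWedge_limitIntegrand (a b x y : ℝ) {α β ρ θ : ℝ} (hαβ : β < α)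
    (h0 : 0 < Real.cos θ) (h1 : Real.cos θ < Real.sin θ) (hρ : 0 < ρ) :
    truncatedWedgeIntegral ρ θ (fun Z =>
        wedgeIntegral 0 (2 * Real.pi / 3) (limitIntegrand a b x y Z)) =
      wedgeIntegral α (Real.pi / 3) fun Z =>
        wedgeIntegral β (2 * Real.pi / 3) (limitIntegrand a b x y Z) := by
  simp only [wedgeIntegral_limitIntegrand]
  have key : ∀ γ : ℝ,
      DifferentiableOn ℂ (fun Z : ℂ => Complex.exp (Z ^ 3 / 3 + a * Z ^ 2 + (-x : ℝ) * Z) *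
        innerIntegral (-b) (-y) (-γ) Z) {z | γ < z.re} ∧
      DecaysInSectors γ (fun Z : ℂ => Complex.exp (Z ^ 3 / 3 + a * Z ^ 2 + (-x : ℝ) * Z) *
        innerIntegral (-b) (-y) (-γ) Z) := by
    intro γ
    obtain ⟨hd, K, hK⟩ := innerIntegral_spec (-b) (-y) (-γ)
    rw [neg_neg] at hd hK
    refine ⟨DifferentiableOn.mul (Differentiable.differentiableOn (by fun_prop)) hd, ?_⟩
    exact decaysInSectors_exp_cubic_mul a (-x) hK
  have c1 := cos_pi_div_three_pos
  have c2 := cos_lt_sin_pi_div_three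
  obtain ⟨A, hA⟩ := exists_gt (max 0 β)
  have hA0 : 0 < A := (le_max_left _ _).trans_lt hA
  have hAβ : β < A := (le_max_right _ _).trans_lt hA
  rw [← wedgeIntegral_eq_truncated (key 0).1 (key 0).2 hA0 c1 c2 h0 h1 (by positivity),
    wedgeIntegral_eq_wedgeIntegral (key β).1 (key β).2 hαβ hAβ c1 c2]
  refine wedgeIntegral_congr c1 fun Z hZ => ?_
  rw [innerIntegral_indep (-b) (-y) (β := -0) (β' := -β) (by simp; linarith)
    (by simp; linarith)]

theorem wedgeIntegral_shift (α φ a : ℝ) (f : ℂ → ℂ) :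
    wedgeIntegral (α + a) φ f = wedgeIntegral α φ fun z => f (z + a) := by
  have h : ∀ ψ s : ℝ, rayPoint (α + a) ψ s = rayPoint α ψ s + a := by
    intro ψ s; simp only [rayPoint]; push_cast; ring
  unfold wedgeIntegral
  simp only [h]

/-- Completing the cube: with `z = Z + a` and `w = W + b` the quadratic terms `a Z²` and `b W²`
appear, the linear coefficients `x + a²` and `y + b²` reduce to `x` and `y`, and the denominator
becomes `Z - W`. -/
theorem airy_doubleIntegral_eq (a b x y α β : ℝ) :
    Complex.exp (2 * a ^ 3 / 3 - 2 * b ^ 3 / 3 + a * x - b * y) *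
      (wedgeIntegral (α + a) (Real.pi / 3) fun z =>
        wedgeIntegral (β + b) (2 * Real.pi / 3) fun w =>
          Complex.exp (z ^ 3 / 3 - (x + a ^ 2 : ℝ) * z - w ^ 3 / 3 + (y + b ^ 2 : ℝ) * w) /
            (z + (-a : ℝ) - w - (-b : ℝ))) =
      wedgeIntegral α (Real.pi / 3) fun Z =>
        wedgeIntegral β (2 * Real.pi / 3) (limitIntegrand a b x y Z) := by
  simp only [wedgeIntegral_shift]
  rw [← wedgeIntegral_const_mul]
  congr 1
  funext Z
  rw [← wedgeIntegral_const_mul]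
  congr 1
  funext W
  unfold limitIntegrand
  rw [← Complex.exp_add, mul_div_assoc', ← Complex.exp_add]
  congr 1
  · congr 1; push_cast; ring
  · push_cast; ring


/-! ### Rescaled contours and dominated convergence -/

/-- The points of the rescaled limit of a contour; the arc disappears in the limit. -/
noncomputable def limitPoint (θ ρ : ℝ) : Fin 4 → ℝ → ℂ :=
  ![rayPoint 0 (-θ), segmentPath (rayPoint 0 (-θ) ρ) (rayPoint 0 θ ρ), rayPoint 0 θ, fun _ => 0]

/-- The derivative along the rescaled limit of a contour, cut off to the domain of the
parametrization. -/
noncomputable def limitWeight (θ ρ : ℝ) : Fin 4 → ℝ → ℂ :=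
  ![(Ioi ρ).indicator fun _ => -Complex.exp (-(θ * Complex.I)),
    (Ioc 0 1).indicator fun _ => rayPoint 0 θ ρ - rayPoint 0 (-θ) ρ,
    (Ioi ρ).indicator fun _ => Complex.exp (θ * Complex.I), fun _ => 0]

/-- The points of `C(x, θ, R, ρ / m)`, parametrized at scale `m⁻¹` around `x`. -/
noncomputable def scaledPoint (x θ R ρ m : ℝ) : Fin 4 → ℝ → ℂ :=
  ![fun v => x + limitPoint θ ρ 0 v / m, fun v => x + limitPoint θ ρ 1 v / m,
    fun v => x + limitPoint θ ρ 2 v / m, arcPath R (Complex.arg (rayPoint x θ (rayDist x θ R)))]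

/-- `m` times the derivative of `scaledPoint`, cut off to the domain of the parametrization. -/
noncomputable def scaledWeight (x θ R ρ m : ℝ) : Fin 4 → ℝ → ℂ :=
  ![(Ioc ρ (m * rayDist x θ R)).indicator fun _ => -Complex.exp (-(θ * Complex.I)),
    (Ioc 0 1).indicator fun _ => rayPoint 0 θ ρ - rayPoint 0 (-θ) ρ,
    (Ioc ρ (m * rayDist x θ R)).indicator fun _ => Complex.exp (θ * Complex.I),
    (Ioc 0 1).indicator fun v =>
      m * deriv (arcPath R (Complex.arg (rayPoint x θ (rayDist x θ R)))) v]

theorem rayDist_neg (x θ R : ℝ) : rayDist x (-θ) R = rayDist x θ R := by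
  unfold rayDist
  congr 1
  ext t
  have : ‖(x : ℂ) + t * Complex.exp ((-θ : ℝ) * Complex.I)‖ =
      ‖(x : ℂ) + t * Complex.exp (θ * Complex.I)‖ := by
    rw [← Complex.norm_conj]
    congr 1
    simp only [map_add, map_mul, Complex.conj_ofReal, ← Complex.exp_conj, Complex.conj_I]
    push_cast; ring_nf
  rw [mem_ofPred_eq, mem_ofPred_eq, this]

theorem hasDerivAt_segmentPath (a b : ℂ) (u : ℝ) : HasDerivAt (segmentPath a b) (b - a) u := by
  have h := ((hasDerivAt_id u).ofReal_comp.mul_const (b - a)).const_add a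
  rwa [Complex.ofReal_one, one_mul] at h

theorem rayPoint_div (x θ v m : ℝ) : rayPoint x θ (v / m) = x + rayPoint 0 θ v / m := by
  simp only [rayPoint]; push_cast; ring

theorem integral_segment_ray (x θ m s₀ s₁ : ℝ) (hm : 0 < m) (f : ℂ → ℂ) :
    ∫ u in (0 : ℝ)..1, f (segmentPath (rayPoint x θ (s₀ / m)) (rayPoint x θ (s₁ / m)) u) *
        deriv (segmentPath (rayPoint x θ (s₀ / m)) (rayPoint x θ (s₁ / m))) u =
      (m : ℂ)⁻¹ * ∫ v in s₀..s₁, f (x + rayPoint 0 θ v / m) * Complex.exp (θ * Complex.I) := by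
  have h := intervalIntegral.smul_integral_comp_mul_add (a := 0) (b := 1)
    (fun v => f (x + rayPoint 0 θ v / m) * Complex.exp (θ * Complex.I)) (s₁ - s₀) s₀
  have e1 : (s₁ - s₀) * 0 + s₀ = s₀ := by ring
  have e2 : (s₁ - s₀) * 1 + s₀ = s₁ := by ring
  rw [e1, e2] at h
  rw [← h, Complex.real_smul, ← mul_assoc, ← intervalIntegral.integral_const_mul]
  have hm' : (m : ℂ) ≠ 0 := by exact_mod_cast hm.ne'
  refine intervalIntegral.integral_congr fun u _ => ?_
  simp only [(hasDerivAt_segmentPath _ _ u).deriv]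
  have e3 : segmentPath (rayPoint x θ (s₀ / m)) (rayPoint x θ (s₁ / m)) u =
      x + rayPoint 0 θ ((s₁ - s₀) * u + s₀) / m := by
    simp only [segmentPath, rayPoint]; push_cast; field_simp; ring
  rw [e3]
  have e4 : rayPoint x θ (s₁ / m) - rayPoint x θ (s₀ / m) =
      (m : ℂ)⁻¹ * ((s₁ - s₀ : ℝ) : ℂ) * Complex.exp (θ * Complex.I) := by
    simp only [rayPoint]; push_cast; field_simp; ring
  rw [e4]; ring

/-- Storing the cut-off in the weight turns all integrals, for every `N`, into integrals over the
whole line, as dominated convergence needs. -/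
theorem integral_mul_indicator (S : Set ℝ) (hS : MeasurableSet S) (f w : ℝ → ℂ) :
    ∫ v, f v * S.indicator w v = ∫ v in S, f v * w v := by
  rw [← integral_indicator hS]
  congr 1
  funext v
  by_cases hv : v ∈ S <;> simp [hv]

/-- The substitution `v = m · distance` turns the two segments on the rays into unit-speed integrals
over `(ρ, m · rayDist]` and extracts the Jacobian `m⁻¹`. The arc is not rescaled, and its weight
carries the compensating factor `m`. -/
theorem contourIntegral_contourPiece {x θ R ρ m : ℝ} (hm : 0 < m)
    (hD : ρ ≤ m * rayDist x θ R) (f : ℂ → ℂ) :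
    contourIntegral (contourPiece x θ R (ρ / m)) f =
      (m : ℂ)⁻¹ * ∑ i, ∫ v, f (scaledPoint x θ R ρ m i v) * scaledWeight x θ R ρ m i v := by
  have hm' : (m : ℂ) ≠ 0 := by exact_mod_cast hm.ne'
  have hDm : rayDist x θ R = m * rayDist x θ R / m := by field_simp
  have p0 : ∫ u in (0 : ℝ)..1, f (contourPiece x θ R (ρ / m) 0 u) *
      deriv (contourPiece x θ R (ρ / m) 0) u =
      (m : ℂ)⁻¹ * ∫ v, f (scaledPoint x θ R ρ m 0 v) * scaledWeight x θ R ρ m 0 v := by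
    have e : contourPiece x θ R (ρ / m) 0 = segmentPath
        (rayPoint x (-θ) (m * rayDist x θ R / m)) (rayPoint x (-θ) (ρ / m)) := by
      rw [← hDm, ← rayDist_neg]; rfl
    rw [e, integral_segment_ray x (-θ) m _ _ hm f, intervalIntegral.integral_symm,
      intervalIntegral.integral_of_le hD, ← integral_neg]
    simp only [scaledPoint, scaledWeight, limitPoint, Matrix.cons_val_zero]
    rw [integral_mul_indicator _ measurableSet_Ioc]
    congr 2
    funext v
    push_cast; ring_nf
  have p2 : ∫ u in (0 : ℝ)..1, f (contourPiece x θ R (ρ / m) 2 u) *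
      deriv (contourPiece x θ R (ρ / m) 2) u =
      (m : ℂ)⁻¹ * ∫ v, f (scaledPoint x θ R ρ m 2 v) * scaledWeight x θ R ρ m 2 v := by
    have e : contourPiece x θ R (ρ / m) 2 = segmentPath
        (rayPoint x θ (ρ / m)) (rayPoint x θ (m * rayDist x θ R / m)) := by
      rw [← hDm]; rfl
    rw [e, integral_segment_ray x θ m _ _ hm f, intervalIntegral.integral_of_le hD]
    change _ = (m : ℂ)⁻¹ * ∫ v, f (x + rayPoint 0 θ v / m) *
      (Ioc ρ (m * rayDist x θ R)).indicator (fun _ => Complex.exp (θ * Complex.I)) v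
    rw [integral_mul_indicator _ measurableSet_Ioc]
  have p1 : ∫ u in (0 : ℝ)..1, f (contourPiece x θ R (ρ / m) 1 u) *
      deriv (contourPiece x θ R (ρ / m) 1) u =
      (m : ℂ)⁻¹ * ∫ v, f (scaledPoint x θ R ρ m 1 v) * scaledWeight x θ R ρ m 1 v := by
    have e : contourPiece x θ R (ρ / m) 1 = segmentPath
        (rayPoint x (-θ) (ρ / m)) (rayPoint x θ (ρ / m)) := rfl
    change _ = (m : ℂ)⁻¹ * ∫ v,
      f (x + segmentPath (rayPoint 0 (-θ) ρ) (rayPoint 0 θ ρ) v / m) *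
      (Ioc 0 1).indicator (fun _ => rayPoint 0 θ ρ - rayPoint 0 (-θ) ρ) v
    rw [e, integral_mul_indicator _ measurableSet_Ioc, ← intervalIntegral.integral_of_le
      zero_le_one, ← intervalIntegral.integral_const_mul]
    refine intervalIntegral.integral_congr fun u _ => ?_
    simp only [(hasDerivAt_segmentPath _ _ u).deriv, rayPoint_div]
    have e3 : segmentPath (x + rayPoint 0 (-θ) ρ / m) (x + rayPoint 0 θ ρ / m) u =
        x + segmentPath (rayPoint 0 (-θ) ρ) (rayPoint 0 θ ρ) u / m := by
      simp only [segmentPath]; ring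
    rw [e3]; ring
  have p3 : ∫ u in (0 : ℝ)..1, f (contourPiece x θ R (ρ / m) 3 u) *
      deriv (contourPiece x θ R (ρ / m) 3) u =
      (m : ℂ)⁻¹ * ∫ v, f (scaledPoint x θ R ρ m 3 v) * scaledWeight x θ R ρ m 3 v := by
    change _ = (m : ℂ)⁻¹ * ∫ v,
      f (arcPath R (Complex.arg (rayPoint x θ (rayDist x θ R))) v) *
      (Ioc 0 1).indicator (fun v =>
        m * deriv (arcPath R (Complex.arg (rayPoint x θ (rayDist x θ R)))) v) v
    rw [integral_mul_indicator _ measurableSet_Ioc, ← intervalIntegral.integral_of_le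
      zero_le_one, ← intervalIntegral.integral_const_mul]
    refine intervalIntegral.integral_congr fun u _ => ?_
    change f (arcPath R (Complex.arg (rayPoint x θ (rayDist x θ R))) u) *
      deriv (arcPath R (Complex.arg (rayPoint x θ (rayDist x θ R)))) u = _
    field_simp
  unfold contourIntegral
  rw [Fin.sum_univ_four, Fin.sum_univ_four, p0, p1, p2, p3]
  ring

theorem hasDerivAt_arcPath (R φ u : ℝ) :
    HasDerivAt (arcPath R φ)
      (arcPath R φ u * ((2 * Real.pi - 2 * φ : ℝ) * Complex.I)) u := by
  have h1 : HasDerivAt (fun u : ℝ => φ + u * (2 * Real.pi - 2 * φ)) (2 * Real.pi - 2 * φ) u := by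
    simpa using ((hasDerivAt_id u).mul_const (2 * Real.pi - 2 * φ)).const_add φ
  have h2 := ((h1.ofReal_comp.mul_const Complex.I).cexp).const_mul (R : ℂ)
  rw [← mul_assoc] at h2
  exact h2

theorem norm_arcPath {R : ℝ} (hR : 0 ≤ R) (φ u : ℝ) : ‖arcPath R φ u‖ = R := by
  unfold arcPath
  rw [norm_mul, Complex.norm_exp_ofReal_mul_I, mul_one, Complex.norm_real,
    Real.norm_of_nonneg hR]

theorem continuous_arcPath (R φ : ℝ) : Continuous (arcPath R φ) :=
  continuous_iff_continuousAt.2 fun u => (hasDerivAt_arcPath R φ u).continuousAt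

theorem continuous_rayPoint (x θ : ℝ) : Continuous (rayPoint x θ) := by
  unfold rayPoint; fun_prop

theorem continuous_segmentPath (a b : ℂ) : Continuous (segmentPath a b) := by
  unfold segmentPath; fun_prop

theorem measurable_limitPoint (θ ρ : ℝ) (i : Fin 4) : Measurable (limitPoint θ ρ i) := by
  fin_cases i
  · exact (continuous_rayPoint 0 (-θ)).measurable
  · exact (continuous_segmentPath _ _).measurable
  · exact (continuous_rayPoint 0 θ).measurable
  · exact measurable_const

theorem measurable_scaledPoint (x θ R ρ m : ℝ) (i : Fin 4) :
    Measurable (scaledPoint x θ R ρ m i) := by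
  fin_cases i
  · exact ((measurable_limitPoint θ ρ 0).div_const _).const_add _
  · exact ((measurable_limitPoint θ ρ 1).div_const _).const_add _
  · exact ((measurable_limitPoint θ ρ 2).div_const _).const_add _
  · exact (continuous_arcPath _ _).measurable

theorem measurable_scaledWeight (x θ R ρ m : ℝ) (i : Fin 4) :
    Measurable (scaledWeight x θ R ρ m i) := by
  fin_cases i
  · exact measurable_const.indicator measurableSet_Ioc
  · exact measurable_const.indicator measurableSet_Ioc
  · exact measurable_const.indicator measurableSet_Ioc
  · exact ((measurable_deriv _).const_mul _).indicator measurableSet_Ioc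

/-- The integral along the rescaled limit of a contour. -/
noncomputable def limitContourIntegral (θ ρ : ℝ) (f : ℂ → ℂ) : ℂ :=
  ∑ i, ∫ v, f (limitPoint θ ρ i v) * limitWeight θ ρ i v

theorem limitContourIntegral_eq (θ ρ : ℝ) (f : ℂ → ℂ) :
    limitContourIntegral θ ρ f = truncatedWedgeIntegral ρ θ f := by
  unfold limitContourIntegral truncatedWedgeIntegral
  rw [Fin.sum_univ_four]
  change (∫ v, f (rayPoint 0 (-θ) v) *
      (Ioi ρ).indicator (fun _ => -Complex.exp (-(θ * Complex.I))) v) +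
    (∫ v, f (segmentPath (rayPoint 0 (-θ) ρ) (rayPoint 0 θ ρ) v) *
      (Ioc 0 1).indicator (fun _ => rayPoint 0 θ ρ - rayPoint 0 (-θ) ρ) v) +
    (∫ v, f (rayPoint 0 θ v) * (Ioi ρ).indicator (fun _ => Complex.exp (θ * Complex.I)) v) +
    (∫ v : ℝ, f 0 * 0) = _
  rw [integral_mul_indicator _ measurableSet_Ioi, integral_mul_indicator _ measurableSet_Ioc,
    integral_mul_indicator _ measurableSet_Ioi]
  simp only [mul_neg, integral_neg, mul_zero, integral_zero, add_zero]

theorem truncatedWedgeIntegral_zero (θ : ℝ) (f : ℂ → ℂ) :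
    truncatedWedgeIntegral 0 θ f = wedgeIntegral 0 θ f := by
  unfold truncatedWedgeIntegral wedgeIntegral
  have h : rayPoint 0 θ 0 - rayPoint 0 (-θ) 0 = 0 := by simp [rayPoint]
  simp only [h, mul_zero, integral_zero, add_zero]
  ring

/-- A sequence of functions `E N` on the contours `C(x, θ, R N, ρ / m N)` which, after rescaling by
`m N` around `x`, is dominated by an integrable function and converges to `Elim` on the rescaled
limit of the contours. -/
structure DominatedFamily (x θ ρ : ℝ) (R m : ℕ → ℝ) (E : ℕ → ℂ → ℂ) (Elim : ℂ → ℂ) :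
    Prop where
  meas : ∀ N, Measurable (E N)
  pos : ∀ᶠ N in atTop, 0 < m N ∧ ρ ≤ m N * rayDist x θ (R N)
  bound : ∃ g : Fin 4 → ℝ → ℝ, (∀ i, Integrable (g i)) ∧ ∀ᶠ N in atTop, ∀ i v,
    ‖E N (scaledPoint x θ (R N) ρ (m N) i v) * scaledWeight x θ (R N) ρ (m N) i v‖ ≤ g i v
  -- Bounds on prefactors are available only where the prelimit weight is nonzero; this carries them
  -- to the points that matter in the limit.
  weight_ne_zero : ∀ i v, limitWeight θ ρ i v ≠ 0 →
    ∀ᶠ N in atTop, scaledWeight x θ (R N) ρ (m N) i v ≠ 0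
  lim : ∀ i v, Tendsto (fun N => E N (scaledPoint x θ (R N) ρ (m N) i v) *
    scaledWeight x θ (R N) ρ (m N) i v) atTop
      (𝓝 (Elim (limitPoint θ ρ i v) * limitWeight θ ρ i v))

theorem scaledPoint_of_ne (x θ R ρ m : ℝ) {i : Fin 4} (hi : i ≠ 3) (v : ℝ) :
    scaledPoint x θ R ρ m i v = x + limitPoint θ ρ i v / m := by
  fin_cases i
  · rfl
  · rfl
  · rfl
  · exact absurd rfl hi

theorem limitWeight_ne_zero_imp {θ ρ v : ℝ} {i : Fin 4} (h : limitWeight θ ρ i v ≠ 0) :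
    i ≠ 3 := by
  rintro rfl; exact h rfl

/-- Where the main factor tends to zero, boundedness of the prefactor is enough. This covers the
arc, whose points do not converge to the rescaled limit. -/
theorem tendsto_mul_of_bounded {A k : ℕ → ℂ} {a b : ℂ} {C : ℝ}
    (hA : Tendsto A atTop (𝓝 a)) (hk : ∀ᶠ N in atTop, A N ≠ 0 → ‖k N‖ ≤ C)
    (hlim : a ≠ 0 → Tendsto k atTop (𝓝 b)) :
    Tendsto (fun N => A N * k N) atTop (𝓝 (a * b)) := by
  by_cases ha : a = 0
  · subst ha
    rw [zero_mul]
    refine squeeze_zero_norm' (a := fun N => ‖A N‖ * C) ?_ ?_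
    · filter_upwards [hk] with N hN
      by_cases h : A N = 0
      · simp [h]
      · rw [norm_mul]; gcongr; exact hN h
    · simpa using hA.norm.mul_const C
  · exact hA.mul (hlim ha)

/-- Dominated convergence with the work divided: the exponential `E` supplies the integrable
majorant, and the prefactor `k` only has to be bounded and pointwise convergent off the arc. -/
theorem tendsto_contourIntegral {x θ ρ : ℝ} {R m : ℕ → ℝ} {E : ℕ → ℂ → ℂ} {Elim : ℂ → ℂ}
    (hE : DominatedFamily x θ ρ R m E Elim) {k : ℕ → ℂ → ℂ} {klim : ℂ → ℂ} {C : ℝ}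
    (hk : ∀ N, Measurable (k N))
    (hkC : ∀ᶠ N in atTop, ∀ i v, scaledWeight x θ (R N) ρ (m N) i v ≠ 0 →
      ‖k N (scaledPoint x θ (R N) ρ (m N) i v)‖ ≤ C)
    (hklim : ∀ i v, limitWeight θ ρ i v ≠ 0 →
      Tendsto (fun N => k N (x + limitPoint θ ρ i v / m N)) atTop
        (𝓝 (klim (limitPoint θ ρ i v)))) :
    Tendsto (fun N => (m N : ℂ) *
        contourIntegral (contourPiece x θ (R N) (ρ / m N)) fun z => E N z * k N z) atTop
      (𝓝 (limitContourIntegral θ ρ fun Z => Elim Z * klim Z)) := by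
  obtain ⟨g, hgi, hg⟩ := hE.bound
  have hmain : Tendsto (fun N => ∑ i, ∫ v,
      E N (scaledPoint x θ (R N) ρ (m N) i v) * scaledWeight x θ (R N) ρ (m N) i v *
        k N (scaledPoint x θ (R N) ρ (m N) i v)) atTop
      (𝓝 (∑ i, ∫ v, Elim (limitPoint θ ρ i v) * limitWeight θ ρ i v *
        klim (limitPoint θ ρ i v))) := by
    refine tendsto_finsetSum _ fun i _ => ?_
    refine tendsto_integral_filter_of_dominated_convergence (fun v => g i v * |C|)
      (Eventually.of_forall fun N => ?_) ?_ ((hgi i).mul_const _)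
      (Eventually.of_forall fun v => ?_)
    · exact ((((hE.meas N).comp (measurable_scaledPoint _ _ _ _ _ i)).mul
        (measurable_scaledWeight _ _ _ _ _ i)).mul
        ((hk N).comp (measurable_scaledPoint _ _ _ _ _ i))).aestronglyMeasurable
    · filter_upwards [hg, hkC] with N h1 h2
      refine Eventually.of_forall fun v => ?_
      by_cases hw : scaledWeight x θ (R N) ρ (m N) i v = 0
      · have := (norm_nonneg _).trans (h1 i v)
        simp only [hw, mul_zero, zero_mul, norm_zero]
        positivity
      · rw [norm_mul]
        exact mul_le_mul (h1 i v) ((h2 i v hw).trans (le_abs_self C)) (norm_nonneg _)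
          ((norm_nonneg _).trans (h1 i v))
    · refine tendsto_mul_of_bounded (C := C) (hE.lim i v) ?_ fun hne => ?_
      · filter_upwards [hkC] with N h2 hne
        exact h2 i v (right_ne_zero_of_mul hne)
      · have hi := right_ne_zero_of_mul hne
        simp only [scaledPoint_of_ne _ _ _ _ _ (limitWeight_ne_zero_imp hi)]
        exact hklim i v hi
  have hlim : (∑ i, ∫ v, Elim (limitPoint θ ρ i v) * limitWeight θ ρ i v *
      klim (limitPoint θ ρ i v)) = limitContourIntegral θ ρ fun Z => Elim Z * klim Z := by
    unfold limitContourIntegral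
    refine Finset.sum_congr rfl fun i _ => ?_
    congr 1; funext v; ring
  rw [hlim] at hmain
  refine hmain.congr' ?_
  filter_upwards [hE.pos] with N hN
  have hm' : (m N : ℂ) ≠ 0 := by exact_mod_cast hN.1.ne'
  rw [contourIntegral_contourPiece hN.1 hN.2, ← mul_assoc, mul_inv_cancel₀ hm', one_mul]
  refine Finset.sum_congr rfl fun i _ => ?_
  congr 1; funext v; ring

/-- Dominated convergence is applied twice, to the inner and then to the outer integral, with the
product of the two majorants; the prefactor need not factorize. -/
theorem tendsto_contourIntegral₂ {x θ ρ θ' ρ' : ℝ} {R R' m : ℕ → ℝ} {E E' : ℕ → ℂ → ℂ}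
    {Elim Elim' : ℂ → ℂ} (hE : DominatedFamily x θ ρ R m E Elim)
    (hE' : DominatedFamily x θ' ρ' R' m E' Elim') {k : ℕ → ℂ → ℂ → ℂ} {klim : ℂ → ℂ → ℂ} {C : ℝ}
    (hk : ∀ N, Measurable (Function.uncurry (k N)))
    (hkC : ∀ᶠ N in atTop, ∀ i v j w, scaledWeight x θ (R N) ρ (m N) i v ≠ 0 →
      scaledWeight x θ' (R' N) ρ' (m N) j w ≠ 0 →
      ‖k N (scaledPoint x θ (R N) ρ (m N) i v) (scaledPoint x θ' (R' N) ρ' (m N) j w)‖ ≤ C)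
    (hklim : ∀ i v j w, limitWeight θ ρ i v ≠ 0 → limitWeight θ' ρ' j w ≠ 0 →
      Tendsto (fun N => k N (x + limitPoint θ ρ i v / m N) (x + limitPoint θ' ρ' j w / m N)) atTop
        (𝓝 (klim (limitPoint θ ρ i v) (limitPoint θ' ρ' j w)))) :
    Tendsto (fun N => (m N : ℂ) ^ 2 *
        contourIntegral (contourPiece x θ (R N) (ρ / m N)) fun z =>
          contourIntegral (contourPiece x θ' (R' N) (ρ' / m N)) fun w =>
            E N z * E' N w * k N z w) atTop
      (𝓝 (limitContourIntegral θ ρ fun Z => limitContourIntegral θ' ρ' fun W =>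
        Elim Z * Elim' W * klim Z W)) := by
  obtain ⟨g, hgi, hg⟩ := hE.bound
  obtain ⟨g', hgi', hg'⟩ := hE'.bound
  let A : ℕ → Fin 4 → ℝ → ℂ := fun N i v =>
    E N (scaledPoint x θ (R N) ρ (m N) i v) * scaledWeight x θ (R N) ρ (m N) i v
  let A' : ℕ → Fin 4 → ℝ → ℂ := fun N i v =>
    E' N (scaledPoint x θ' (R' N) ρ' (m N) i v) * scaledWeight x θ' (R' N) ρ' (m N) i v
  let kk : ℕ → Fin 4 → Fin 4 → ℝ → ℝ → ℂ := fun N i j v w =>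
    k N (scaledPoint x θ (R N) ρ (m N) i v) (scaledPoint x θ' (R' N) ρ' (m N) j w)
  have hA : ∀ N i, Measurable (A N i) := fun N i =>
    ((hE.meas N).comp (measurable_scaledPoint _ _ _ _ _ i)).mul (measurable_scaledWeight _ _ _ _ _ i)
  have hA' : ∀ N i, Measurable (A' N i) := fun N i =>
    ((hE'.meas N).comp (measurable_scaledPoint _ _ _ _ _ i)).mul
      (measurable_scaledWeight _ _ _ _ _ i)
  have hmeas : ∀ N i j, Measurable (Function.uncurry fun v w =>
      A N i v * A' N j w * kk N i j v w) := by
    intro N i j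
    refine (((hA N i).comp measurable_fst).mul ((hA' N j).comp measurable_snd)).mul ?_
    exact (hk N).comp (((measurable_scaledPoint _ _ _ _ _ i).comp measurable_fst).prodMk
      ((measurable_scaledPoint _ _ _ _ _ j).comp measurable_snd))
  have hbd : ∀ᶠ N in atTop, ∀ i j v w,
      ‖A N i v * A' N j w * kk N i j v w‖ ≤ g i v * g' j w * |C| := by
    filter_upwards [hg, hg', hkC] with N h1 h2 h3 i j v w
    have n1 := (norm_nonneg _).trans (h1 i v)
    have n2 := (norm_nonneg _).trans (h2 j w)
    by_cases hw : scaledWeight x θ (R N) ρ (m N) i v = 0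
    · simp only [A, hw, mul_zero, zero_mul, norm_zero]; positivity
    by_cases hw' : scaledWeight x θ' (R' N) ρ' (m N) j w = 0
    · simp only [A', hw', mul_zero, zero_mul, norm_zero]; positivity
    rw [norm_mul, norm_mul]
    exact mul_le_mul (mul_le_mul (h1 i v) (h2 j w) (norm_nonneg _) n1)
      ((h3 i v j w hw hw').trans (le_abs_self C)) (norm_nonneg _) (mul_nonneg n1 n2)
  have hpt : ∀ i j v w, Tendsto (fun N => A N i v * A' N j w * kk N i j v w) atTop
      (𝓝 (Elim (limitPoint θ ρ i v) * limitWeight θ ρ i v *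
        (Elim' (limitPoint θ' ρ' j w) * limitWeight θ' ρ' j w) *
          klim (limitPoint θ ρ i v) (limitPoint θ' ρ' j w))) := by
    intro i j v w
    refine tendsto_mul_of_bounded (C := C) ((hE.lim i v).mul (hE'.lim j w)) ?_ fun hne => ?_
    · filter_upwards [hkC] with N h3 hne
      exact h3 i v j w (right_ne_zero_of_mul (left_ne_zero_of_mul hne))
        (right_ne_zero_of_mul (right_ne_zero_of_mul hne))
    · have hi := right_ne_zero_of_mul (left_ne_zero_of_mul hne)
      have hj := right_ne_zero_of_mul (right_ne_zero_of_mul hne)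
      simp only [kk, scaledPoint_of_ne _ _ _ _ _ (limitWeight_ne_zero_imp hi),
        scaledPoint_of_ne _ _ _ _ _ (limitWeight_ne_zero_imp hj)]
      exact hklim i v j w hi hj
  have hmain : Tendsto (fun N => ∑ i, ∫ v, ∑ j, ∫ w, A N i v * A' N j w * kk N i j v w) atTop
      (𝓝 (∑ i, ∫ v, ∑ j, ∫ w, Elim (limitPoint θ ρ i v) * limitWeight θ ρ i v *
        (Elim' (limitPoint θ' ρ' j w) * limitWeight θ' ρ' j w) *
          klim (limitPoint θ ρ i v) (limitPoint θ' ρ' j w))) := by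
    refine tendsto_finsetSum _ fun i _ => ?_
    refine tendsto_integral_filter_of_dominated_convergence
      (fun v => g i v * ∑ j, (∫ w, g' j w) * |C|)
      (Eventually.of_forall fun N => ?_) ?_ ((hgi i).mul_const _)
      (Eventually.of_forall fun v => ?_)
    · refine (Finset.stronglyMeasurable_fun_sum _ fun j _ => ?_).aestronglyMeasurable
      exact (hmeas N i j).stronglyMeasurable.integral_prod_right
    · filter_upwards [hbd] with N hN
      refine Eventually.of_forall fun v => ?_
      rw [Finset.mul_sum]
      refine norm_sum_le_of_le _ fun j _ => ?_
      have hint : Integrable fun w => g i v * g' j w * |C| :=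
        ((hgi' j).const_mul _).mul_const _
      refine (norm_integral_le_of_norm_le hint (Eventually.of_forall (hN i j v))).trans ?_
      rw [integral_mul_const, integral_const_mul, mul_assoc]
    · refine tendsto_finsetSum _ fun j _ => ?_
      refine tendsto_integral_filter_of_dominated_convergence
        (fun w => g i v * g' j w * |C|)
        (Eventually.of_forall fun N => ?_) ?_ (((hgi' j).const_mul _).mul_const _)
        (Eventually.of_forall fun w => hpt i j v w)
      · exact ((hmeas N i j).comp measurable_prodMk_left).aestronglyMeasurable
      · filter_upwards [hbd] with N hN
        exact Eventually.of_forall (hN i j v)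
  have hlim : (∑ i, ∫ v, ∑ j, ∫ w, Elim (limitPoint θ ρ i v) * limitWeight θ ρ i v *
        (Elim' (limitPoint θ' ρ' j w) * limitWeight θ' ρ' j w) *
          klim (limitPoint θ ρ i v) (limitPoint θ' ρ' j w)) =
      limitContourIntegral θ ρ fun Z => limitContourIntegral θ' ρ' fun W =>
        Elim Z * Elim' W * klim Z W := by
    unfold limitContourIntegral
    refine Finset.sum_congr rfl fun i _ => ?_
    congr 1; funext v
    rw [Finset.sum_mul]
    refine Finset.sum_congr rfl fun j _ => ?_
    rw [← integral_mul_const]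
    congr 1; funext w; ring
  rw [hlim] at hmain
  refine hmain.congr' ?_
  filter_upwards [hE.pos, hE'.pos] with N hN hN'
  have hm' : (m N : ℂ) ≠ 0 := by exact_mod_cast hN.1.ne'
  simp only [contourIntegral_contourPiece hN.1 hN.2, contourIntegral_contourPiece hN'.1 hN'.2]
  rw [sq, mul_assoc, ← mul_assoc _ (m N : ℂ)⁻¹, mul_inv_cancel₀ hm', one_mul, Finset.mul_sum]
  refine Finset.sum_congr rfl fun i _ => ?_
  rw [← integral_const_mul]
  congr 1; funext v
  rw [← mul_assoc, ← mul_assoc, mul_inv_cancel₀ hm', one_mul, Finset.sum_mul]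
  refine Finset.sum_congr rfl fun j _ => ?_
  rw [← integral_mul_const]
  congr 1; funext w
  simp only [A, A', kk]; ring

theorem contourIntegral_const_mul (γ : Fin 4 → ℝ → ℂ) (k : ℂ) (f : ℂ → ℂ) :
    contourIntegral γ (fun z => k * f z) = k * contourIntegral γ f := by
  unfold contourIntegral
  simp only [mul_assoc, intervalIntegral.integral_const_mul, Finset.mul_sum]

theorem limitContourIntegral_zero (θ ρ : ℝ) : limitContourIntegral θ ρ (fun _ => 0) = 0 := by
  simp [limitContourIntegral]

theorem tendsto_contourIntegral_of_div {x θ ρ : ℝ} {R m : ℕ → ℝ} {E : ℕ → ℂ → ℂ} {Elim : ℂ → ℂ}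
    (hE : DominatedFamily x θ ρ R m E Elim) {K : ℕ → ℂ → ℂ} {klim : ℂ → ℂ} {C : ℝ}
    (hK : ∀ N, Measurable (K N))
    (hKC : ∀ᶠ N in atTop, ∀ i v, scaledWeight x θ (R N) ρ (m N) i v ≠ 0 →
      ‖K N (scaledPoint x θ (R N) ρ (m N) i v)‖ ≤ C * m N)
    (hklim : ∀ i v, limitWeight θ ρ i v ≠ 0 →
      Tendsto (fun N => K N (x + limitPoint θ ρ i v / m N) / m N) atTop
        (𝓝 (klim (limitPoint θ ρ i v)))) :
    Tendsto (fun N =>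
        contourIntegral (contourPiece x θ (R N) (ρ / m N)) fun z => E N z * K N z) atTop
      (𝓝 (limitContourIntegral θ ρ fun Z => Elim Z * klim Z)) := by
  have h := tendsto_contourIntegral hE (k := fun N z => K N z / m N) (C := C)
    (fun N => (hK N).div_const _) ?_ hklim
  · refine h.congr' ?_
    filter_upwards [hE.pos] with N hN
    have hm' : (m N : ℂ) ≠ 0 := by exact_mod_cast hN.1.ne'
    rw [← contourIntegral_const_mul]
    congr 1; funext z; field_simp
  · filter_upwards [hE.pos, hKC] with N hN h1 i v hw
    rw [norm_div, Complex.norm_real, Real.norm_of_nonneg hN.1.le, div_le_iff₀ hN.1]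
    exact h1 i v hw

/-- The two Jacobians `m⁻¹` are absorbed into the prefactor, so a prefactor of order `m²` gives a
finite limit. -/
theorem tendsto_contourIntegral₂_of_div {x θ ρ θ' ρ' : ℝ} {R R' m : ℕ → ℝ} {E E' : ℕ → ℂ → ℂ}
    {Elim Elim' : ℂ → ℂ} (hE : DominatedFamily x θ ρ R m E Elim)
    (hE' : DominatedFamily x θ' ρ' R' m E' Elim') {K : ℕ → ℂ → ℂ → ℂ} {klim : ℂ → ℂ → ℂ} {C : ℝ}
    (hK : ∀ N, Measurable (Function.uncurry (K N)))
    (hKC : ∀ᶠ N in atTop, ∀ i v j w, scaledWeight x θ (R N) ρ (m N) i v ≠ 0 →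
      scaledWeight x θ' (R' N) ρ' (m N) j w ≠ 0 →
      ‖K N (scaledPoint x θ (R N) ρ (m N) i v) (scaledPoint x θ' (R' N) ρ' (m N) j w)‖ ≤
        C * m N ^ 2)
    (hklim : ∀ i v j w, limitWeight θ ρ i v ≠ 0 → limitWeight θ' ρ' j w ≠ 0 →
      Tendsto (fun N => K N (x + limitPoint θ ρ i v / m N)
        (x + limitPoint θ' ρ' j w / m N) / (m N : ℂ) ^ 2) atTop
        (𝓝 (klim (limitPoint θ ρ i v) (limitPoint θ' ρ' j w)))) :
    Tendsto (fun N =>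
        contourIntegral (contourPiece x θ (R N) (ρ / m N)) fun z =>
          contourIntegral (contourPiece x θ' (R' N) (ρ' / m N)) fun w =>
            E N z * E' N w * K N z w) atTop
      (𝓝 (limitContourIntegral θ ρ fun Z => limitContourIntegral θ' ρ' fun W =>
        Elim Z * Elim' W * klim Z W)) := by
  have h := tendsto_contourIntegral₂ hE hE' (k := fun N z w => K N z w / (m N : ℂ) ^ 2) (C := C)
    (fun N => (hK N).div_const _) ?_ hklim
  · refine h.congr' ?_
    filter_upwards [hE.pos] with N hN
    have hm' : (m N : ℂ) ≠ 0 := by exact_mod_cast hN.1.ne'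
    rw [← contourIntegral_const_mul]
    congr 1; funext z
    rw [← contourIntegral_const_mul]
    congr 1; funext w; field_simp
  · filter_upwards [hE.pos, hKC] with N hN h1 i v j w hw hw'
    rw [norm_div, norm_pow, Complex.norm_real, Real.norm_of_nonneg hN.1.le,
      div_le_iff₀ (pow_pos hN.1 2)]
    exact h1 i v j w hw hw'

theorem tendsto_contourIntegral_zero {x θ ρ : ℝ} {R m : ℕ → ℝ} {E : ℕ → ℂ → ℂ} {Elim : ℂ → ℂ}
    (hE : DominatedFamily x θ ρ R m E Elim) {K : ℕ → ℂ → ℂ} {ε : ℕ → ℝ}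
    (hε : Tendsto ε atTop (𝓝 0)) (hK : ∀ N, Measurable (K N))
    (hKC : ∀ᶠ N in atTop, ∀ i v, scaledWeight x θ (R N) ρ (m N) i v ≠ 0 →
      ‖K N (scaledPoint x θ (R N) ρ (m N) i v)‖ ≤ ε N * m N) :
    Tendsto (fun N =>
        contourIntegral (contourPiece x θ (R N) (ρ / m N)) fun z => E N z * K N z) atTop
      (𝓝 0) := by
  have h := tendsto_contourIntegral_of_div hE (K := K) (klim := fun _ => 0) (C := 1) hK ?_ ?_
  · simpa only [mul_zero, limitContourIntegral_zero] using h
  · filter_upwards [hKC, hε.eventually_lt_const one_pos, hE.pos] with N h1 h2 h3 i v hw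
    refine (h1 i v hw).trans ?_
    have := h3.1
    gcongr
  · intro i v hne
    refine squeeze_zero_norm' ?_ hε
    filter_upwards [hKC, hE.pos, hE.weight_ne_zero i v hne] with N h1 h2 h3
    rw [← scaledPoint_of_ne x θ (R N) ρ (m N) (limitWeight_ne_zero_imp hne) v,
      norm_div, Complex.norm_real, Real.norm_of_nonneg h2.1.le, div_le_iff₀ h2.1]
    exact h1 i v h3

theorem tendsto_contourIntegral₂_zero {x θ ρ θ' ρ' : ℝ} {R R' m : ℕ → ℝ} {E E' : ℕ → ℂ → ℂ}
    {Elim Elim' : ℂ → ℂ} (hE : DominatedFamily x θ ρ R m E Elim)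
    (hE' : DominatedFamily x θ' ρ' R' m E' Elim') {K : ℕ → ℂ → ℂ → ℂ} {ε : ℕ → ℝ}
    (hε : Tendsto ε atTop (𝓝 0)) (hK : ∀ N, Measurable (Function.uncurry (K N)))
    (hKC : ∀ᶠ N in atTop, ∀ i v j w, scaledWeight x θ (R N) ρ (m N) i v ≠ 0 →
      scaledWeight x θ' (R' N) ρ' (m N) j w ≠ 0 →
      ‖K N (scaledPoint x θ (R N) ρ (m N) i v) (scaledPoint x θ' (R' N) ρ' (m N) j w)‖ ≤
        ε N * m N ^ 2) :
    Tendsto (fun N =>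
        contourIntegral (contourPiece x θ (R N) (ρ / m N)) fun z =>
          contourIntegral (contourPiece x θ' (R' N) (ρ' / m N)) fun w =>
            E N z * E' N w * K N z w) atTop (𝓝 0) := by
  have h := tendsto_contourIntegral₂_of_div hE hE' (K := K) (klim := fun _ _ => 0) (C := 1) hK
    ?_ ?_
  · simpa only [mul_zero, limitContourIntegral_zero] using h
  · filter_upwards [hKC, hε.eventually_lt_const one_pos, hE.pos] with N h1 h2 h3 i v j w hw hw'
    refine (h1 i v j w hw hw').trans ?_
    gcongr
  · intro i v j w hne hne'
    refine squeeze_zero_norm' ?_ hε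
    filter_upwards [hKC, hE.pos, hE.weight_ne_zero i v hne, hE'.weight_ne_zero j w hne']
      with N h1 h2 h3 h4
    rw [← scaledPoint_of_ne x θ (R N) ρ (m N) (limitWeight_ne_zero_imp hne) v,
      ← scaledPoint_of_ne x θ' (R' N) ρ' (m N) (limitWeight_ne_zero_imp hne') w,
      norm_div, norm_pow, Complex.norm_real, Real.norm_of_nonneg h2.1.le,
      div_le_iff₀ (pow_pos h2.1 2)]
    exact h1 i v j w h3 h4


/-! ### Domination from bounds on the exponent -/

theorem norm_deriv_arcPath_arg_le {R : ℝ} (hR : 0 ≤ R) (z : ℂ) (u : ℝ) :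
    ‖deriv (arcPath R (Complex.arg z)) u‖ ≤ R * (4 * Real.pi) := by
  rw [(hasDerivAt_arcPath R _ u).deriv, norm_mul, norm_arcPath hR, norm_mul, Complex.norm_I,
    mul_one, Complex.norm_real, Real.norm_eq_abs]
  gcongr
  rw [abs_le]
  have h1 := Complex.neg_pi_lt_arg z
  have h2 := Complex.arg_le_pi z
  have h3 := Real.pi_pos
  constructor <;> linarith

theorem scaledWeight_three_of_notMem {x θ R ρ m v : ℝ} (hv : v ∉ Ioc (0 : ℝ) 1) :
    scaledWeight x θ R ρ m 3 v = 0 := by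
  change (Ioc (0 : ℝ) 1).indicator (fun v => (m : ℂ) *
    deriv (arcPath R (Complex.arg (rayPoint x θ (rayDist x θ R)))) v) v = 0
  rw [indicator_of_notMem hv]

/-- Three bounds on the real part of the exponent suffice: Gaussian decay on the rays, boundedness
on the short connecting segment, and on the arc a bound `b N` whose exponential beats the factor `m
N` in the weight. -/
theorem DominatedFamily.of_phase {x θ ρ : ℝ} {R m : ℕ → ℝ} {Φ : ℕ → ℂ → ℂ} {Φlim : ℂ → ℂ}
    (hmeas : ∀ N, Measurable (Φ N)) (hm : Tendsto m atTop atTop)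
    (hmD : Tendsto (fun N => m N * rayDist x θ (R N)) atTop atTop)
    {B : ℝ} (hR : ∀ᶠ N in atTop, 0 ≤ R N ∧ R N ≤ B)
    {C c : ℝ} (hc : 0 < c)
    (hray : ∀ᶠ N in atTop, ∀ v, ρ < v → v ≤ m N * rayDist x θ (R N) → ∀ ψ, ψ = θ ∨ ψ = -θ →
      (Φ N (x + rayPoint 0 ψ v / m N)).re ≤ C - c * v ^ 2)
    {C' : ℝ} (hloc : ∀ᶠ N in atTop, ∀ v ∈ Ioc (0 : ℝ) 1,
      (Φ N (x + limitPoint θ ρ 1 v / m N)).re ≤ C')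
    {b : ℕ → ℝ} (hb : Tendsto (fun N => m N * Real.exp (b N)) atTop (𝓝 0))
    (harc : ∀ᶠ N in atTop, ∀ v ∈ Ioc (0 : ℝ) 1,
      (Φ N (arcPath (R N) (Complex.arg (rayPoint x θ (rayDist x θ (R N)))) v)).re ≤ b N)
    (hlim : ∀ Z : ℂ, Tendsto (fun N => Φ N (x + Z / m N)) atTop (𝓝 (Φlim Z))) :
    DominatedFamily x θ ρ R m (fun N z => Complex.exp (Φ N z))
      (fun Z => Complex.exp (Φlim Z)) := by
  have hgauss : Integrable fun v : ℝ => Real.exp (C - c * v ^ 2) := by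
    have := (integrable_exp_neg_mul_sq hc).const_mul (Real.exp C)
    refine this.congr (Eventually.of_forall fun v => ?_)
    simp only [← Real.exp_add]; ring_nf
  have hone : ∀ K : ℝ, Integrable ((Ioc (0 : ℝ) 1).indicator fun _ => K) := fun K =>
    (integrable_indicator_iff measurableSet_Ioc).2 (integrableOn_const (by simp))
  have hpos : ∀ᶠ N in atTop, 0 < m N := hm.eventually_gt_atTop 0
  have harcb : ∀ᶠ N in atTop, ∀ v ∈ Ioc (0 : ℝ) 1,
      ‖Complex.exp (Φ N (scaledPoint x θ (R N) ρ (m N) 3 v)) *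
        scaledWeight x θ (R N) ρ (m N) 3 v‖ ≤ m N * Real.exp (b N) * (B * (4 * Real.pi)) := by
    filter_upwards [harc, hR, hpos] with N h1 h2 h3 v hv
    change ‖Complex.exp (Φ N (arcPath (R N) (Complex.arg (rayPoint x θ (rayDist x θ (R N)))) v)) *
      (Ioc (0 : ℝ) 1).indicator (fun v => (m N : ℂ) *
        deriv (arcPath (R N) (Complex.arg (rayPoint x θ (rayDist x θ (R N))))) v) v‖ ≤ _
    rw [indicator_of_mem hv, norm_mul, norm_mul, Complex.norm_exp, Complex.norm_real,
      Real.norm_of_nonneg h3.le]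
    have e1 := norm_deriv_arcPath_arg_le h2.1 (rayPoint x θ (rayDist x θ (R N))) v
    have e2 : R N * (4 * Real.pi) ≤ B * (4 * Real.pi) := by
      have := Real.pi_pos
      gcongr; exact h2.2
    calc _ ≤ Real.exp (b N) * (m N * (B * (4 * Real.pi))) := by
          gcongr
          · exact h1 v hv
          · exact e1.trans e2
      _ = _ := by ring
  have hbB : Tendsto (fun N => m N * Real.exp (b N) * (B * (4 * Real.pi))) atTop (𝓝 0) := by
    simpa using hb.mul_const (B * (4 * Real.pi))
  have hind : ∀ (w : ℂ) (v : ℝ), ∀ᶠ N in atTop,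
      (Ioc ρ (m N * rayDist x θ (R N))).indicator (fun _ => w) v =
        (Ioi ρ).indicator (fun _ => w) v := by
    intro w v
    filter_upwards [hmD.eventually_ge_atTop v] with N hN
    by_cases hv : ρ < v
    · rw [indicator_of_mem (show v ∈ Ioc ρ _ from ⟨hv, hN⟩),
        indicator_of_mem (show v ∈ Ioi ρ from hv)]
    · rw [indicator_of_notMem (show v ∉ Ioc ρ _ from fun h => hv h.1),
        indicator_of_notMem (show v ∉ Ioi ρ from hv)]
  refine ⟨fun N => (hmeas N).cexp, ?_, ?_, ?_, ?_⟩
  · exact hpos.and (hmD.eventually_ge_atTop ρ)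
  -- The arc contribution tends to zero uniformly, hence is eventually at most `1` there.
  · refine ⟨![fun v => Real.exp (C - c * v ^ 2),
      (Ioc (0 : ℝ) 1).indicator fun _ =>
        Real.exp C' * ‖rayPoint 0 θ ρ - rayPoint 0 (-θ) ρ‖,
      fun v => Real.exp (C - c * v ^ 2), (Ioc (0 : ℝ) 1).indicator fun _ => 1], ?_, ?_⟩
    · intro i
      fin_cases i
      · exact hgauss
      · exact hone _
      · exact hgauss
      · exact hone _
    · filter_upwards [hray, hloc, harcb, hbB.eventually_le_const (zero_lt_one' ℝ)]
        with N h1 h2 h3 h4 i v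
      have hone_exp : ‖Complex.exp (-(θ * Complex.I))‖ = 1 := by
        have := norm_exp_angle (-θ)
        rwa [Complex.ofReal_neg, neg_mul] at this
      fin_cases i
      · change ‖Complex.exp (Φ N (x + rayPoint 0 (-θ) v / m N)) *
          (Ioc ρ (m N * rayDist x θ (R N))).indicator
            (fun _ => -Complex.exp (-(θ * Complex.I))) v‖ ≤ Real.exp (C - c * v ^ 2)
        by_cases hv : v ∈ Ioc ρ (m N * rayDist x θ (R N))
        · rw [indicator_of_mem hv, norm_mul, norm_neg, hone_exp, mul_one, Complex.norm_exp]
          exact Real.exp_le_exp.2 (h1 v hv.1 hv.2 _ (Or.inr rfl))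
        · rw [indicator_of_notMem hv, mul_zero, norm_zero]; positivity
      · change ‖Complex.exp (Φ N (x + limitPoint θ ρ 1 v / m N)) *
          (Ioc (0 : ℝ) 1).indicator (fun _ => rayPoint 0 θ ρ - rayPoint 0 (-θ) ρ) v‖ ≤
          (Ioc (0 : ℝ) 1).indicator (fun _ =>
            Real.exp C' * ‖rayPoint 0 θ ρ - rayPoint 0 (-θ) ρ‖) v
        by_cases hv : v ∈ Ioc (0 : ℝ) 1
        · rw [indicator_of_mem hv, indicator_of_mem hv, norm_mul, Complex.norm_exp]
          gcongr
          exact h2 v hv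
        · rw [indicator_of_notMem hv, indicator_of_notMem hv, mul_zero, norm_zero]
      · change ‖Complex.exp (Φ N (x + rayPoint 0 θ v / m N)) *
          (Ioc ρ (m N * rayDist x θ (R N))).indicator
            (fun _ => Complex.exp (θ * Complex.I)) v‖ ≤ Real.exp (C - c * v ^ 2)
        by_cases hv : v ∈ Ioc ρ (m N * rayDist x θ (R N))
        · rw [indicator_of_mem hv, norm_mul, norm_exp_angle, mul_one, Complex.norm_exp]
          exact Real.exp_le_exp.2 (h1 v hv.1 hv.2 _ (Or.inl rfl))
        · rw [indicator_of_notMem hv, mul_zero, norm_zero]; positivity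
      · change ‖_‖ ≤ (Ioc (0 : ℝ) 1).indicator (fun _ => (1 : ℝ)) v
        by_cases hv : v ∈ Ioc (0 : ℝ) 1
        · rw [indicator_of_mem hv]
          exact (h3 v hv).trans h4
        · rw [indicator_of_notMem hv]
          change ‖_ * scaledWeight x θ (R N) ρ (m N) 3 v‖ ≤ _
          rw [scaledWeight_three_of_notMem hv, mul_zero, norm_zero]
  · intro i v hne
    fin_cases i
    · filter_upwards [hind (-Complex.exp (-(θ * Complex.I))) v] with N hN
      exact fun h0 => hne (hN.symm.trans h0)
    · exact Eventually.of_forall fun _ => hne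
    · filter_upwards [hind (Complex.exp (θ * Complex.I)) v] with N hN
      exact fun h0 => hne (hN.symm.trans h0)
    · exact absurd rfl hne
  · intro i v
    fin_cases i
    · refine ((hlim (rayPoint 0 (-θ) v)).cexp.mul_const
        ((Ioi ρ).indicator (fun _ => -Complex.exp (-(θ * Complex.I))) v)).congr' ?_
      filter_upwards [hind (-Complex.exp (-(θ * Complex.I))) v] with N hN
      rw [← hN]; rfl
    · exact (hlim (limitPoint θ ρ 1 v)).cexp.mul_const _
    · refine ((hlim (rayPoint 0 θ v)).cexp.mul_const
        ((Ioi ρ).indicator (fun _ => Complex.exp (θ * Complex.I)) v)).congr' ?_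
      filter_upwards [hind (Complex.exp (θ * Complex.I)) v] with N hN
      rw [← hN]; rfl
    · change Tendsto _ _ (𝓝 (_ * 0))
      rw [mul_zero]
      by_cases hv : v ∈ Ioc (0 : ℝ) 1
      · refine squeeze_zero_norm' ?_ hbB
        filter_upwards [harcb] with N hN
        exact hN v hv
      · refine tendsto_const_nhds.congr fun N => ?_
        change _ = _ * scaledWeight x θ (R N) ρ (m N) 3 v
        rw [scaledWeight_three_of_notMem hv, mul_zero]


/-! ### The parameters -/

section Parameters

variable {q κ : ℝ}

theorem one_sub_sq_pos (hq0 : 0 < q) (hq1 : q < 1) : 0 < 1 - q ^ 2 := by nlinarith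

theorem sigmaOne_pos (hq0 : 0 < q) (hq1 : q < 1) (hk0 : 0 < κ) : 0 < sigmaOne q κ := by
  have := one_sub_sq_pos hq0 hq1
  have := Real.sqrt_pos.2 hk0
  unfold sigmaOne; positivity

theorem fOne_pos (hq0 : 0 < q) (hk0 : 0 < κ) : 0 < fOne q κ := by
  have := Real.sqrt_pos.2 hk0
  unfold fOne; positivity

/-- With the cube roots of `q`, `q + √κ`, `√κ` and `1 + q√κ` as variables, `σ₁` and `f₁` become
rational, and identities between their powers reduce to field arithmetic. -/
theorem sigmaOne_eq_fOne_eq (hq0 : 0 < q) (hk0 : 0 < κ) :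
    ∃ u v w y : ℝ, 0 < u ∧ 0 < v ∧ 0 < w ∧ 0 < y ∧ u ^ 3 = q ∧ v ^ 3 = q + √κ ∧ w ^ 3 = √κ ∧
      y ^ 3 = 1 + q * √κ ∧ sigmaOne q κ = u * v ^ 5 / (w * (1 - q ^ 2) * y) ∧
      fOne q κ = u / (2 * w ^ 4 * v * y) := by
  have hs := Real.sqrt_pos.2 hk0
  have key : ∀ (a r : ℝ) (n : ℕ), 0 < a → (a ^ r) ^ n = a ^ (r * n) := by
    intro a r n ha
    rw [← Real.rpow_natCast, ← Real.rpow_mul ha.le]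
  have h1 : 0 < q + √κ := by positivity
  have h2 : 0 < 1 + q * √κ := by positivity
  refine ⟨q ^ (1 / 3 : ℝ), (q + √κ) ^ (1 / 3 : ℝ), κ ^ (1 / 6 : ℝ), (1 + q * √κ) ^ (1 / 3 : ℝ),
    by positivity, by positivity, by positivity, by positivity, ?_, ?_, ?_, ?_, ?_, ?_⟩
  · rw [key _ _ _ hq0]; norm_num
  · rw [key _ _ _ h1]; norm_num
  · rw [key _ _ _ hk0, Real.sqrt_eq_rpow]; norm_num
  · rw [key _ _ _ h2]; norm_num
  · rw [key _ _ _ h1]; unfold sigmaOne; norm_num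
  · rw [key _ _ _ hk0]; unfold fOne; norm_num

theorem one_lt_zCrit (hq0 : 0 < q) (hq1 : q < 1) (hk0 : 0 < κ) (hk1 : κ < 1) :
    1 < zCrit q κ := by
  have hs := Real.sqrt_pos.2 hk0
  have hs1 : √κ < 1 := by rw [Real.sqrt_lt' one_pos]; simpa using hk1
  unfold zCrit
  rw [one_lt_div (by positivity)]
  nlinarith

theorem one_sub_q_mul_zCrit (hq0 : 0 < q) (hk0 : 0 < κ) :
    1 - q * zCrit q κ = √κ * (1 - q ^ 2) / (q + √κ) := by
  have hs := Real.sqrt_pos.2 hk0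
  unfold zCrit; field_simp; ring

theorem zCrit_sub_q (hq0 : 0 < q) (hk0 : 0 < κ) :
    zCrit q κ - q = (1 - q ^ 2) / (q + √κ) := by
  have hs := Real.sqrt_pos.2 hk0
  unfold zCrit; field_simp; ring

theorem q_mul_zCrit_lt_one (hq0 : 0 < q) (hq1 : q < 1) (hk0 : 0 < κ) : q * zCrit q κ < 1 := by
  have hs := Real.sqrt_pos.2 hk0
  have h := one_sub_q_mul_zCrit hq0 hk0
  have := one_sub_sq_pos hq0 hq1
  have : 0 < √κ * (1 - q ^ 2) / (q + √κ) := by positivity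
  linarith

/-- The condition `(1 - qc)/(c - q) < √κ` rearranges to `z_c < c`. It keeps the pole at `c` outside
`γ_N`, which lies in the disc of radius `z_c`. -/
theorem zCrit_lt_of_kappaZero_lt {c : ℝ} (hq0 : 0 < q) (hq1 : q < 1) (hc : c ∈ Ioo 1 q⁻¹)
    (hκ : kappaZero q c < κ) : zCrit q κ < c := by
  have h1 : 0 < c - q := by linarith [hc.1]
  have h2 : 0 < 1 - q * c := by
    have := mul_lt_mul_of_pos_left hc.2 hq0
    rw [mul_inv_cancel₀ hq0.ne'] at this; linarith
  have h3 : (1 - q * c) / (c - q) < √κ := Real.lt_sqrt_of_sq_lt hκ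
  have hs : 0 < √κ := lt_trans (by positivity) h3
  rw [div_lt_iff₀ h1] at h3
  unfold zCrit
  rw [div_lt_iff₀ (by positivity)]
  nlinarith

/-- The derivative of `S₁` is `sCoeff (z - z_c)² / (z (z - q) (1 - q z))`. -/
noncomputable def sCoeff (q κ : ℝ) : ℝ := q * (q + √κ) ^ 2 / (1 - q ^ 2)

/-- The derivative of `G₁` is `gCoeff (z - z_c) / (z (1 - q z))`. -/
noncomputable def gCoeff (q κ : ℝ) : ℝ := q * (q + √κ) / ((1 - q ^ 2) * √κ)

theorem sCoeff_pos (hq0 : 0 < q) (hq1 : q < 1) (hk0 : 0 < κ) : 0 < sCoeff q κ := by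
  have := one_sub_sq_pos hq0 hq1
  have := Real.sqrt_pos.2 hk0
  unfold sCoeff; positivity

/-- The left side is half the third derivative of `S₁` at `z_c`, read off from the factorized form
of `S₁'`. -/
theorem sCoeff_div (hq0 : 0 < q) (hq1 : q < 1) (hk0 : 0 < κ) :
    sCoeff q κ / (zCrit q κ * (zCrit q κ - q) * (1 - q * zCrit q κ)) = sigmaOne q κ ^ 3 := by
  obtain ⟨u, v, w, y, hu, hv, hw, hy, eu, ev, ew, ey, eσ, -⟩ := sigmaOne_eq_fOne_eq hq0 hk0
  have h1 := one_sub_sq_pos hq0 hq1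
  have hs := Real.sqrt_pos.2 hk0
  rw [zCrit_sub_q hq0 hk0, one_sub_q_mul_zCrit hq0 hk0, eσ, div_pow, mul_pow, mul_pow, mul_pow,
    eu, ew, ey, ← pow_mul, show 5 * 3 = 3 * 5 from rfl, pow_mul, ev]
  unfold sCoeff zCrit
  field_simp

/-- The left side is the second derivative of `G₁` at `z_c`. -/
theorem gCoeff_div (hq0 : 0 < q) (hq1 : q < 1) (hk0 : 0 < κ) :
    gCoeff q κ / (zCrit q κ * (1 - q * zCrit q κ)) = 2 * fOne q κ * sigmaOne q κ ^ 2 := by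
  obtain ⟨u, v, w, y, hu, hv, hw, hy, eu, ev, ew, ey, eσ, ef⟩ := sigmaOne_eq_fOne_eq hq0 hk0
  have h1 := one_sub_sq_pos hq0 hq1
  have hs := Real.sqrt_pos.2 hk0
  have e : 2 * fOne q κ * sigmaOne q κ ^ 2 =
      u ^ 3 * (v ^ 3) ^ 3 / (w ^ 3 * w ^ 3 * (1 - q ^ 2) ^ 2 * y ^ 3) := by
    rw [eσ, ef]; field_simp
  rw [e, one_sub_q_mul_zCrit hq0 hk0, eu, ew, ey, ev]
  unfold gCoeff zCrit
  field_simp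

/-- The points at which the principal branches of all logarithms are holomorphic. -/
def IsRegular (q : ℝ) (z : ℂ) : Prop :=
  z ∈ Complex.slitPlane ∧ 1 - q / z ∈ Complex.slitPlane ∧ 1 - q * z ∈ Complex.slitPlane

theorem isRegular_of (hq0 : 0 < q) {z : ℂ} (hre : 0 < z.re) (hn : q < ‖z‖)
    (h : z.im ≠ 0 ∨ q * z.re < 1) : IsRegular q z := by
  refine ⟨Or.inl hre, Or.inl ?_, ?_⟩
  · have h1 : ‖(q : ℂ) / z‖ < 1 := by
      rw [norm_div, Complex.norm_real, Real.norm_of_nonneg hq0.le,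
        div_lt_one (hq0.trans hn)]
      exact hn
    have h2 := (Complex.re_le_norm ((q : ℂ) / z)).trans_lt h1
    rw [Complex.sub_re, Complex.one_re]; linarith
  · rcases h with h | h
    · right
      simp [hq0.ne', h]
    · left
      simp; linarith

/-- The constant `h₁` is the value for which the quadratic numerator of `S₁'` is a multiple of a
perfect square; this makes the critical point double. -/
theorem hasDerivAt_SOne (hq0 : 0 < q) (hq1 : q < 1) (hk0 : 0 < κ) {z : ℂ} (hz : IsRegular q z) :
    HasDerivAt (SOne q κ)
      (sCoeff q κ * (z - zCrit q κ) ^ 2 / (z * (z - q) * (1 - q * z))) z := by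
  obtain ⟨h1, h2, h3⟩ := hz
  have n1 : z ≠ 0 := Complex.slitPlane_ne_zero h1
  have n2' := Complex.slitPlane_ne_zero h2
  have n3 := Complex.slitPlane_ne_zero h3
  have n2 : z - q ≠ 0 := by
    intro h
    apply n2'
    rw [sub_eq_zero.1 h, div_self, sub_self]
    exact_mod_cast hq0.ne'
  have d1 : HasDerivAt (fun z : ℂ => 1 - q / z) (q / z ^ 2) z := by
    have h := (hasDerivAt_inv n1).const_mul (q : ℂ)
    refine (h.const_sub 1).congr_deriv ?_
    ring
  have d2 : HasDerivAt (fun z : ℂ => 1 - q * z) (-q) z := by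
    simpa using ((hasDerivAt_id z).const_mul (q : ℂ)).const_sub 1
  have d := ((d1.clog h2).sub ((d2.clog h3).const_mul (κ : ℂ))).sub
    ((Complex.hasDerivAt_log h1).const_mul (hOne q κ : ℂ))
  refine d.congr_deriv ?_
  have e2 : (1 : ℂ) - q / z = (z - q) / z := by field_simp
  rw [e2]
  have hs := Real.sqrt_pos.2 hk0
  have hsq : κ = √κ ^ 2 := (Real.sq_sqrt hk0.le).symm
  have hp : (1 - q ^ 2 : ℝ) ≠ 0 := (one_sub_sq_pos hq0 hq1).ne'
  have hr : (q + √κ : ℝ) ≠ 0 := by positivity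
  have hpc : (1 - (q : ℂ) ^ 2) ≠ 0 := by exact_mod_cast hp
  have hrc : ((q : ℂ) + (√κ : ℝ)) ≠ 0 := by exact_mod_cast hr
  unfold sCoeff hOne zCrit
  push_cast
  have hsqc : (κ : ℂ) = ((√κ : ℝ) : ℂ) ^ 2 := by exact_mod_cast hsq
  rw [hsqc]
  generalize ((√κ : ℝ) : ℂ) = k at *
  field_simp
  ring

/-- The constant `p₁` places the zero of `G₁'` at the same point `z_c`. -/
theorem hasDerivAt_GOne (hq0 : 0 < q) (hq1 : q < 1) (hk0 : 0 < κ) {z : ℂ} (hz : IsRegular q z) :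
    HasDerivAt (GOne q κ)
      (gCoeff q κ * (z - zCrit q κ) / (z * (1 - q * z))) z := by
  obtain ⟨h1, h2, h3⟩ := hz
  have n1 : z ≠ 0 := Complex.slitPlane_ne_zero h1
  have n3 := Complex.slitPlane_ne_zero h3
  have d2 : HasDerivAt (fun z : ℂ => 1 - q * z) (-q) z := by
    simpa using ((hasDerivAt_id z).const_mul (q : ℂ)).const_sub 1
  have d := ((d2.clog h3).neg).sub
    ((Complex.hasDerivAt_log h1).const_mul (pOne q κ : ℂ))
  refine d.congr_deriv ?_
  have hs := Real.sqrt_pos.2 hk0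
  have hp : (1 - q ^ 2 : ℝ) ≠ 0 := (one_sub_sq_pos hq0 hq1).ne'
  have hr : (q + √κ : ℝ) ≠ 0 := by positivity
  have hpc : (1 - (q : ℂ) ^ 2) ≠ 0 := by exact_mod_cast hp
  have hrc : ((q : ℂ) + (√κ : ℝ)) ≠ 0 := by exact_mod_cast hr
  have hsc : ((√κ : ℝ) : ℂ) ≠ 0 := by exact_mod_cast hs.ne'
  unfold gCoeff pOne zCrit
  push_cast
  generalize ((√κ : ℝ) : ℂ) = k at *
  field_simp
  ring

theorem eventually_isRegular (hq0 : 0 < q) (hq1 : q < 1) (hk0 : 0 < κ) (hk1 : κ < 1) :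
    ∀ᶠ h : ℂ in 𝓝 0, IsRegular q (zCrit q κ + h) := by
  have hc1 := one_lt_zCrit hq0 hq1 hk0 hk1
  have hc2 := q_mul_zCrit_lt_one hq0 hq1 hk0
  have t : Tendsto (fun h : ℂ => (zCrit q κ : ℂ) + h) (𝓝 0) (𝓝 (zCrit q κ : ℂ)) := by
    have : Continuous fun h : ℂ => (zCrit q κ : ℂ) + h := by fun_prop
    simpa using this.tendsto 0
  have tr : Tendsto (fun h : ℂ => ((zCrit q κ : ℂ) + h).re) (𝓝 0) (𝓝 (zCrit q κ)) := by
    have := (Complex.continuous_re.tendsto _).comp t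
    rwa [Complex.ofReal_re] at this
  have tn : Tendsto (fun h : ℂ => ‖(zCrit q κ : ℂ) + h‖) (𝓝 0) (𝓝 (zCrit q κ)) := by
    have := t.norm
    rwa [Complex.norm_real, Real.norm_of_nonneg (by linarith)] at this
  filter_upwards [tr.eventually_const_lt (show (0 : ℝ) < zCrit q κ by linarith),
    tn.eventually_const_lt (show q < zCrit q κ by linarith),
    (tr.const_mul q).eventually_lt_const hc2] with h h1 h2 h3
  exact isRegular_of hq0 h1 h2 (Or.inr h3)

/-- Taylor expansion at a zero of order `k` of the derivative, to leading order. -/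
theorem exists_leading_term {F φ : ℂ → ℂ} {x : ℂ} (k : ℕ)
    (hF : ∀ᶠ h in 𝓝 0, HasDerivAt F (h ^ k * φ h) (x + h)) (hφ : ContinuousAt φ 0) :
    ∃ B : ℂ → ℂ, Tendsto B (𝓝 0) (𝓝 (φ 0 / (k + 1))) ∧
      ∀ h, F (x + h) - F x = h ^ (k + 1) * B h := by
  classical
  have hk : ((k : ℂ) + 1) ≠ 0 := by exact_mod_cast Nat.succ_ne_zero k
  -- The quotient is given its limit at `h = 0`, so that convergence holds along the full
  -- neighbourhood filter. Off zero, the mean value inequality is applied to `F` minus its leading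
  -- monomial on the disc of radius `‖h‖`.
  refine ⟨fun h => if h = 0 then φ 0 / (k + 1) else (F (x + h) - F x) / h ^ (k + 1), ?_, ?_⟩
  · rw [Metric.tendsto_nhds]
    intro ε hε
    have h1 : ∀ᶠ h in 𝓝 (0 : ℂ), dist (φ h) (φ 0) < ε / 2 :=
      Metric.tendsto_nhds.1 hφ _ (by positivity)
    obtain ⟨δ, hδ, hball⟩ := Metric.eventually_nhds_iff.1 (hF.and h1)
    filter_upwards [Metric.ball_mem_nhds (0 : ℂ) hδ] with h hh
    by_cases h0 : h = 0
    · simp [h0, hε]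
    simp only [h0, if_false]
    have hn : ‖h‖ < δ := by simpa using hh
    have hd : ∀ u ∈ Metric.closedBall (0 : ℂ) ‖h‖,
        HasDerivWithinAt (fun u => F (x + u) - φ 0 * u ^ (k + 1) / (k + 1))
          (u ^ k * (φ u - φ 0)) (Metric.closedBall (0 : ℂ) ‖h‖) u := by
      intro u hu
      have hu' : dist u 0 < δ := (Metric.mem_closedBall.1 hu).trans_lt hn
      have d1 := (hball hu').1.comp_const_add x u
      have d2 := ((hasDerivAt_pow (k + 1) u).const_mul (φ 0)).div_const ((k : ℂ) + 1)
      refine ((d1.sub d2).congr_deriv ?_).hasDerivWithinAt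
      push_cast
      field_simp
    have hb : ∀ u ∈ Metric.closedBall (0 : ℂ) ‖h‖, ‖u ^ k * (φ u - φ 0)‖ ≤ ‖h‖ ^ k * (ε / 2) := by
      intro u hu
      have hu1 : ‖u‖ ≤ ‖h‖ := by simpa using hu
      have hu' : dist u 0 < δ := (Metric.mem_closedBall.1 hu).trans_lt hn
      rw [norm_mul, norm_pow, ← dist_eq_norm]
      gcongr
      exact (hball hu').2.le
    have hmv := (convex_closedBall (0 : ℂ) ‖h‖).norm_image_sub_le_of_norm_hasDerivWithin_le hd hb
      (x := 0) (y := h) (by simp) (by simp)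
    simp only [add_zero, ne_eq, Nat.add_eq_zero_iff, one_ne_zero, and_false, not_false_eq_true,
      zero_pow, mul_zero, zero_div, sub_zero] at hmv
    rw [dist_eq_norm]
    have hp : 0 < ‖h‖ := norm_pos_iff.2 h0
    have e : (F (x + h) - F x) / h ^ (k + 1) - φ 0 / (k + 1) =
        (F (x + h) - φ 0 * h ^ (k + 1) / (k + 1) - F x) / h ^ (k + 1) := by
      field_simp; ring
    rw [e, norm_div, norm_pow, div_lt_iff₀ (by positivity)]
    calc _ ≤ ‖h‖ ^ k * (ε / 2) * ‖h‖ := hmv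
      _ = ε / 2 * ‖h‖ ^ (k + 1) := by ring
      _ < ε * ‖h‖ ^ (k + 1) := by gcongr; linarith
  · intro h
    by_cases h0 : h = 0
    · simp [h0]
    · simp only [h0, if_false]; field_simp

theorem exists_SOneBar_expansion (hq0 : 0 < q) (hq1 : q < 1) (hk0 : 0 < κ) (hk1 : κ < 1) :
    ∃ B : ℂ → ℂ, Tendsto B (𝓝 0) (𝓝 ((sigmaOne q κ : ℂ) ^ 3 / 3)) ∧
      ∀ h, SOneBar q κ (zCrit q κ + h) = h ^ 3 * B h := by
  have hc1 := one_lt_zCrit hq0 hq1 hk0 hk1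
  have hc2 := q_mul_zCrit_lt_one hq0 hq1 hk0
  obtain ⟨B, hB, hBe⟩ := exists_leading_term (F := SOne q κ) (x := zCrit q κ) 2
    (φ := fun h => sCoeff q κ / ((zCrit q κ + h) * (zCrit q κ + h - q) *
      (1 - q * (zCrit q κ + h))))
    (by
      filter_upwards [eventually_isRegular hq0 hq1 hk0 hk1] with h hh
      refine (hasDerivAt_SOne hq0 hq1 hk0 hh).congr_deriv ?_
      rw [add_sub_cancel_left]; ring)
    (by
      refine ContinuousAt.div (by fun_prop) (by fun_prop) ?_
      have h1 : zCrit q κ * (zCrit q κ - q) * (1 - q * zCrit q κ) ≠ 0 := by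
        refine mul_ne_zero (mul_ne_zero ?_ ?_) ?_ <;> linarith
      simp only [add_zero]
      exact_mod_cast h1)
  refine ⟨B, ?_, hBe⟩
  convert hB using 2
  simp only [add_zero]
  have := sCoeff_div hq0 hq1 hk0
  have hC : (sCoeff q κ : ℂ) / (zCrit q κ * (zCrit q κ - q) * (1 - q * zCrit q κ)) =
      (sigmaOne q κ : ℂ) ^ 3 := by exact_mod_cast this
  rw [hC]; norm_num

theorem exists_GOneBar_expansion (hq0 : 0 < q) (hq1 : q < 1) (hk0 : 0 < κ) (hk1 : κ < 1) :
    ∃ B : ℂ → ℂ, Tendsto B (𝓝 0) (𝓝 ((fOne q κ : ℂ) * (sigmaOne q κ : ℂ) ^ 2)) ∧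
      ∀ h, GOneBar q κ (zCrit q κ + h) = h ^ 2 * B h := by
  have hc1 := one_lt_zCrit hq0 hq1 hk0 hk1
  have hc2 := q_mul_zCrit_lt_one hq0 hq1 hk0
  obtain ⟨B, hB, hBe⟩ := exists_leading_term (F := GOne q κ) (x := zCrit q κ) 1
    (φ := fun h => gCoeff q κ / ((zCrit q κ + h) * (1 - q * (zCrit q κ + h))))
    (by
      filter_upwards [eventually_isRegular hq0 hq1 hk0 hk1] with h hh
      refine (hasDerivAt_GOne hq0 hq1 hk0 hh).congr_deriv ?_
      rw [add_sub_cancel_left]; ring)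
    (by
      refine ContinuousAt.div (by fun_prop) (by fun_prop) ?_
      have h1 : zCrit q κ * (1 - q * zCrit q κ) ≠ 0 := by
        refine mul_ne_zero ?_ ?_ <;> linarith
      simp only [add_zero]
      exact_mod_cast h1)
  refine ⟨B, ?_, hBe⟩
  convert hB using 2
  simp only [add_zero]
  have := gCoeff_div hq0 hq1 hk0
  have hC : (gCoeff q κ : ℂ) / (zCrit q κ * (1 - q * zCrit q κ)) =
      2 * (fOne q κ : ℂ) * (sigmaOne q κ : ℂ) ^ 2 := by exact_mod_cast this
  rw [hC]; push_cast; ring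

theorem exists_log_expansion {x : ℝ} (hx : 0 < x) :
    ∃ B : ℂ → ℂ, Tendsto B (𝓝 0) (𝓝 (1 / (x : ℂ))) ∧
      ∀ h, Complex.log ((x + h) / x) = h * B h := by
  have hx' : (x : ℂ) ≠ 0 := by exact_mod_cast hx.ne'
  have t : Tendsto (fun h : ℂ => ((x : ℂ) + h) / x) (𝓝 0) (𝓝 1) := by
    have : ContinuousAt (fun h : ℂ => ((x : ℂ) + h) / x) 0 := by fun_prop
    simpa [ContinuousAt, hx'] using this
  obtain ⟨B, hB, hBe⟩ := exists_leading_term (F := fun z : ℂ => Complex.log (z / x)) (x := x) 0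
    (φ := fun h => 1 / (x + h))
    (by
      filter_upwards [t.eventually (Complex.isOpen_slitPlane.mem_nhds Complex.one_mem_slitPlane)]
        with h hh
      have d := ((hasDerivAt_id ((x : ℂ) + h)).div_const (x : ℂ)).clog hh
      refine d.congr_deriv ?_
      have : (x : ℂ) + h ≠ 0 := by
        intro h0; rw [h0, zero_div] at hh; exact Complex.slitPlane_ne_zero hh rfl
      simp; field_simp)
    (by
      refine ContinuousAt.div (by fun_prop) (by fun_prop) ?_
      simpa using hx')
  refine ⟨B, by simpa using hB, fun h => ?_⟩
  have := hBe h
  simpa [div_self hx'] using this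

end Parameters


/-! ### Scales and phases -/

/-- The standing assumptions on `q` and `κ`. -/
structure IsParam (q κ : ℝ) : Prop where
  q_pos : 0 < q
  q_lt_one : q < 1
  κ_pos : 0 < κ
  κ_lt_one : κ < 1

/-- `N^{1/12}`; all scales of the problem are powers of it. -/
noncomputable def mu (N : ℕ) : ℝ := (N : ℝ) ^ (1 / 12 : ℝ)

/-- The inverse of the scale at which the contours are resolved near `z_c`. -/
noncomputable def mScale (q κ : ℝ) (N : ℕ) : ℝ := sigmaOne q κ * mu N ^ 4

theorem rpow_eq_mu_pow (N : ℕ) (n : ℕ) : (N : ℝ) ^ (n / 12 : ℝ) = mu N ^ n := by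
  unfold mu
  rw [← Real.rpow_natCast, ← Real.rpow_mul (Nat.cast_nonneg N)]
  congr 1; ring

theorem rpow_neg_eq_mu_pow (N : ℕ) (n : ℕ) : (N : ℝ) ^ (-(n / 12) : ℝ) = (mu N ^ n)⁻¹ := by
  rw [Real.rpow_neg (Nat.cast_nonneg N), rpow_eq_mu_pow]

theorem natCast_eq_mu_pow (N : ℕ) : (N : ℝ) = mu N ^ 12 := by
  rw [← rpow_eq_mu_pow]; norm_num

theorem scale_eq (q κ : ℝ) (N : ℕ) : scale q κ N = zCrit q κ * mScale q κ N := by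
  unfold scale mScale
  have := rpow_eq_mu_pow N 4
  rw [← this]; norm_num; ring

theorem tendsto_mu : Tendsto mu atTop atTop :=
  (tendsto_rpow_atTop (by norm_num)).comp tendsto_natCast_atTop_atTop

theorem tendsto_mScale {q κ : ℝ} (hp : IsParam q κ) : Tendsto (mScale q κ) atTop atTop :=
  ((tendsto_pow_atTop (by norm_num)).comp tendsto_mu).const_mul_atTop
    (sigmaOne_pos hp.q_pos hp.q_lt_one hp.κ_pos)

theorem eventually_mu_ge_one : ∀ᶠ N in atTop, 1 ≤ mu N := tendsto_mu.eventually_ge_atTop 1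

theorem bigT_eq (N : ℕ) (t : ℝ) : bigT N t = ⌊t * mu N ^ 8⌋ := by
  unfold bigT
  rw [← rpow_eq_mu_pow]; norm_num

theorem tendsto_bigT_div (t : ℝ) :
    Tendsto (fun N => (bigT N t : ℝ) / mu N ^ 8) atTop (𝓝 t) := by
  have h8 : Tendsto (fun N => mu N ^ 8) atTop atTop :=
    (tendsto_pow_atTop (by norm_num)).comp tendsto_mu
  have h1 : Tendsto (fun N => t - (mu N ^ 8)⁻¹) atTop (𝓝 t) := by
    simpa using tendsto_const_nhds.sub h8.inv_tendsto_atTop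
  refine tendsto_of_tendsto_of_tendsto_of_le_of_le' h1 tendsto_const_nhds ?_ ?_
  · filter_upwards [eventually_mu_ge_one] with N hN
    have hp : 0 < mu N ^ 8 := by positivity
    rw [le_div_iff₀ hp, bigT_eq, sub_mul, inv_mul_cancel₀ hp.ne']
    exact (Int.sub_one_lt_floor _).le
  · filter_upwards [eventually_mu_ge_one] with N hN
    have hp : 0 < mu N ^ 8 := by positivity
    rw [div_le_iff₀ hp, bigT_eq]
    exact Int.floor_le _

/-- A super-polynomially small factor beats the scale. -/
theorem tendsto_mScale_mul_exp (q κ : ℝ) {c : ℝ} (hc : 0 < c) (C : ℝ) {k : ℕ} (hk : 1 ≤ k) :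
    Tendsto (fun N => mScale q κ N * Real.exp (-c * mu N ^ (k + 1) + C * mu N ^ k)) atTop
      (𝓝 0) := by
  have h0 : Tendsto (fun N => |sigmaOne q κ| * (mu N ^ 4 * Real.exp (-mu N))) atTop (𝓝 0) := by
    simpa using ((Real.tendsto_pow_mul_exp_neg_atTop_nhds_zero 4).comp tendsto_mu).const_mul
      |sigmaOne q κ|
  refine squeeze_zero_norm' ?_ h0
  filter_upwards [eventually_mu_ge_one,
    (tendsto_mu.const_mul_atTop hc).eventually_ge_atTop (C + 1)] with N h1 h2
  unfold mScale
  rw [norm_mul, norm_mul, Real.norm_of_nonneg (Real.exp_pos _).le, Real.norm_eq_abs,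
    Real.norm_of_nonneg (by positivity : 0 ≤ mu N ^ 4), mul_assoc]
  gcongr
  have h3 : mu N ≤ mu N ^ k := le_self_pow₀ h1 (by omega)
  have h4 : (C + 1) * mu N ^ k ≤ c * mu N * mu N ^ k := by gcongr
  rw [pow_succ]
  linarith

section Phase

variable {q κ : ℝ}

/-- The exponent `ε N S̄₁ + τ Ḡ₁ + ξ log(z / z_c)`. -/
noncomputable def phase (q κ ε τ ξ : ℝ) (N : ℕ) (z : ℂ) : ℂ :=
  ε * (N * SOneBar q κ z) + τ * GOneBar q κ z + ξ * Complex.log (z / zCrit q κ)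

theorem measurable_SOneBar (q κ : ℝ) : Measurable (SOneBar q κ) := by
  unfold SOneBar SOne; fun_prop

theorem measurable_GOneBar (q κ : ℝ) : Measurable (GOneBar q κ) := by
  unfold GOneBar GOne; fun_prop

theorem measurable_phase (q κ ε τ ξ : ℝ) (N : ℕ) : Measurable (phase q κ ε τ ξ N) := by
  unfold phase
  have h1 := measurable_SOneBar q κ
  have h2 := measurable_GOneBar q κ
  fun_prop

/-- The rescaled limit of `phase`. -/
noncomputable def phaseLim (q κ ε T X : ℝ) (Z : ℂ) : ℂ :=
  ε * (Z ^ 3 / 3) + (T * fOne q κ : ℝ) * Z ^ 2 + (X / (zCrit q κ * sigmaOne q κ) : ℝ) * Z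

theorem tendsto_div_mScale (hp : IsParam q κ) (Z : ℂ) :
    Tendsto (fun N => Z / (mScale q κ N : ℂ)) atTop (𝓝 0) := by
  have h : Tendsto (fun N => ((mScale q κ N)⁻¹ : ℝ)) atTop (𝓝 0) :=
    (tendsto_mScale hp).inv_tendsto_atTop
  have h' : Tendsto (fun N => Z * (((mScale q κ N)⁻¹ : ℝ) : ℂ)) atTop (𝓝 (Z * (0 : ℝ))) :=
    ((Complex.continuous_ofReal.tendsto _).comp h).const_mul Z
  simpa [div_eq_mul_inv] using h'

theorem zCrit_pos (hp : IsParam q κ) : 0 < zCrit q κ :=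
  zero_lt_one.trans (one_lt_zCrit hp.q_pos hp.q_lt_one hp.κ_pos hp.κ_lt_one)

theorem sigma_pos (hp : IsParam q κ) : 0 < sigmaOne q κ :=
  sigmaOne_pos hp.q_pos hp.q_lt_one hp.κ_pos

/-- With `μ = N^{1/12}`, the displacement is of order `μ⁻⁴`, so the orders of vanishing `3, 2, 1`
match exactly the sizes `μ¹², μ⁸, μ⁴` of the coefficients. -/
theorem tendsto_phase (hp : IsParam q κ) (ε : ℝ) {τ ξ : ℕ → ℝ} {T X : ℝ}
    (hτ : Tendsto (fun N => τ N / mu N ^ 8) atTop (𝓝 T))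
    (hξ : Tendsto (fun N => ξ N / mu N ^ 4) atTop (𝓝 X)) (Z : ℂ) :
    Tendsto (fun N => phase q κ ε (τ N) (ξ N) N (zCrit q κ + Z / mScale q κ N)) atTop
      (𝓝 (phaseLim q κ ε T X Z)) := by
  obtain ⟨B, hB, hBe⟩ := exists_SOneBar_expansion hp.q_pos hp.q_lt_one hp.κ_pos hp.κ_lt_one
  obtain ⟨B', hB', hBe'⟩ := exists_GOneBar_expansion hp.q_pos hp.q_lt_one hp.κ_pos hp.κ_lt_one
  obtain ⟨B'', hB'', hBe''⟩ := exists_log_expansion (zCrit_pos hp)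
  have hσ := (sigma_pos hp).ne'
  have hσc : (sigmaOne q κ : ℂ) ≠ 0 := by exact_mod_cast hσ
  have hzc : (zCrit q κ : ℂ) ≠ 0 := by exact_mod_cast (zCrit_pos hp).ne'
  have tZ := tendsto_div_mScale hp Z
  have t1 := ((hB.comp tZ).const_mul (ε * (Z ^ 3 / (sigmaOne q κ : ℂ) ^ 3)))
  have t2 := (((Complex.continuous_ofReal.tendsto _).comp hτ).mul (hB'.comp tZ)).const_mul
    (Z ^ 2 / (sigmaOne q κ : ℂ) ^ 2)
  have t3 := (((Complex.continuous_ofReal.tendsto _).comp hξ).mul (hB''.comp tZ)).const_mul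
    (Z / (sigmaOne q κ : ℂ))
  have t := (t1.add t2).add t3
  have hlim : ε * (Z ^ 3 / (sigmaOne q κ : ℂ) ^ 3) * ((sigmaOne q κ : ℂ) ^ 3 / 3) +
      Z ^ 2 / (sigmaOne q κ : ℂ) ^ 2 * (T * ((fOne q κ : ℂ) * (sigmaOne q κ : ℂ) ^ 2)) +
      Z / (sigmaOne q κ : ℂ) * (X * (1 / (zCrit q κ : ℂ))) = phaseLim q κ ε T X Z := by
    unfold phaseLim; push_cast; field_simp
  rw [hlim] at t
  refine t.congr' ?_
  filter_upwards [eventually_mu_ge_one] with N hN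
  have hmu : (mu N : ℂ) ≠ 0 := by
    have : mu N ≠ 0 := by positivity
    exact_mod_cast this
  have hNc : (N : ℂ) = (mu N : ℂ) ^ 12 := by exact_mod_cast natCast_eq_mu_pow N
  have hm : (mScale q κ N : ℂ) = sigmaOne q κ * (mu N : ℂ) ^ 4 := by
    unfold mScale; push_cast; rfl
  unfold phase
  rw [hBe, hBe', hBe'', hNc]
  simp only [Function.comp_apply, hm]
  push_cast
  field_simp

theorem exists_local_bounds (hp : IsParam q κ) :
    ∃ δ > 0, ∃ K, 0 ≤ K ∧ ∀ h : ℂ, ‖h‖ ≤ δ →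
      ‖SOneBar q κ (zCrit q κ + h)‖ ≤ K * ‖h‖ ^ 3 ∧
      ‖GOneBar q κ (zCrit q κ + h)‖ ≤ K * ‖h‖ ^ 2 ∧
      ‖Complex.log ((zCrit q κ + h) / zCrit q κ)‖ ≤ K * ‖h‖ := by
  obtain ⟨B, hB, hBe⟩ := exists_SOneBar_expansion hp.q_pos hp.q_lt_one hp.κ_pos hp.κ_lt_one
  obtain ⟨B', hB', hBe'⟩ := exists_GOneBar_expansion hp.q_pos hp.q_lt_one hp.κ_pos hp.κ_lt_one
  obtain ⟨B'', hB'', hBe''⟩ := exists_log_expansion (zCrit_pos hp)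
  obtain ⟨K, hK⟩ := exists_gt (max ‖(sigmaOne q κ : ℂ) ^ 3 / 3‖
    (max ‖(fOne q κ : ℂ) * (sigmaOne q κ : ℂ) ^ 2‖ ‖1 / (zCrit q κ : ℂ)‖))
  simp only [max_lt_iff] at hK
  have e := (hB.norm.eventually_lt_const hK.1).and ((hB'.norm.eventually_lt_const hK.2.1).and
    (hB''.norm.eventually_lt_const hK.2.2))
  obtain ⟨δ, hδ, hball⟩ := Metric.eventually_nhds_iff.1 e
  refine ⟨δ / 2, by positivity, K, (norm_nonneg _).trans hK.1.le, fun h hh => ?_⟩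
  obtain ⟨h1, h2, h3⟩ := hball (show dist h 0 < δ by rw [dist_zero_right]; linarith)
  rw [hBe, hBe', hBe'', norm_mul, norm_mul, norm_mul, norm_pow, norm_pow]
  refine ⟨?_, ?_, ?_⟩ <;> rw [mul_comm] <;> gcongr

/-- Bounds on the coefficients of the phase. -/
theorem eventually_abs_le_of_tendsto_div {τ : ℕ → ℝ} {T : ℝ} {k : ℕ}
    (hτ : Tendsto (fun N => τ N / mu N ^ k) atTop (𝓝 T)) :
    ∀ᶠ N in atTop, |τ N| ≤ (|T| + 1) * mu N ^ k := by
  filter_upwards [hτ.abs.eventually_lt_const (lt_add_one |T|), eventually_mu_ge_one]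
    with N h1 h2
  rw [abs_div, abs_of_pos (by positivity : 0 < mu N ^ k), div_lt_iff₀ (by positivity)] at h1
  exact h1.le

theorem re_phase_le (q κ ε τ ξ : ℝ) (N : ℕ) (z : ℂ) :
    (phase q κ ε τ ξ N z).re ≤ N * (ε * (SOneBar q κ z).re) + |τ| * ‖GOneBar q κ z‖ +
      |ξ| * ‖Complex.log (z / zCrit q κ)‖ := by
  unfold phase
  rw [Complex.add_re, Complex.add_re]
  have h1 : ((ε : ℂ) * (N * SOneBar q κ z)).re = N * (ε * (SOneBar q κ z).re) := by
    rw [Complex.re_ofReal_mul, ← Complex.ofReal_natCast, Complex.re_ofReal_mul]; ring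
  have h2 : ((τ : ℂ) * GOneBar q κ z).re ≤ |τ| * ‖GOneBar q κ z‖ := by
    refine (Complex.re_le_norm _).trans ?_
    rw [norm_mul, Complex.norm_real, Real.norm_eq_abs]
  have h3 : ((ξ : ℂ) * Complex.log (z / zCrit q κ)).re ≤
      |ξ| * ‖Complex.log (z / zCrit q κ)‖ := by
    refine (Complex.re_le_norm _).trans ?_
    rw [norm_mul, Complex.norm_real, Real.norm_eq_abs]
  linarith

theorem exists_phase_local_bound (hp : IsParam q κ) (ε : ℝ) {τ ξ : ℕ → ℝ} {T X : ℝ}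
    (hτ : Tendsto (fun N => τ N / mu N ^ 8) atTop (𝓝 T))
    (hξ : Tendsto (fun N => ξ N / mu N ^ 4) atTop (𝓝 X)) (r : ℝ) :
    ∃ C, ∀ᶠ N in atTop, ∀ Z : ℂ, ‖Z‖ ≤ r →
      (phase q κ ε (τ N) (ξ N) N (zCrit q κ + Z / mScale q κ N)).re ≤ C := by
  obtain ⟨δ, hδ, K, hK0, hK⟩ := exists_local_bounds hp
  have hσ := sigma_pos hp
  refine ⟨|ε| * (K * (r / sigmaOne q κ) ^ 3) + (|T| + 1) * (K * (r / sigmaOne q κ) ^ 2) +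
    (|X| + 1) * (K * (r / sigmaOne q κ)), ?_⟩
  filter_upwards [eventually_abs_le_of_tendsto_div hτ, eventually_abs_le_of_tendsto_div hξ,
    eventually_mu_ge_one, (tendsto_mScale hp).eventually_ge_atTop (r / δ)] with N h1 h2 h3 h4 Z hZ
  have hmu : 0 < mu N := by linarith
  have hm : 0 < mScale q κ N := by unfold mScale; positivity
  have hr : 0 ≤ r := (norm_nonneg Z).trans hZ
  have hn : ‖Z / (mScale q κ N : ℂ)‖ ≤ r / sigmaOne q κ / mu N ^ 4 := by
    rw [norm_div, Complex.norm_real, Real.norm_of_nonneg hm.le, div_div]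
    unfold mScale; gcongr
  have hn' : ‖Z / (mScale q κ N : ℂ)‖ ≤ δ := by
    rw [norm_div, Complex.norm_real, Real.norm_of_nonneg hm.le, div_le_iff₀ hm]
    rw [div_le_iff₀ hδ] at h4
    linarith
  obtain ⟨b1, b2, b3⟩ := hK _ hn'
  set H := ‖Z / (mScale q κ N : ℂ)‖ with hH
  have hH0 : 0 ≤ H := norm_nonneg _
  set s := r / sigmaOne q κ with hs
  have hs0 : 0 ≤ s := by positivity
  refine (re_phase_le q κ ε _ _ N _).trans ?_
  have c1 : (N : ℝ) * (ε * (SOneBar q κ (zCrit q κ + Z / mScale q κ N)).re) ≤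
      |ε| * (K * s ^ 3) := by
    have : |ε * (SOneBar q κ (zCrit q κ + Z / mScale q κ N)).re| ≤
        |ε| * (K * (s / mu N ^ 4) ^ 3) := by
      rw [abs_mul]
      gcongr
      refine (Complex.abs_re_le_norm _).trans (b1.trans ?_)
      gcongr
    calc _ ≤ (N : ℝ) * (|ε| * (K * (s / mu N ^ 4) ^ 3)) :=
          mul_le_mul_of_nonneg_left ((le_abs_self _).trans this) (Nat.cast_nonneg N)
      _ = _ := by rw [natCast_eq_mu_pow]; field_simp
  have c2 : |τ N| * ‖GOneBar q κ (zCrit q κ + Z / mScale q κ N)‖ ≤ (|T| + 1) * (K * s ^ 2) := by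
    calc _ ≤ ((|T| + 1) * mu N ^ 8) * (K * (s / mu N ^ 4) ^ 2) := by
          gcongr; exact b2.trans (by gcongr)
      _ = _ := by field_simp
  have c3 : |ξ N| * ‖Complex.log ((zCrit q κ + Z / mScale q κ N) / zCrit q κ)‖ ≤
      (|X| + 1) * (K * s) := by
    calc _ ≤ ((|X| + 1) * mu N ^ 4) * (K * (s / mu N ^ 4)) := by
          gcongr; exact b3.trans (by gcongr)
      _ = _ := by field_simp
  linarith

/-- Decay of the phase along a ray on which `S̄₁` has cubic descent. -/
theorem exists_phase_ray_bound (hp : IsParam q κ) (ε : ℝ) {τ ξ D : ℕ → ℝ} {T X ψ c K : ℝ}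
    (hτ : Tendsto (fun N => τ N / mu N ^ 8) atTop (𝓝 T))
    (hξ : Tendsto (fun N => ξ N / mu N ^ 4) atTop (𝓝 X)) (hc : 0 < c)
    (hS : ∀ᶠ N in atTop, ∀ t, 0 < t → t ≤ D N →
      ε * (SOneBar q κ (rayPoint (zCrit q κ) ψ t)).re ≤ -c * t ^ 3 ∧
      ‖GOneBar q κ (rayPoint (zCrit q κ) ψ t)‖ ≤ K * t ^ 2 ∧
      ‖Complex.log (rayPoint (zCrit q κ) ψ t / zCrit q κ)‖ ≤ K * t) :
    ∃ C, ∀ᶠ N in atTop, ∀ v, 0 < v → v ≤ mScale q κ N * D N →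
      (phase q κ ε (τ N) (ξ N) N (zCrit q κ + rayPoint 0 ψ v / mScale q κ N)).re ≤
        C - 1 * v ^ 2 := by
  have hσ := sigma_pos hp
  -- After rescaling, the three terms are bounded by a cubic polynomial in `v`. The additional `1`
  -- in its quadratic coefficient yields the decay `-v²`.
  obtain ⟨C, hC⟩ := exists_cubic_bound (c := c / sigmaOne q κ ^ 3) (by positivity)
    ((|T| + 1) * (K / sigmaOne q κ ^ 2) + 1) ((|X| + 1) * (K / sigmaOne q κ))
  refine ⟨C, ?_⟩
  filter_upwards [eventually_abs_le_of_tendsto_div hτ, eventually_abs_le_of_tendsto_div hξ,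
    eventually_mu_ge_one, hS] with N h1 h2 h3 h4 v hv hvD
  have hmu : 0 < mu N := by linarith
  have hm : 0 < mScale q κ N := by unfold mScale; positivity
  obtain ⟨b1, b2, b3⟩ := h4 (v / mScale q κ N) (by positivity)
    (by rw [div_le_iff₀ hm]; linarith)
  rw [rayPoint_div] at b1 b2 b3
  refine (re_phase_le q κ ε _ _ N _).trans ?_
  have hK2 := (norm_nonneg _).trans b2
  have hK3 := (norm_nonneg _).trans b3
  have c1 : (N : ℝ) * (ε * (SOneBar q κ (zCrit q κ + rayPoint 0 ψ v / mScale q κ N)).re) ≤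
      -(c / sigmaOne q κ ^ 3) * v ^ 3 := by
    calc _ ≤ (N : ℝ) * (-c * (v / mScale q κ N) ^ 3) := by gcongr
      _ = _ := by rw [natCast_eq_mu_pow]; unfold mScale; field_simp
  have c2 : |τ N| * ‖GOneBar q κ (zCrit q κ + rayPoint 0 ψ v / mScale q κ N)‖ ≤
      (|T| + 1) * (K / sigmaOne q κ ^ 2) * v ^ 2 := by
    calc _ ≤ ((|T| + 1) * mu N ^ 8) * (K * (v / mScale q κ N) ^ 2) := by gcongr
      _ = _ := by unfold mScale; field_simp
  have c3 : |ξ N| * ‖Complex.log ((zCrit q κ + rayPoint 0 ψ v / mScale q κ N) / zCrit q κ)‖ ≤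
      (|X| + 1) * (K / sigmaOne q κ) * v := by
    calc _ ≤ ((|X| + 1) * mu N ^ 4) * (K * (v / mScale q κ N)) := by gcongr
      _ = _ := by unfold mScale; field_simp
  have := hC v hv.le
  linarith

theorem norm_rayPoint_zero {ψ t : ℝ} (ht : 0 ≤ t) : ‖rayPoint 0 ψ t‖ = t := by
  simp [rayPoint, abs_of_nonneg ht]

theorem rayPoint_eq_add (x ψ t : ℝ) : rayPoint x ψ t = x + rayPoint 0 ψ t := by
  simp [rayPoint]

theorem rayPoint_zero_pow (ψ t : ℝ) (k : ℕ) :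
    rayPoint 0 ψ t ^ k = ((t ^ k : ℝ) : ℂ) * Complex.exp ((k * ψ : ℝ) * Complex.I) := by
  simp only [rayPoint, Complex.ofReal_zero, zero_add, mul_pow, ← Complex.exp_nat_mul]
  push_cast; ring_nf

theorem tendsto_rayPoint_zero (ψ : ℝ) : Tendsto (rayPoint 0 ψ) (𝓝 0) (𝓝 0) := by
  simpa [rayPoint] using (continuous_rayPoint 0 ψ).tendsto 0

/-- On the ray of angle `ψ` the leading term is `t^k b e^{ikψ}`, so the sign of the real part near
the vertex is that of `b cos (kψ)`. -/
theorem exists_re_le_of_expansion {F B : ℂ → ℂ} {x : ℝ} {b : ℝ} {k : ℕ}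
    (hB : Tendsto B (𝓝 0) (𝓝 (b : ℂ))) (hBe : ∀ h, F (x + h) = h ^ k * B h) {ψ ε c : ℝ}
    (hψ : ε * (Real.cos (k * ψ) * b) < -c) :
    ∃ δ > 0, ∀ t, 0 < t → t ≤ δ → ε * (F (rayPoint x ψ t)).re ≤ -c * t ^ k := by
  have h1 : Tendsto (fun t : ℝ => ε * (Complex.exp ((k * ψ : ℝ) * Complex.I) *
      B (rayPoint 0 ψ t)).re) (𝓝 0)
      (𝓝 (ε * (Complex.exp ((k * ψ : ℝ) * Complex.I) * (b : ℂ)).re)) :=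
    (((Complex.continuous_re.tendsto _).comp
      ((hB.comp (tendsto_rayPoint_zero ψ)).const_mul _))).const_mul ε
  rw [Complex.re_mul_ofReal, Complex.exp_ofReal_mul_I_re] at h1
  obtain ⟨δ, hδ, hball⟩ := Metric.eventually_nhds_iff.1 (h1.eventually_lt_const hψ)
  refine ⟨δ / 2, by positivity, fun t ht htδ => ?_⟩
  have h2 := hball (show dist t 0 < δ by
    rw [dist_zero_right, Real.norm_of_nonneg ht.le]; linarith)
  rw [rayPoint_eq_add, hBe, rayPoint_zero_pow, mul_assoc, Complex.re_ofReal_mul]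
  have hp : 0 < t ^ k := by positivity
  nlinarith

end Phase


/-! ### Contour geometry -/

theorem norm_sq_rayPoint (x θ t : ℝ) :
    ‖rayPoint x θ t‖ ^ 2 = x ^ 2 + 2 * x * t * Real.cos θ + t ^ 2 := by
  rw [← Complex.normSq_eq_norm_sq, Complex.normSq_apply, rayPoint_re, rayPoint_im]
  linear_combination t ^ 2 * Real.sin_sq_add_cos_sq θ

/-- The set of hitting distances is nonempty by the intermediate value theorem and closed, so its
infimum is attained; it is not `0` because the vertex is strictly inside the circle. -/
theorem rayDist_pos {x R : ℝ} (hx : 0 < x) (hR : x < R) (θ : ℝ) : 0 < rayDist x θ R := by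
  set S := {t : ℝ | 0 ≤ t ∧ ‖(x : ℂ) + t * Complex.exp (θ * Complex.I)‖ = R} with hS
  have hcont : Continuous fun t : ℝ => ‖(x : ℂ) + t * Complex.exp (θ * Complex.I)‖ := by fun_prop
  have hne : S.Nonempty := by
    have hsub := intermediate_value_Icc (show (0 : ℝ) ≤ R + x by linarith) hcont.continuousOn
    have hmem : R ∈ Icc ‖(x : ℂ) + (0 : ℝ) * Complex.exp (θ * Complex.I)‖
        ‖(x : ℂ) + ((R + x : ℝ) : ℂ) * Complex.exp (θ * Complex.I)‖ := by
      constructor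
      · simp [abs_of_pos hx, hR.le]
      · have h := norm_sub_le ((x : ℂ) + ((R + x : ℝ) : ℂ) * Complex.exp (θ * Complex.I)) x
        rw [add_sub_cancel_left, norm_mul, norm_exp_angle, Complex.norm_real, Complex.norm_real,
          Real.norm_of_nonneg hx.le, Real.norm_of_nonneg (by linarith)] at h
        linarith
    obtain ⟨t, ht, hte⟩ := hsub hmem
    exact ⟨t, ht.1, hte⟩
  have hcl : IsClosed S := isClosed_Ici.inter (isClosed_singleton.preimage hcont)
  have hmem : sInf S ∈ S := hcl.csInf_mem hne ⟨0, fun t ht => ht.1⟩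
  have h0 : sInf S ≠ 0 := by
    intro h
    rw [h] at hmem
    have := hmem.2
    simp [abs_of_pos hx] at this
    linarith
  exact lt_of_le_of_ne hmem.1 (Ne.symm h0)

theorem rayDist_eq {x θ R d : ℝ} (hd : 0 ≤ d) (h : ‖rayPoint x θ d‖ = R)
    (hmin : ∀ t, 0 ≤ t → ‖rayPoint x θ t‖ = R → d ≤ t) : rayDist x θ R = d :=
  IsLeast.csInf_eq ⟨⟨hd, h⟩, fun t ht => hmin t ht.1 ht.2⟩

theorem cos_arc_le {φ v : ℝ} (h0 : 0 ≤ φ) (h1 : φ ≤ Real.pi) (hv0 : 0 ≤ v) (hv1 : v ≤ 1) :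
    Real.cos (φ + v * (2 * Real.pi - 2 * φ)) ≤ Real.cos φ := by
  set a := φ + v * (2 * Real.pi - 2 * φ) with ha
  have e1 : φ ≤ a := by rw [ha]; nlinarith
  have e2 : a ≤ 2 * Real.pi - φ := by rw [ha]; nlinarith
  rcases le_total a Real.pi with h | h
  · exact Real.cos_le_cos_of_nonneg_of_le_pi h0 h e1
  · rw [← Real.cos_two_pi_sub a]
    exact Real.cos_le_cos_of_nonneg_of_le_pi h0 (by linarith) (by linarith)

/-- The arc runs from angle `φ` to `2π - φ` through `π`, so it stays to the left of its end points.
Combined with monotonicity in `Re z` on circles, this reduces arc bounds to the end of the ray. -/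
theorem arcPath_arg_re_le {ζ : ℂ} {R v : ℝ} (hR : ‖ζ‖ = R) (him : 0 ≤ ζ.im) (hv0 : 0 ≤ v)
    (hv1 : v ≤ 1) : (arcPath R (Complex.arg ζ) v).re ≤ ζ.re := by
  unfold arcPath
  rw [Complex.re_ofReal_mul, Complex.exp_ofReal_mul_I_re]
  have h := cos_arc_le (Complex.arg_nonneg_iff.2 him) (Complex.arg_le_pi ζ) hv0 hv1
  calc _ ≤ R * Real.cos (Complex.arg ζ) := by
        apply mul_le_mul_of_nonneg_left h
        rw [← hR]; exact norm_nonneg _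
    _ = ζ.re := by rw [← hR, Complex.norm_mul_cos_arg]

/-- The hypothesis on the connecting segment is conditional because for `ρ = 0` that segment is a
point and carries no weight. -/
theorem forall_scaledPoint_of {x θ R ρ m : ℝ} {P : ℂ → Prop}
    (hray : ∀ ψ, ψ = θ ∨ ψ = -θ → ∀ v, ρ < v → v ≤ m * rayDist x θ R →
      P (x + rayPoint 0 ψ v / m))
    (hmid : rayPoint 0 θ ρ - rayPoint 0 (-θ) ρ ≠ 0 → ∀ v ∈ Ioc (0 : ℝ) 1,
      P (x + segmentPath (rayPoint 0 (-θ) ρ) (rayPoint 0 θ ρ) v / m))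
    (harc : ∀ v ∈ Ioc (0 : ℝ) 1,
      P (arcPath R (Complex.arg (rayPoint x θ (rayDist x θ R))) v))
    (i : Fin 4) (v : ℝ) (hw : scaledWeight x θ R ρ m i v ≠ 0) :
    P (scaledPoint x θ R ρ m i v) := by
  have hmem : ∀ {S : Set ℝ} {f : ℝ → ℂ}, S.indicator f v ≠ 0 → v ∈ S :=
    fun h => mem_of_indicator_ne_zero h
  fin_cases i
  · have hv : v ∈ Ioc ρ (m * rayDist x θ R) :=
      hmem (f := fun _ => -Complex.exp (-(θ * Complex.I))) hw
    exact hray (-θ) (Or.inr rfl) v hv.1 hv.2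
  · have hv : v ∈ Ioc (0 : ℝ) 1 :=
      hmem (f := fun _ => rayPoint 0 θ ρ - rayPoint 0 (-θ) ρ) hw
    refine hmid (fun h => hw ?_) v hv
    change (Ioc (0 : ℝ) 1).indicator (fun _ => rayPoint 0 θ ρ - rayPoint 0 (-θ) ρ) v = 0
    rw [h]; simp
  · have hv : v ∈ Ioc ρ (m * rayDist x θ R) :=
      hmem (f := fun _ => Complex.exp (θ * Complex.I)) hw
    exact hray θ (Or.inl rfl) v hv.1 hv.2
  · by_contra hP
    exact hw (scaledWeight_three_of_notMem fun hv => hP (harc v hv))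

theorem norm_log_le (w : ℂ) : ‖Complex.log w‖ ≤ |Real.log ‖w‖| + Real.pi := by
  refine (Complex.norm_le_abs_re_add_abs_im _).trans ?_
  rw [Complex.log_re, Complex.log_im]
  gcongr
  exact Complex.abs_arg_le_pi w

theorem norm_log_le_of_mem {w : ℂ} {a b : ℝ} (ha : 0 < a) (h1 : a ≤ ‖w‖) (h2 : ‖w‖ ≤ b) :
    ‖Complex.log w‖ ≤ |Real.log a| + |Real.log b| + Real.pi := by
  refine (norm_log_le w).trans ?_
  have h3 := Real.log_le_log ha h1
  have h4 := Real.log_le_log (ha.trans_le h1) h2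
  gcongr
  rw [abs_le]
  constructor
  · linarith [neg_abs_le (Real.log a), abs_nonneg (Real.log b)]
  · linarith [le_abs_self (Real.log b), abs_nonneg (Real.log a)]

section Param

variable {q κ : ℝ}

/-- Principal logarithms jump across their cuts, but `‖log w‖ ≤ |log ‖w‖| + π` still bounds them
away from `0`, `1/q` and infinity. This is needed on arcs that cross the cuts. -/
theorem exists_log_bounds (hp : IsParam q κ) {a : ℝ} (ha : 0 < a) (b : ℝ) :
    ∃ K, 0 ≤ K ∧ ∀ z : ℂ, a ≤ ‖z‖ → ‖z‖ ≤ b → a ≤ ‖1 - q * z‖ →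
      ‖GOneBar q κ z‖ ≤ K ∧ ‖Complex.log (z / zCrit q κ)‖ ≤ K := by
  have hz := zCrit_pos hp
  have hq := hp.q_pos
  set K1 := |Real.log a| + |Real.log (1 + q * b)| + Real.pi with hK1
  set K2 := |Real.log a| + |Real.log b| + Real.pi with hK2
  set K3 := |Real.log (a / zCrit q κ)| + |Real.log (b / zCrit q κ)| + Real.pi with hK3
  have p1 : 0 ≤ K1 := by rw [hK1]; positivity
  have p2 : 0 ≤ K2 := by rw [hK2]; positivity
  have p3 : 0 ≤ K3 := by rw [hK3]; positivity
  refine ⟨K1 + |pOne q κ| * K2 + ‖GOne q κ (zCrit q κ)‖ + K3, by positivity,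
    fun z h1 h2 h3 => ?_⟩
  have l1 : ‖Complex.log (1 - q * z)‖ ≤ K1 := by
    refine norm_log_le_of_mem ha h3 ((norm_sub_le _ _).trans ?_)
    rw [norm_one, norm_mul, Complex.norm_real, Real.norm_of_nonneg hq.le]
    gcongr
  have l2 : ‖Complex.log z‖ ≤ K2 := norm_log_le_of_mem ha h1 h2
  have l3 : ‖Complex.log (z / zCrit q κ)‖ ≤ K3 := by
    have e : ‖z / (zCrit q κ : ℂ)‖ = ‖z‖ / zCrit q κ := by
      rw [norm_div, Complex.norm_real, Real.norm_of_nonneg hz.le]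
    refine norm_log_le_of_mem (by positivity) ?_ ?_ <;> rw [e] <;> gcongr
  constructor
  · have : ‖GOneBar q κ z‖ ≤ K1 + |pOne q κ| * K2 + ‖GOne q κ (zCrit q κ)‖ := by
      unfold GOneBar
      refine (norm_sub_le _ _).trans ?_
      gcongr
      unfold GOne
      refine (norm_sub_le _ _).trans ?_
      rw [norm_neg, norm_mul, Complex.norm_real, Real.norm_eq_abs]
      gcongr
    linarith
  · have : 0 ≤ |pOne q κ| * K2 := by positivity
    linarith [norm_nonneg (GOne q κ (zCrit q κ))]

theorem SOne_re (z : ℂ) (hz : z ≠ 0) :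
    (SOne q κ z).re = Real.log (‖z - q‖ / ‖z‖) - κ * Real.log ‖1 - q * z‖ -
      hOne q κ * Real.log ‖z‖ := by
  unfold SOne
  have e : 1 - (q : ℂ) / z = (z - q) / z := by field_simp
  rw [Complex.sub_re, Complex.sub_re, Complex.re_ofReal_mul, Complex.re_ofReal_mul,
    Complex.log_re, Complex.log_re, Complex.log_re, e, norm_div]

theorem GOne_re (z : ℂ) :
    (GOne q κ z).re = -Real.log ‖1 - q * z‖ - pOne q κ * Real.log ‖z‖ := by
  unfold GOne
  rw [Complex.sub_re, Complex.neg_re, Complex.re_ofReal_mul, Complex.log_re, Complex.log_re]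

theorem norm_sq_sub_q (z : ℂ) : ‖z - q‖ ^ 2 = ‖z‖ ^ 2 - 2 * q * z.re + q ^ 2 := by
  rw [← Complex.normSq_eq_norm_sq, ← Complex.normSq_eq_norm_sq, Complex.normSq_apply,
    Complex.normSq_apply]
  simp; ring

theorem norm_sq_one_sub (z : ℂ) :
    ‖1 - q * z‖ ^ 2 = 1 - 2 * q * z.re + q ^ 2 * ‖z‖ ^ 2 := by
  rw [← Complex.normSq_eq_norm_sq, ← Complex.normSq_eq_norm_sq, Complex.normSq_apply,
    Complex.normSq_apply]
  simp; ring

theorem one_sub_le_norm (hq : 0 < q) (z : ℂ) : 1 - q * ‖z‖ ≤ ‖1 - q * z‖ := by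
  have h := norm_sub_norm_le (1 : ℂ) (q * z)
  rwa [norm_one, norm_mul, Complex.norm_real, Real.norm_of_nonneg hq.le] at h

/-- Bernoulli's inequality for exponents in `(0, 1)`: `(1 + d/p')^κ ≤ (1 + d/(κp))^κ ≤ 1 + d/p`. -/
theorem log_bernoulli {p p' d κ : ℝ} (hp : 0 < p) (hp' : 0 < p') (hd : 0 ≤ d) (hκ : 0 < κ)
    (hκ1 : κ < 1) (h : κ * p ≤ p') :
    κ * (Real.log (p' + d) - Real.log p') ≤ Real.log (p + d) - Real.log p := by
  have e1 : Real.log (p' + d) - Real.log p' = Real.log (1 + d / p') := by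
    rw [← Real.log_div (by positivity) (by positivity)]; congr 1; field_simp
  have e2 : Real.log (p + d) - Real.log p = Real.log (1 + d / p) := by
    rw [← Real.log_div (by positivity) (by positivity)]; congr 1; field_simp
  rw [e1, e2, ← Real.log_rpow (by positivity)]
  apply Real.log_le_log (by positivity)
  have hb := rpow_one_add_le_one_add_mul_self (s := d / p / κ)
    (by linarith [show 0 ≤ d / p / κ by positivity]) hκ.le hκ1.le
  calc (1 + d / p') ^ κ ≤ (1 + d / p / κ) ^ κ := by
        gcongr ?_ ^ κ
        rw [div_div, mul_comm p κ]
        gcongr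
    _ ≤ 1 + κ * (d / p / κ) := hb
    _ = 1 + d / p := by field_simp

/-- On circles of radius at most `z_c`, the real part of `S₁` decreases with `Re z`. -/
theorem SOne_re_le_of_re_le (hp : IsParam q κ) {z ζ : ℂ} (hn : ‖z‖ = ‖ζ‖) (h1 : 1 ≤ ‖ζ‖)
    (h2 : ‖ζ‖ ≤ zCrit q κ) (hre : z.re ≤ ζ.re) : (SOne q κ ζ).re ≤ (SOne q κ z).re := by
  obtain ⟨hq, hq1, hκ, hκ1⟩ := hp
  have hs := Real.sqrt_pos.2 hκ
  have hzn : z ≠ 0 := by rw [← norm_pos_iff, hn]; linarith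
  have hζn : ζ ≠ 0 := by rw [← norm_pos_iff]; linarith
  have hqz := q_mul_zCrit_lt_one hq hq1 hκ
  set r := ‖ζ‖ with hr
  have hqr : 0 < 1 - q * r := by nlinarith
  have pos1 : ∀ w : ℂ, ‖w‖ = r → 0 < ‖w - q‖ := by
    intro w hw
    have h := norm_sub_norm_le w q
    rw [Complex.norm_real, Real.norm_of_nonneg hq.le, hw] at h
    linarith
  have pos2 : ∀ w : ℂ, ‖w‖ = r → 0 < ‖1 - q * w‖ := by
    intro w hw
    have h := one_sub_le_norm hq w
    rw [hw] at h; linarith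
  rw [SOne_re z hzn, SOne_re ζ hζn, hn, Real.log_div (pos1 z hn).ne' (by linarith),
    Real.log_div (pos1 ζ hr.symm).ne' (by linarith)]
  have hlog : ∀ y : ℝ, 0 < y → Real.log y = Real.log (y ^ 2) / 2 := by
    intro y _; rw [Real.log_pow]; push_cast; ring
  rw [hlog _ (pos1 z hn), hlog _ (pos1 ζ hr.symm), hlog _ (pos2 z hn), hlog _ (pos2 ζ hr.symm)]
  -- At the real point `r` this is the square of `√κ (r - q) ≤ 1 - q r`, which is `r ≤ z_c`. Passing
  -- from `r` to `ζ` adds `2q(1 - κ)(r - Re ζ) ≥ 0` to the difference of the two sides.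
  have hcond : κ * ‖ζ - q‖ ^ 2 ≤ ‖1 - q * ζ‖ ^ 2 := by
    rw [norm_sq_sub_q, norm_sq_one_sub, ← hr]
    have hle : √κ * (r - q) ≤ 1 - q * r := by
      unfold zCrit at h2
      rw [le_div_iff₀ (by positivity)] at h2
      linarith
    have hsq : (√κ * (r - q)) ^ 2 ≤ (1 - q * r) ^ 2 := by
      have : 0 ≤ √κ * (r - q) := mul_nonneg hs.le (by linarith)
      gcongr
    rw [mul_pow, Real.sq_sqrt hκ.le] at hsq
    have hζre : ζ.re ≤ r := Complex.re_le_norm ζ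
    have : 0 ≤ 2 * q * (1 - κ) * (r - ζ.re) :=
      mul_nonneg (mul_nonneg (by linarith) (by linarith)) (by linarith)
    nlinarith
  -- Moving left on the circle increases `‖z - q‖²` and `‖1 - qz‖²` by the same amount `d`.
  have hb := log_bernoulli (d := 2 * q * (ζ.re - z.re)) (pow_pos (pos1 ζ hr.symm) 2)
    (pow_pos (pos2 ζ hr.symm) 2) (by
      have : 0 ≤ ζ.re - z.re := by linarith
      positivity) hκ hκ1 hcond
  have e1 : ‖ζ - q‖ ^ 2 + 2 * q * (ζ.re - z.re) = ‖z - q‖ ^ 2 := by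
    rw [norm_sq_sub_q, norm_sq_sub_q, hn, hr]; ring
  have e2 : ‖1 - q * ζ‖ ^ 2 + 2 * q * (ζ.re - z.re) = ‖1 - q * z‖ ^ 2 := by
    rw [norm_sq_one_sub, norm_sq_one_sub, hn, hr]; ring
  rw [e1, e2] at hb
  linarith

/-- On circles inside the disc of radius `q⁻¹`, the real part of `G₁` increases with `Re z`. -/
theorem GOne_re_le_of_re_le (hq : 0 < q) {z ζ : ℂ} (hn : ‖z‖ = ‖ζ‖) (h1 : q * ‖ζ‖ < 1)
    (hre : z.re ≤ ζ.re) : (GOne q κ z).re ≤ (GOne q κ ζ).re := by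
  rw [GOne_re, GOne_re, hn]
  have hpos : 0 < ‖1 - q * ζ‖ := by linarith [one_sub_le_norm hq ζ]
  have hle : ‖1 - q * ζ‖ ≤ ‖1 - q * z‖ := by
    refine (le_abs_self _).trans (abs_le_of_sq_le_sq ?_ (norm_nonneg _))
    rw [norm_sq_one_sub, norm_sq_one_sub, hn]
    nlinarith
  have := Real.log_le_log hpos hle
  linarith

end Param


/-! ### The three families of contours -/

section Families

variable {q κ : ℝ}

theorem norm_segmentPath_symm_le (θ : ℝ) {ρ v : ℝ} (hρ : 0 ≤ ρ) (hv : v ∈ Ioc (0 : ℝ) 1) :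
    ‖segmentPath (rayPoint 0 (-θ) ρ) (rayPoint 0 θ ρ) v‖ ≤ ρ := by
  have e : segmentPath (rayPoint 0 (-θ) ρ) (rayPoint 0 θ ρ) v =
      ((1 - v : ℝ) : ℂ) * rayPoint 0 (-θ) ρ + (v : ℂ) * rayPoint 0 θ ρ := by
    simp only [segmentPath]; push_cast; ring
  rw [e]
  refine (norm_add_le _ _).trans ?_
  rw [norm_mul, norm_mul, norm_rayPoint_zero hρ, norm_rayPoint_zero hρ, Complex.norm_real,
    Complex.norm_real, Real.norm_of_nonneg hv.1.le, Real.norm_of_nonneg (by linarith [hv.2])]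
  linarith

theorem isDescentContour_ray {θ R : ℝ} (h : IsDescentContour q κ θ R) (hR : zCrit q κ < R)
    (hz : 0 < zCrit q κ) {ψ t : ℝ}
    (hψ : ψ = θ ∨ ψ = -θ) (ht : 0 ≤ t) (htD : t ≤ rayDist (zCrit q κ) θ R) :
    rayPoint (zCrit q κ) ψ t ∈ contourSet (zCrit q κ) θ R 0 := by
  have hD := rayDist_pos hz hR θ
  rcases hψ with rfl | rfl
  · refine mem_iUnion.2 ⟨2, t / rayDist (zCrit q κ) ψ R, ⟨by positivity, ?_⟩, ?_⟩
    · rwa [div_le_one hD]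
    · change segmentPath (rayPoint (zCrit q κ) ψ 0)
        (rayPoint (zCrit q κ) ψ (rayDist (zCrit q κ) ψ R)) _ = _
      have : (rayDist (zCrit q κ) ψ R : ℂ) ≠ 0 := by exact_mod_cast hD.ne'
      simp only [segmentPath, rayPoint]; push_cast; field_simp; ring
  · refine mem_iUnion.2 ⟨0, 1 - t / rayDist (zCrit q κ) θ R, ⟨?_, ?_⟩, ?_⟩
    · rw [sub_nonneg]; rwa [div_le_one hD]
    · have : 0 ≤ t / rayDist (zCrit q κ) θ R := by positivity
      linarith
    · change segmentPath (rayPoint (zCrit q κ) (-θ) (rayDist (zCrit q κ) (-θ) R))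
        (rayPoint (zCrit q κ) (-θ) 0) _ = _
      rw [rayDist_neg]
      have : (rayDist (zCrit q κ) θ R : ℂ) ≠ 0 := by exact_mod_cast hD.ne'
      simp only [segmentPath, rayPoint]; push_cast; field_simp; ring

theorem zCrit_lt_of_inv_lt (hp : IsParam q κ) {R : ℝ} (hR : q⁻¹ < R) : zCrit q κ < R := by
  have h := q_mul_zCrit_lt_one hp.q_pos hp.q_lt_one hp.κ_pos
  rw [mul_comm, ← lt_div_iff₀ hp.q_pos, one_div] at h
  exact h.trans hR

theorem q_mul_gt_one (hp : IsParam q κ) {R : ℝ} (hR : q⁻¹ < R) : 1 < q * R := by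
  rw [← inv_mul_lt_iff₀ hp.q_pos]; simpa using hR

/-- Near `z_c` the Taylor bounds apply, with `cos 3θ < 0` because `3θ` lies in `(3π/4, 3π/2)`.
Farther out the ray has bounded length, so the uniform descent `-ψ(δ)` and the uniform bounds on the
logarithms can be rewritten as bounds by powers of `t`. -/
theorem exists_descent_ray_bounds (hp : IsParam q κ) {θ R : ℝ} (h : IsDescentContour q κ θ R)
    {ψ : ℝ} (hψ : ψ = θ ∨ ψ = -θ) :
    ∃ c > 0, ∃ K, ∀ t, 0 < t → t ≤ rayDist (zCrit q κ) θ R →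
      1 * (SOneBar q κ (rayPoint (zCrit q κ) ψ t)).re ≤ -c * t ^ 3 ∧
      ‖GOneBar q κ (rayPoint (zCrit q κ) ψ t)‖ ≤ K * t ^ 2 ∧
      ‖Complex.log (rayPoint (zCrit q κ) ψ t / zCrit q κ)‖ ≤ K * t := by
  obtain ⟨hθ, hR, Ψ, hΨ⟩ := id h
  have hz := zCrit_pos hp
  have hq := hp.q_pos
  have hσ := sigma_pos hp
  have hzR := zCrit_lt_of_inv_lt hp hR
  have hD := rayDist_pos hz hzR θ
  have hmem := fun t ht htD => isDescentContour_ray h hzR hz (t := t) hψ ht htD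
  set D := rayDist (zCrit q κ) θ R
  have hsin : 0 < Real.sin θ :=
    Real.sin_pos_of_pos_of_lt_pi (by linarith [hθ.1, Real.pi_pos]) (by linarith [hθ.2, Real.pi_pos])
  have hcos : 0 < Real.cos θ :=
    Real.cos_pos_of_mem_Ioo ⟨by linarith [hθ.1, Real.pi_pos], hθ.2⟩
  have hcos3 : Real.cos ((3 : ℕ) * ψ) < 0 := by
    have : Real.cos ((3 : ℕ) * θ) < 0 := by
      push_cast
      exact Real.cos_neg_of_pi_div_two_lt_of_lt (by linarith [hθ.1, Real.pi_pos])
        (by linarith [hθ.2])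
    rcases hψ with rfl | rfl
    · exact this
    · rwa [mul_neg, Real.cos_neg]
  have hcosψ : 0 < Real.cos ψ := by rcases hψ with rfl | rfl <;> simpa using hcos
  have hsinψ : |Real.sin ψ| = Real.sin θ := by
    rcases hψ with rfl | rfl
    · exact abs_of_pos hsin
    · rw [Real.sin_neg, abs_neg, abs_of_pos hsin]
  obtain ⟨B, hB, hBe⟩ := exists_SOneBar_expansion hq hp.q_lt_one hp.κ_pos hp.κ_lt_one
  have hB' : Tendsto B (𝓝 0) (𝓝 ((sigmaOne q κ ^ 3 / 3 : ℝ) : ℂ)) := by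
    push_cast; exact hB
  obtain ⟨c, hc0, hc⟩ : ∃ c > 0,
      1 * (Real.cos ((3 : ℕ) * ψ) * (sigmaOne q κ ^ 3 / 3)) < -c := by
    have : Real.cos ((3 : ℕ) * ψ) * (sigmaOne q κ ^ 3 / 3) < 0 :=
      mul_neg_of_neg_of_pos hcos3 (by positivity)
    exact ⟨-(Real.cos ((3 : ℕ) * ψ) * (sigmaOne q κ ^ 3 / 3)) / 2, by linarith, by linarith⟩
  obtain ⟨δ₁, hδ₁, hS⟩ := exists_re_le_of_expansion hB' hBe hc
  obtain ⟨δ₂, hδ₂, K₁, hK₁0, hK₁⟩ := exists_local_bounds hp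
  set δ := min δ₁ δ₂ with hδdef
  have hδ : 0 < δ := lt_min hδ₁ hδ₂
  -- For `t ≥ δ` the imaginary part keeps `1 - qz` at distance at least `q δ sin θ` from zero.
  set a := min (zCrit q κ) (q * δ * Real.sin θ) with hadef
  have ha : 0 < a := lt_min hz (by positivity)
  obtain ⟨K₂, hK₂0, hK₂⟩ := exists_log_bounds hp ha (zCrit q κ + D)
  obtain ⟨hΨ0, hΨ1⟩ := hΨ δ hδ
  refine ⟨min c (Ψ δ / D ^ 3), lt_min hc0 (by positivity),
    K₁ + K₂ / δ ^ 2 + K₂ / δ, fun t ht htD => ?_⟩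
  have hnt : ‖rayPoint 0 ψ t‖ = t := norm_rayPoint_zero ht.le
  have q1 : 0 ≤ K₂ / δ ^ 2 := by positivity
  have q2 : 0 ≤ K₂ / δ := by positivity
  rcases le_total t δ with h1 | h1
  · obtain ⟨-, b2, b3⟩ := hK₁ (rayPoint 0 ψ t) (by
      rw [hnt]; exact h1.trans (min_le_right _ _))
    rw [← rayPoint_eq_add, hnt] at b2 b3
    refine ⟨(hS t ht (h1.trans (min_le_left _ _))).trans ?_, b2.trans ?_, b3.trans ?_⟩
    · have : min c (Ψ δ / D ^ 3) * t ^ 3 ≤ c * t ^ 3 := by gcongr; exact min_le_left _ _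
      linarith
    · gcongr; linarith
    · gcongr; linarith
  · have hre : zCrit q κ ≤ (rayPoint (zCrit q κ) ψ t).re := by
      rw [rayPoint_re]; nlinarith
    have n1 : zCrit q κ ≤ ‖rayPoint (zCrit q κ) ψ t‖ := hre.trans (Complex.re_le_norm _)
    have n2 : ‖rayPoint (zCrit q κ) ψ t‖ ≤ zCrit q κ + D := by
      rw [rayPoint_eq_add]
      refine (norm_add_le _ _).trans ?_
      rw [hnt, Complex.norm_real, Real.norm_of_nonneg hz.le]; gcongr
    have n3 : q * δ * Real.sin θ ≤ ‖1 - q * rayPoint (zCrit q κ) ψ t‖ := by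
      refine le_trans ?_ (Complex.abs_im_le_norm _)
      have : (1 - q * rayPoint (zCrit q κ) ψ t).im = -(q * (t * Real.sin ψ)) := by
        rw [Complex.sub_im, Complex.im_ofReal_mul, rayPoint_im, Complex.one_im, zero_sub]
      rw [this, abs_neg, abs_mul, abs_mul, hsinψ, abs_of_pos hq, abs_of_pos ht, mul_assoc]
      gcongr
    obtain ⟨b2, b3⟩ := hK₂ _ ((min_le_left _ _).trans n1) n2 ((min_le_right _ _).trans n3)
    refine ⟨?_, b2.trans ?_, b3.trans ?_⟩
    · have h2 := hΨ1 _ (hmem t ht.le htD) (by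
        rw [rayPoint_eq_add, add_sub_cancel_left, hnt]; exact h1)
      have h3 : min c (Ψ δ / D ^ 3) * t ^ 3 ≤ Ψ δ / D ^ 3 * D ^ 3 := by
        gcongr; exact min_le_right _ _
      rw [div_mul_cancel₀ _ (by positivity)] at h3
      unfold SOneBar
      linarith
    · calc K₂ = K₂ / δ ^ 2 * δ ^ 2 := by field_simp
        _ ≤ (K₁ + K₂ / δ ^ 2 + K₂ / δ) * t ^ 2 := by gcongr; linarith
    · calc K₂ = K₂ / δ * δ := by field_simp
        _ ≤ (K₁ + K₂ / δ ^ 2 + K₂ / δ) * t := by gcongr; linarith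

theorem dominatedFamily_Gamma (hp : IsParam q κ) {θ R : ℝ} (h : IsDescentContour q κ θ R)
    {τ ξ : ℕ → ℝ} {T X : ℝ} (hτ : Tendsto (fun N => τ N / mu N ^ 8) atTop (𝓝 T))
    (hξ : Tendsto (fun N => ξ N / mu N ^ 4) atTop (𝓝 X)) :
    DominatedFamily (zCrit q κ) θ (sigmaOne q κ / Real.cos θ) (fun _ => R) (mScale q κ)
      (fun N z => Complex.exp (phase q κ 1 (τ N) (ξ N) N z))
      (fun Z => Complex.exp (phaseLim q κ 1 T X Z)) := by
  obtain ⟨hθ, hR, Ψ, hΨ⟩ := id h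
  have hz := zCrit_pos hp
  have hq := hp.q_pos
  have hσ := sigma_pos hp
  have hzR := zCrit_lt_of_inv_lt hp hR
  have hqR := q_mul_gt_one hp hR
  have hD := rayDist_pos hz hzR θ
  have hcos : 0 < Real.cos θ :=
    Real.cos_pos_of_mem_Ioo ⟨by linarith [hθ.1, Real.pi_pos], hθ.2⟩
  have hρ : 0 ≤ sigmaOne q κ / Real.cos θ := by positivity
  obtain ⟨c₁, hc₁, K₁, hb₁⟩ := exists_descent_ray_bounds hp h (Or.inl rfl)
  obtain ⟨c₂, hc₂, K₂, hb₂⟩ := exists_descent_ray_bounds hp h (Or.inr rfl)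
  obtain ⟨C₁, hC₁⟩ := exists_phase_ray_bound hp 1 (D := fun _ => rayDist (zCrit q κ) θ R)
    hτ hξ hc₁ (Eventually.of_forall fun _ => hb₁)
  obtain ⟨C₂, hC₂⟩ := exists_phase_ray_bound hp 1 (D := fun _ => rayDist (zCrit q κ) θ R)
    hτ hξ hc₂ (Eventually.of_forall fun _ => hb₂)
  obtain ⟨C₃, hC₃⟩ := exists_phase_local_bound hp 1 hτ hξ (sigmaOne q κ / Real.cos θ)
  set a := min R (q * R - 1) with hadef
  have ha : 0 < a := lt_min (by linarith) (by linarith)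
  obtain ⟨K, hK0, hK⟩ := exists_log_bounds hp ha R
  obtain ⟨hΨ0, hΨ1⟩ := hΨ (R - zCrit q κ) (by linarith)
  -- On the arc `N S̄₁` contributes `-ψ μ¹²`, while the other two terms are at most of order `μ⁸`;
  -- `μ¹¹` is a convenient upper bound for both.
  refine DominatedFamily.of_phase (C := max C₁ C₂) (c := 1) (C' := C₃) (B := R)
    (b := fun N => -Ψ (R - zCrit q κ) * mu N ^ (11 + 1) +
      (K * (|T| + 1) + K * (|X| + 1)) * mu N ^ 11)
    (fun N => measurable_phase _ _ _ _ _ _) (tendsto_mScale hp)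
    ((tendsto_mScale hp).atTop_mul_const hD)
    (Eventually.of_forall fun _ => ⟨by linarith, le_rfl⟩) one_pos ?_ ?_
    (tendsto_mScale_mul_exp q κ hΨ0 _ (by norm_num)) ?_ (tendsto_phase hp 1 hτ hξ)
  · filter_upwards [hC₁, hC₂] with N h1 h2 v hv hvD ψ hψ
    rcases hψ with rfl | rfl
    · exact (h1 v (hρ.trans_lt hv) hvD).trans (by gcongr; exact le_max_left _ _)
    · exact (h2 v (hρ.trans_lt hv) hvD).trans (by gcongr; exact le_max_right _ _)
  · filter_upwards [hC₃] with N h1 v hv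
    exact h1 _ (norm_segmentPath_symm_le θ hρ hv)
  · filter_upwards [eventually_abs_le_of_tendsto_div hτ, eventually_abs_le_of_tendsto_div hξ,
      eventually_mu_ge_one] with N h1 h2 h3 v hv
    set z := arcPath R (Complex.arg (rayPoint (zCrit q κ) θ (rayDist (zCrit q κ) θ R))) v with hzdef
    have hn : ‖z‖ = R := norm_arcPath (by linarith) _ _
    have hmem : z ∈ contourSet (zCrit q κ) θ R 0 := mem_iUnion.2 ⟨3, v, ⟨hv.1.le, hv.2⟩, rfl⟩
    have hfar : R - zCrit q κ ≤ ‖z - zCrit q κ‖ := by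
      have := norm_sub_norm_le z (zCrit q κ)
      rwa [hn, Complex.norm_real, Real.norm_of_nonneg hz.le] at this
    have hS := hΨ1 z hmem hfar
    have h1q : q * R - 1 ≤ ‖1 - q * z‖ := by
      have := norm_sub_norm_le (q * z) 1
      rwa [norm_sub_rev, norm_mul, Complex.norm_real, Real.norm_of_nonneg hq.le, hn,
        norm_one] at this
    obtain ⟨b2, b3⟩ := hK z (by rw [hn]; exact min_le_left _ _) hn.le
      ((min_le_right _ _).trans h1q)
    refine (re_phase_le q κ 1 _ _ N z).trans ?_
    have hN : (N : ℝ) * (1 * (SOneBar q κ z).re) ≤ -Ψ (R - zCrit q κ) * mu N ^ (11 + 1) := by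
      rw [natCast_eq_mu_pow, one_mul, mul_comm (-Ψ _)]
      exact mul_le_mul_of_nonneg_left hS (by positivity)
    have p1 : mu N ^ 8 ≤ mu N ^ 11 := pow_le_pow_right₀ h3 (by norm_num)
    have p2 : mu N ^ 4 ≤ mu N ^ 11 := pow_le_pow_right₀ h3 (by norm_num)
    have e1 : |τ N| * ‖GOneBar q κ z‖ ≤ (|T| + 1) * mu N ^ 11 * K := by
      refine mul_le_mul (h1.trans ?_) b2 (norm_nonneg _) (by positivity)
      gcongr
    have e2 : |ξ N| * ‖Complex.log (z / zCrit q κ)‖ ≤ (|X| + 1) * mu N ^ 11 * K := by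
      refine mul_le_mul (h2.trans ?_) b3 (norm_nonneg _) (by positivity)
      gcongr
    exact (add_le_add (add_le_add hN e1) e2).trans (le_of_eq (by ring))

/-- The radius of `γ_N`. -/
noncomputable def gammaRadius (q κ : ℝ) (N : ℕ) : ℝ :=
  √(zCrit q κ ^ 2 + (N : ℝ) ^ (-(1 / 6) : ℝ) - zCrit q κ * (N : ℝ) ^ (-(1 / 12) : ℝ))

/-- The radius of `γ̃_N`. -/
noncomputable def gammaTildeRadius (q κ : ℝ) (N : ℕ) : ℝ :=
  √(zCrit q κ ^ 2 + (N : ℝ) ^ (-(1 / 6) : ℝ))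

/-- Law of cosines with `cos (2π/3) = -1/2`: the circle passes through the points at distance
`N^{-1/12}` on the rays. -/
theorem gammaRadius_eq (q κ : ℝ) (N : ℕ) :
    gammaRadius q κ N = ‖rayPoint (zCrit q κ) (2 * Real.pi / 3) (mu N)⁻¹‖ := by
  have h1 := rpow_neg_eq_mu_pow N 2
  have h2 := rpow_neg_eq_mu_pow N 1
  have e1 : (-(1 / 6) : ℝ) = -(((2 : ℕ) : ℝ) / 12) := by norm_num
  have e2 : (-(1 / 12) : ℝ) = -(((1 : ℕ) : ℝ) / 12) := by norm_num
  unfold gammaRadius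
  rw [e1, e2, h1, h2, ← Real.sqrt_sq (norm_nonneg (rayPoint _ _ _)), norm_sq_rayPoint]
  have hc : Real.cos (2 * Real.pi / 3) = -1 / 2 := by
    rw [show 2 * Real.pi / 3 = Real.pi - Real.pi / 3 by ring, Real.cos_pi_sub,
      Real.cos_pi_div_three]
    ring
  rw [hc]
  congr 1
  ring

theorem gammaTildeRadius_eq (q κ : ℝ) (N : ℕ) :
    gammaTildeRadius q κ N = ‖rayPoint (zCrit q κ) (Real.pi / 2) (mu N)⁻¹‖ := by
  have h1 := rpow_neg_eq_mu_pow N 2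
  have e1 : (-(1 / 6) : ℝ) = -(((2 : ℕ) : ℝ) / 12) := by norm_num
  unfold gammaTildeRadius
  rw [e1, h1, ← Real.sqrt_sq (norm_nonneg (rayPoint _ _ _)), norm_sq_rayPoint,
    Real.cos_pi_div_two]
  congr 1
  ring

theorem cos_two_pi_div_three : Real.cos (2 * Real.pi / 3) = -1 / 2 := by
  rw [show 2 * Real.pi / 3 = Real.pi - Real.pi / 3 by ring, Real.cos_pi_sub,
    Real.cos_pi_div_three]
  ring

theorem tendsto_mu_inv : Tendsto (fun N => (mu N)⁻¹) atTop (𝓝 0) :=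
  tendsto_mu.inv_tendsto_atTop

theorem eventually_rayDist_gamma (hp : IsParam q κ) :
    ∀ᶠ N in atTop, rayDist (zCrit q κ) (2 * Real.pi / 3) (gammaRadius q κ N) = (mu N)⁻¹ := by
  have hz := zCrit_pos hp
  filter_upwards [eventually_mu_ge_one,
    tendsto_mu_inv.eventually_lt_const (show 0 < zCrit q κ / 2 by positivity)] with N h1 h2
  refine rayDist_eq (by positivity) (gammaRadius_eq q κ N).symm fun t ht hte => ?_
  rw [gammaRadius_eq] at hte
  have h := congrArg (· ^ 2) hte
  simp only [norm_sq_rayPoint, cos_two_pi_div_three] at h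
  -- The ray meets the circle again at distance `z_c - μ⁻¹`, which is not smaller once `μ⁻¹ <
  -- z_c/2`.
  have hf : (t - (mu N)⁻¹) * (t + (mu N)⁻¹ - zCrit q κ) = 0 := by linarith
  rcases mul_eq_zero.1 hf with h | h <;> linarith

theorem eventually_rayDist_gammaTilde (q κ : ℝ) :
    ∀ᶠ N in atTop, rayDist (zCrit q κ) (Real.pi / 2) (gammaTildeRadius q κ N) = (mu N)⁻¹ := by
  filter_upwards [eventually_mu_ge_one] with N h1
  have hm : 0 ≤ (mu N)⁻¹ := by positivity
  refine rayDist_eq hm (gammaTildeRadius_eq q κ N).symm fun t ht hte => ?_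
  rw [gammaTildeRadius_eq] at hte
  have h := congrArg (· ^ 2) hte
  simp only [norm_sq_rayPoint, Real.cos_pi_div_two] at h
  have hf : (t - (mu N)⁻¹) * (t + (mu N)⁻¹) = 0 := by linarith
  rcases mul_eq_zero.1 hf with h | h <;> linarith

theorem tendsto_norm_rayPoint (x θ : ℝ) (hx : 0 < x) :
    Tendsto (fun N => ‖rayPoint x θ (mu N)⁻¹‖) atTop (𝓝 x) := by
  have h := ((continuous_rayPoint x θ).tendsto 0).norm.comp tendsto_mu_inv
  have e : ‖rayPoint x θ 0‖ = x := by simp [rayPoint, abs_of_pos hx]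
  rwa [e] at h

theorem tendsto_mScale_mul_mu_inv (hp : IsParam q κ) :
    Tendsto (fun N => mScale q κ N * (mu N)⁻¹) atTop atTop := by
  have h : Tendsto (fun N => sigmaOne q κ * mu N ^ 3) atTop atTop :=
    ((tendsto_pow_atTop (by norm_num)).comp tendsto_mu).const_mul_atTop (sigma_pos hp)
  refine h.congr' ?_
  filter_upwards [eventually_mu_ge_one] with N hN
  unfold mScale; field_simp

/-- `γ_N` stays in a fixed annulus inside the circle of radius `z_c` and to the left of `z_c`. -/
theorem eventually_gamma_geometry (hp : IsParam q κ) :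
    ∀ᶠ N in atTop, ∀ i v,
      scaledWeight (zCrit q κ) (2 * Real.pi / 3) (gammaRadius q κ N) 0 (mScale q κ N) i v ≠ 0 →
      ((1 + zCrit q κ) / 2 ≤ ‖scaledPoint (zCrit q κ) (2 * Real.pi / 3) (gammaRadius q κ N) 0
          (mScale q κ N) i v‖ ∧
        ‖scaledPoint (zCrit q κ) (2 * Real.pi / 3) (gammaRadius q κ N) 0
          (mScale q κ N) i v‖ ≤ zCrit q κ) := by
  have hz := zCrit_pos hp
  have hz1 := one_lt_zCrit hp.q_pos hp.q_lt_one hp.κ_pos hp.κ_lt_one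
  have hR : Tendsto (gammaRadius q κ) atTop (𝓝 (zCrit q κ)) := by
    rw [funext (gammaRadius_eq q κ)]
    exact tendsto_norm_rayPoint _ _ hz
  filter_upwards [eventually_mu_ge_one, eventually_rayDist_gamma hp,
    hR.eventually_const_lt (show (1 + zCrit q κ) / 2 < zCrit q κ by linarith),
    tendsto_mu_inv.eventually_lt_const (show 0 < zCrit q κ / 2 by positivity)]
    with N h1 h2 h3 h4
  have hm : 0 < mScale q κ N := by
    have := sigma_pos hp
    unfold mScale; positivity
  have hmu : 0 < (mu N)⁻¹ := by positivity
  have hkey : ∀ t, 0 ≤ t → t ≤ (mu N)⁻¹ → ∀ ψ, ψ = 2 * Real.pi / 3 ∨ ψ = -(2 * Real.pi / 3) →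
      gammaRadius q κ N ≤ ‖rayPoint (zCrit q κ) ψ t‖ ∧
        ‖rayPoint (zCrit q κ) ψ t‖ ≤ zCrit q κ := by
    intro t ht htm ψ hψ
    have hc : Real.cos ψ = -1 / 2 := by
      rcases hψ with rfl | rfl
      · exact cos_two_pi_div_three
      · rw [Real.cos_neg, cos_two_pi_div_three]
    constructor
    · rw [gammaRadius_eq]
      refine (le_abs_self _).trans (abs_le_of_sq_le_sq ?_ (norm_nonneg _))
      rw [norm_sq_rayPoint, norm_sq_rayPoint, hc, cos_two_pi_div_three]
      nlinarith
    · refine (le_abs_self _).trans (abs_le_of_sq_le_sq ?_ hz.le)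
      rw [norm_sq_rayPoint, hc]
      nlinarith
  refine forall_scaledPoint_of (P := fun z => (1 + zCrit q κ) / 2 ≤ ‖z‖ ∧ ‖z‖ ≤ zCrit q κ)
    ?_ ?_ ?_
  · intro ψ hψ v hv hvD
    rw [h2] at hvD
    rw [← rayPoint_div]
    obtain ⟨e1, e2⟩ := hkey (v / mScale q κ N) (by positivity)
      (by rw [div_le_iff₀ hm]; linarith) ψ hψ
    exact ⟨h3.le.trans e1, e2⟩
  · intro h; exact absurd (by simp [rayPoint]) h
  · intro v hv
    rw [norm_arcPath (by linarith)]
    refine ⟨h3.le, ?_⟩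
    rw [gammaRadius_eq]
    exact (hkey _ hmu.le le_rfl _ (Or.inl rfl)).2

/-- At angle `±2π/3` the cube of the direction is `1`, so `Re S̄₁` grows at the full cubic rate. -/
theorem exists_cubic_ascent (hp : IsParam q κ) {ψ : ℝ}
    (hψ : ψ = 2 * Real.pi / 3 ∨ ψ = -(2 * Real.pi / 3)) :
    ∃ c > 0, ∃ δ > 0, ∀ t, 0 < t → t ≤ δ →
      -1 * (SOneBar q κ (rayPoint (zCrit q κ) ψ t)).re ≤ -c * t ^ 3 := by
  have hσ := sigma_pos hp
  obtain ⟨B, hB, hBe⟩ := exists_SOneBar_expansion hp.q_pos hp.q_lt_one hp.κ_pos hp.κ_lt_one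
  have hB' : Tendsto B (𝓝 0) (𝓝 ((sigmaOne q κ ^ 3 / 3 : ℝ) : ℂ)) := by
    push_cast; exact hB
  have hc : Real.cos ((3 : ℕ) * ψ) = 1 := by
    rcases hψ with rfl | rfl
    · rw [show ((3 : ℕ) : ℝ) * (2 * Real.pi / 3) = 2 * Real.pi by push_cast; ring,
        Real.cos_two_pi]
    · rw [show ((3 : ℕ) : ℝ) * -(2 * Real.pi / 3) = -(2 * Real.pi) by push_cast; ring,
        Real.cos_neg, Real.cos_two_pi]
  have hpos : 0 < sigmaOne q κ ^ 3 / 6 := by positivity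
  obtain ⟨δ, hδ, h⟩ := exists_re_le_of_expansion (ε := -1) (c := sigmaOne q κ ^ 3 / 6) hB' hBe
    (ψ := ψ) (by rw [hc]; linarith)
  exact ⟨_, hpos, δ, hδ, h⟩

/-- The rays shrink to `z_c`, so the local ascent covers them entirely. On the arc `Re S̄₁` is at
least its value at the end of the ray, of order `μ⁻³`; hence `N Re S̄₁` is at least of order `μ⁹`,
more than the `μ⁸` of the `G₁` term. This is why a length of `N^{-1/12}` is admissible. -/
theorem dominatedFamily_gamma (hp : IsParam q κ)
    {τ ξ : ℕ → ℝ} {T X : ℝ} (hτ : Tendsto (fun N => τ N / mu N ^ 8) atTop (𝓝 T))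
    (hξ : Tendsto (fun N => ξ N / mu N ^ 4) atTop (𝓝 X)) :
    DominatedFamily (zCrit q κ) (2 * Real.pi / 3) 0 (gammaRadius q κ) (mScale q κ)
      (fun N z => Complex.exp (phase q κ (-1) (τ N) (ξ N) N z))
      (fun Z => Complex.exp (phaseLim q κ (-1) T X Z)) := by
  have hz := zCrit_pos hp
  have hq := hp.q_pos
  have hz1 := one_lt_zCrit hp.q_pos hp.q_lt_one hp.κ_pos hp.κ_lt_one
  have hqz := q_mul_zCrit_lt_one hq hp.q_lt_one hp.κ_pos
  have hR : Tendsto (gammaRadius q κ) atTop (𝓝 (zCrit q κ)) := by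
    rw [funext (gammaRadius_eq q κ)]
    exact tendsto_norm_rayPoint _ _ hz
  obtain ⟨δ₀, hδ₀, K₀, hK₀0, hK₀⟩ := exists_local_bounds hp
  have hrays : ∀ ψ, ψ = 2 * Real.pi / 3 ∨ ψ = -(2 * Real.pi / 3) →
      ∃ C, ∀ᶠ N in atTop, ∀ v, 0 < v → v ≤ mScale q κ N * (mu N)⁻¹ →
        (phase q κ (-1) (τ N) (ξ N) N (zCrit q κ + rayPoint 0 ψ v / mScale q κ N)).re ≤
          C - 1 * v ^ 2 := by
    intro ψ hψ
    obtain ⟨c, hc, δ, hδ, hS⟩ := exists_cubic_ascent hp hψ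
    refine exists_phase_ray_bound hp (-1) (D := fun N => (mu N)⁻¹) (K := K₀) hτ hξ hc ?_
    filter_upwards [tendsto_mu_inv.eventually_lt_const hδ,
      tendsto_mu_inv.eventually_lt_const hδ₀] with N h1 h2 t ht htm
    have hnt : ‖rayPoint 0 ψ t‖ = t := norm_rayPoint_zero ht.le
    obtain ⟨-, b2, b3⟩ := hK₀ (rayPoint 0 ψ t) (by rw [hnt]; linarith)
    rw [← rayPoint_eq_add, hnt] at b2 b3
    exact ⟨hS t ht (by linarith), b2, b3⟩
  obtain ⟨C₁, hC₁⟩ := hrays _ (Or.inl rfl)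
  obtain ⟨C₂, hC₂⟩ := hrays _ (Or.inr rfl)
  obtain ⟨C₃, hC₃⟩ := exists_phase_local_bound hp (-1) hτ hξ 0
  have ha : 0 < min 1 (1 - q * zCrit q κ) := lt_min one_pos (by linarith)
  obtain ⟨K, hK0, hK⟩ := exists_log_bounds hp ha (zCrit q κ)
  obtain ⟨c, hc, δ, hδ, hS⟩ := exists_cubic_ascent hp (Or.inl rfl)
  refine DominatedFamily.of_phase (C := max C₁ C₂) (c := 1) (C' := C₃) (B := zCrit q κ + 1)
    (b := fun N => -c * mu N ^ (8 + 1) +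
      (K * (|T| + 1) + K * (|X| + 1)) * mu N ^ 8)
    (fun N => measurable_phase _ _ _ _ _ _) (tendsto_mScale hp)
    ((tendsto_mScale_mul_mu_inv hp).congr' ?_)
    ?_ one_pos ?_ ?_
    (tendsto_mScale_mul_exp q κ hc _ (by norm_num)) ?_ (tendsto_phase hp (-1) hτ hξ)
  · filter_upwards [eventually_rayDist_gamma hp] with N hN
    rw [hN]
  · filter_upwards [hR.eventually_lt_const (lt_add_one _)] with N hN
    exact ⟨Real.sqrt_nonneg _, hN.le⟩
  · filter_upwards [hC₁, hC₂, eventually_rayDist_gamma hp] with N h1 h2 h3 v hv hvD ψ hψ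
    rw [h3] at hvD
    rcases hψ with rfl | rfl
    · exact (h1 v hv hvD).trans (by gcongr; exact le_max_left _ _)
    · exact (h2 v hv hvD).trans (by gcongr; exact le_max_right _ _)
  · filter_upwards [hC₃] with N h1 v hv
    exact h1 _ (norm_segmentPath_symm_le _ le_rfl hv)
  · filter_upwards [eventually_abs_le_of_tendsto_div hτ, eventually_abs_le_of_tendsto_div hξ,
      eventually_mu_ge_one, eventually_rayDist_gamma hp, hR.eventually_const_lt hz1,
      tendsto_mu_inv.eventually_lt_const hδ,
      tendsto_mu_inv.eventually_lt_const (show 0 < zCrit q κ / 2 by positivity)]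
      with N h1 h2 h3 h4 h5 h6 h7 v hv
    rw [h4]
    set ζ := rayPoint (zCrit q κ) (2 * Real.pi / 3) (mu N)⁻¹ with hζ
    have hζR : ‖ζ‖ = gammaRadius q κ N := (gammaRadius_eq q κ N).symm
    set z := arcPath (gammaRadius q κ N) (Complex.arg ζ) v with hzdef
    have hmu : 0 < (mu N)⁻¹ := by positivity
    have hn : ‖z‖ = ‖ζ‖ := by rw [hzdef, norm_arcPath (by linarith), hζR]
    have him : 0 ≤ ζ.im := by
      rw [hζ, rayPoint_im]
      refine mul_nonneg hmu.le (Real.sin_nonneg_of_nonneg_of_le_pi ?_ ?_) <;>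
        linarith [Real.pi_pos]
    have hζle : ‖ζ‖ ≤ zCrit q κ := by
      refine (le_abs_self _).trans (abs_le_of_sq_le_sq ?_ hz.le)
      rw [hζ, norm_sq_rayPoint, cos_two_pi_div_three]
      nlinarith
    have hSm := SOne_re_le_of_re_le hp hn (by rw [hζR]; exact h5.le) hζle
      (arcPath_arg_re_le hζR him hv.1.le hv.2)
    have hSz := hS (mu N)⁻¹ hmu h6.le
    have h1q : 1 - q * zCrit q κ ≤ ‖1 - q * z‖ := by
      refine le_trans ?_ (one_sub_le_norm hq z)
      have : q * ‖z‖ ≤ q * zCrit q κ := by rw [hn]; gcongr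
      linarith
    obtain ⟨b2, b3⟩ := hK z ((min_le_left _ _).trans (by rw [hn, hζR]; exact h5.le))
      (by rw [hn]; exact hζle) ((min_le_right _ _).trans h1q)
    refine (re_phase_le q κ (-1) _ _ N z).trans ?_
    have hS2 : -1 * (SOneBar q κ z).re ≤ -c * (mu N)⁻¹ ^ 3 := by
      refine le_trans ?_ hSz
      simp only [SOneBar, Complex.sub_re]
      linarith
    have hN : (N : ℝ) * (-1 * (SOneBar q κ z).re) ≤ -c * mu N ^ (8 + 1) := by
      calc _ ≤ (N : ℝ) * (-c * (mu N)⁻¹ ^ 3) :=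
            mul_le_mul_of_nonneg_left hS2 (Nat.cast_nonneg N)
        _ = _ := by rw [natCast_eq_mu_pow]; field_simp
    have p2 : mu N ^ 4 ≤ mu N ^ 8 := pow_le_pow_right₀ h3 (by norm_num)
    have e1 : |τ N| * ‖GOneBar q κ z‖ ≤ (|T| + 1) * mu N ^ 8 * K :=
      mul_le_mul h1 b2 (norm_nonneg _) (by positivity)
    have e2 : |ξ N| * ‖Complex.log (z / zCrit q κ)‖ ≤ (|X| + 1) * mu N ^ 8 * K := by
      refine mul_le_mul (h2.trans ?_) b3 (norm_nonneg _) (by positivity)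
      gcongr
    exact (add_le_add (add_le_add hN e1) e2).trans (le_of_eq (by ring))

theorem re_phase_zero_le (q κ τ ξ : ℝ) (N : ℕ) (z : ℂ) :
    (phase q κ 0 τ ξ N z).re ≤ τ * (GOneBar q κ z).re +
      |ξ| * ‖Complex.log (z / zCrit q κ)‖ := by
  unfold phase
  rw [Complex.ofReal_zero, zero_mul, zero_add, Complex.add_re, Complex.re_ofReal_mul]
  gcongr
  refine (Complex.re_le_norm _).trans ?_
  rw [norm_mul, Complex.norm_real, Real.norm_eq_abs]

theorem exists_quadratic_descent (hp : IsParam q κ) {ψ : ℝ}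
    (hψ : ψ = Real.pi / 2 ∨ ψ = -(Real.pi / 2)) :
    ∃ c > 0, ∃ δ > 0, ∀ t, 0 < t → t ≤ δ →
      1 * (GOneBar q κ (rayPoint (zCrit q κ) ψ t)).re ≤ -c * t ^ 2 := by
  have hσ := sigma_pos hp
  have hf := fOne_pos hp.q_pos hp.κ_pos
  obtain ⟨B, hB, hBe⟩ := exists_GOneBar_expansion hp.q_pos hp.q_lt_one hp.κ_pos hp.κ_lt_one
  have hB' : Tendsto B (𝓝 0) (𝓝 ((fOne q κ * sigmaOne q κ ^ 2 : ℝ) : ℂ)) := by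
    push_cast; exact hB
  have hc : Real.cos ((2 : ℕ) * ψ) = -1 := by
    rcases hψ with rfl | rfl
    · rw [show ((2 : ℕ) : ℝ) * (Real.pi / 2) = Real.pi by push_cast; ring,
        Real.cos_pi]
    · rw [show ((2 : ℕ) : ℝ) * -(Real.pi / 2) = -Real.pi by push_cast; ring,
        Real.cos_neg, Real.cos_pi]
  have hpos : 0 < fOne q κ * sigmaOne q κ ^ 2 / 2 := by positivity
  obtain ⟨δ, hδ, h⟩ := exists_re_le_of_expansion (ε := 1) (c := fOne q κ * sigmaOne q κ ^ 2 / 2)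
    hB' hBe (ψ := ψ) (by rw [hc]; linarith)
  exact ⟨_, hpos, δ, hδ, h⟩

/-- In the vertical direction `Re Ḡ₁` decreases quadratically, and positivity of `T` turns this into
Gaussian decay. On the arc `Re Ḡ₁` is at most its value at the end of the ray, so the gain is of
order `μ⁸ μ⁻² = μ⁶` against the `μ⁴` of the logarithm. -/
theorem dominatedFamily_gammaTilde (hp : IsParam q κ)
    {τ ξ : ℕ → ℝ} {T X : ℝ} (hT : 0 < T)
    (hτ : Tendsto (fun N => τ N / mu N ^ 8) atTop (𝓝 T))
    (hξ : Tendsto (fun N => ξ N / mu N ^ 4) atTop (𝓝 X)) :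
    DominatedFamily (zCrit q κ) (Real.pi / 2) 0 (gammaTildeRadius q κ) (mScale q κ)
      (fun N z => Complex.exp (phase q κ 0 (τ N) (ξ N) N z))
      (fun Z => Complex.exp (phaseLim q κ 0 T X Z)) := by
  have hz := zCrit_pos hp
  have hq := hp.q_pos
  have hσ := sigma_pos hp
  have hz1 := one_lt_zCrit hp.q_pos hp.q_lt_one hp.κ_pos hp.κ_lt_one
  have hqz := q_mul_zCrit_lt_one hq hp.q_lt_one hp.κ_pos
  have hR : Tendsto (gammaTildeRadius q κ) atTop (𝓝 (zCrit q κ)) := by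
    rw [funext (gammaTildeRadius_eq q κ)]
    exact tendsto_norm_rayPoint _ _ hz
  have hτpos : ∀ᶠ N in atTop, T / 2 * mu N ^ 8 ≤ τ N := by
    filter_upwards [hτ.eventually_const_lt (show T / 2 < T by linarith), eventually_mu_ge_one]
      with N h1 h2
    rw [lt_div_iff₀ (by positivity)] at h1
    exact h1.le
  obtain ⟨δ₀, hδ₀, K₀, hK₀0, hK₀⟩ := exists_local_bounds hp
  obtain ⟨c₁, hc₁, δ₁, hδ₁, hG₁⟩ := exists_quadratic_descent hp (Or.inl rfl)
  obtain ⟨c₂, hc₂, δ₂, hδ₂, hG₂⟩ := exists_quadratic_descent hp (Or.inr rfl)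
  set c := min c₁ c₂ with hcdef
  have hc : 0 < c := lt_min hc₁ hc₂
  set δ := min δ₀ (min δ₁ δ₂) with hδdef
  have hδ : 0 < δ := lt_min hδ₀ (lt_min hδ₁ hδ₂)
  have hG : ∀ ψ, ψ = Real.pi / 2 ∨ ψ = -(Real.pi / 2) → ∀ t, 0 < t → t ≤ δ →
      (GOneBar q κ (rayPoint (zCrit q κ) ψ t)).re ≤ -c * t ^ 2 := by
    intro ψ hψ t ht htδ
    rcases hψ with rfl | rfl
    · have := hG₁ t ht (htδ.trans ((min_le_right _ _).trans (min_le_left _ _)))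
      have : c * t ^ 2 ≤ c₁ * t ^ 2 := by gcongr; exact min_le_left _ _
      linarith
    · have := hG₂ t ht (htδ.trans ((min_le_right _ _).trans (min_le_right _ _)))
      have : c * t ^ 2 ≤ c₂ * t ^ 2 := by gcongr; exact min_le_right _ _
      linarith
  -- The rescaled quadratic rate is at least `2α`; one half absorbs the linear term `β v` by
  -- completing the square, the other remains as decay.
  set α := T * c / (4 * sigmaOne q κ ^ 2) with hα
  have hα0 : 0 < α := by positivity
  set β := (|X| + 1) * (K₀ / sigmaOne q κ) with hβ
  obtain ⟨C₃, hC₃⟩ := exists_phase_local_bound hp 0 hτ hξ 0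
  have ha : 0 < min 1 ((1 - q * zCrit q κ) / 2) := lt_min one_pos (by linarith)
  obtain ⟨K, hK0, hK⟩ := exists_log_bounds hp ha (zCrit q κ + 1)
  refine DominatedFamily.of_phase (C := β ^ 2 / (4 * α)) (c := α) (C' := C₃)
    (B := zCrit q κ + 1)
    (b := fun N => -(T / 2 * c) * mu N ^ (5 + 1) + (K * (|X| + 1)) * mu N ^ 5)
    (fun N => measurable_phase _ _ _ _ _ _) (tendsto_mScale hp)
    ((tendsto_mScale_mul_mu_inv hp).congr' ?_)
    ?_ hα0 ?_ ?_
    (tendsto_mScale_mul_exp q κ (by positivity) _ (by norm_num)) ?_ (tendsto_phase hp 0 hτ hξ)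
  · filter_upwards [eventually_rayDist_gammaTilde q κ] with N hN
    rw [hN]
  · filter_upwards [hR.eventually_lt_const (lt_add_one _)] with N hN
    exact ⟨Real.sqrt_nonneg _, hN.le⟩
  · filter_upwards [hτpos, eventually_abs_le_of_tendsto_div hξ,
      eventually_rayDist_gammaTilde q κ, eventually_mu_ge_one,
      tendsto_mu_inv.eventually_lt_const hδ] with N h1 h2 h3 h4 h5 v hv hvD ψ hψ
    rw [h3] at hvD
    have hm : 0 < mScale q κ N := by unfold mScale; positivity
    have ht : 0 < v / mScale q κ N := by positivity
    have htδ : v / mScale q κ N ≤ δ := by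
      refine le_trans ?_ h5.le
      rw [div_le_iff₀ hm]; linarith
    have hGv := hG ψ hψ _ ht htδ
    obtain ⟨-, -, b3⟩ := hK₀ (rayPoint 0 ψ (v / mScale q κ N)) (by
      rw [norm_rayPoint_zero ht.le]; exact htδ.trans (min_le_left _ _))
    rw [← rayPoint_eq_add, norm_rayPoint_zero ht.le] at b3
    rw [← rayPoint_div]
    refine (re_phase_zero_le q κ _ _ N _).trans ?_
    have e1 : τ N * (GOneBar q κ (rayPoint (zCrit q κ) ψ (v / mScale q κ N))).re ≤
        -(2 * α) * v ^ 2 := by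
      have hneg : (GOneBar q κ (rayPoint (zCrit q κ) ψ (v / mScale q κ N))).re ≤ 0 := by
        have : 0 ≤ c * (v / mScale q κ N) ^ 2 := by positivity
        linarith
      calc _ ≤ T / 2 * mu N ^ 8 *
            (GOneBar q κ (rayPoint (zCrit q κ) ψ (v / mScale q κ N))).re :=
            mul_le_mul_of_nonpos_right h1 hneg
        _ ≤ T / 2 * mu N ^ 8 * (-c * (v / mScale q κ N) ^ 2) := by gcongr
        _ = _ := by rw [hα]; unfold mScale; field_simp; ring
    have e2 : |ξ N| * ‖Complex.log (rayPoint (zCrit q κ) ψ (v / mScale q κ N) / zCrit q κ)‖ ≤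
        β * v := by
      calc _ ≤ ((|X| + 1) * mu N ^ 4) * (K₀ * (v / mScale q κ N)) := by gcongr
        _ = _ := by rw [hβ]; unfold mScale; field_simp
    have e3 : β * v ≤ β ^ 2 / (4 * α) + α * v ^ 2 := by
      have : 0 ≤ (β - 2 * α * v) ^ 2 / (4 * α) := by positivity
      have e : (β - 2 * α * v) ^ 2 / (4 * α) = β ^ 2 / (4 * α) + α * v ^ 2 - β * v := by
        field_simp; ring
      linarith
    linarith
  · filter_upwards [hC₃] with N h1 v hv
    exact h1 _ (norm_segmentPath_symm_le _ le_rfl hv)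
  · filter_upwards [hτpos, eventually_abs_le_of_tendsto_div hξ,
      eventually_mu_ge_one, eventually_rayDist_gammaTilde q κ, hR.eventually_const_lt hz1,
      tendsto_mu_inv.eventually_lt_const hδ, hR.eventually_lt_const (lt_add_one _),
      (hR.const_mul q).eventually_lt_const
        (show q * zCrit q κ < (1 + q * zCrit q κ) / 2 by linarith)]
      with N h1 h2 h3 h4 h5 h6 h7 h8 v hv
    rw [h4]
    set ζ := rayPoint (zCrit q κ) (Real.pi / 2) (mu N)⁻¹ with hζ
    have hζR : ‖ζ‖ = gammaTildeRadius q κ N := (gammaTildeRadius_eq q κ N).symm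
    set z := arcPath (gammaTildeRadius q κ N) (Complex.arg ζ) v with hzdef
    have hmu : 0 < (mu N)⁻¹ := by positivity
    have hn : ‖z‖ = ‖ζ‖ := by rw [hzdef, norm_arcPath (by linarith), hζR]
    have him : 0 ≤ ζ.im := by
      rw [hζ, rayPoint_im, Real.sin_pi_div_two]
      positivity
    have hGm := GOne_re_le_of_re_le (κ := κ) hq hn (by rw [hζR]; linarith)
      (arcPath_arg_re_le hζR him hv.1.le hv.2)
    have hGz := hG _ (Or.inl rfl) (mu N)⁻¹ hmu h6.le
    have h1q : (1 - q * zCrit q κ) / 2 ≤ ‖1 - q * z‖ := by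
      refine le_trans ?_ (one_sub_le_norm hq z)
      rw [hn, hζR]; linarith
    obtain ⟨-, b3⟩ := hK z ((min_le_left _ _).trans (by rw [hn, hζR]; exact h5.le))
      (by rw [hn, hζR]; exact h7.le) ((min_le_right _ _).trans h1q)
    refine (re_phase_zero_le q κ _ _ N z).trans ?_
    have hG2 : (GOneBar q κ z).re ≤ -c * (mu N)⁻¹ ^ 2 := by
      refine le_trans ?_ hGz
      simp only [GOneBar, Complex.sub_re]
      linarith
    have hN : τ N * (GOneBar q κ z).re ≤ -(T / 2 * c) * mu N ^ (5 + 1) := by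
      have hneg : (GOneBar q κ z).re ≤ 0 := by
        have : 0 ≤ c * (mu N)⁻¹ ^ 2 := by positivity
        linarith
      calc _ ≤ T / 2 * mu N ^ 8 * (GOneBar q κ z).re := mul_le_mul_of_nonpos_right h1 hneg
        _ ≤ T / 2 * mu N ^ 8 * (-c * (mu N)⁻¹ ^ 2) := by gcongr
        _ = _ := by field_simp
    have p2 : mu N ^ 4 ≤ mu N ^ 5 := pow_le_pow_right₀ h3 (by norm_num)
    have e2 : |ξ N| * ‖Complex.log (z / zCrit q κ)‖ ≤ (|X| + 1) * mu N ^ 5 * K := by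
      refine mul_le_mul (h2.trans ?_) b3 (norm_nonneg _) (by positivity)
      gcongr
    linarith

end Families


/-! ### The kernel entries -/

section Kernel

variable {q κ : ℝ}

theorem mScale_pos (hp : IsParam q κ) {N : ℕ} (hN : 1 ≤ mu N) : 0 < mScale q κ N := by
  have := sigma_pos hp
  unfold mScale; positivity

/-- `Γ_N` stays in a fixed annulus outside the circle of radius `z_c`, and at distance `N^{-1/3}` to
the right of `z_c` except on the arc. -/
theorem eventually_Gamma_geometry (hp : IsParam q κ) {θ R : ℝ} (h : IsDescentContour q κ θ R) :
    ∃ B, ∀ᶠ N in atTop, ∀ i v,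
      scaledWeight (zCrit q κ) θ R (sigmaOne q κ / Real.cos θ) (mScale q κ N) i v ≠ 0 →
      ∀ z, z = scaledPoint (zCrit q κ) θ R (sigmaOne q κ / Real.cos θ) (mScale q κ N) i v →
      (zCrit q κ ≤ ‖z‖ ∧ ‖z‖ ≤ B ∧ (zCrit q κ + (mu N ^ 4)⁻¹ ≤ z.re ∨ ‖z‖ = R)) := by
  obtain ⟨hθ, hR, -⟩ := id h
  have hz := zCrit_pos hp
  have hσ := sigma_pos hp
  have hzR := zCrit_lt_of_inv_lt hp hR
  have hcos : 0 < Real.cos θ :=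
    Real.cos_pos_of_mem_Ioo ⟨by linarith [hθ.1, Real.pi_pos], hθ.2⟩
  set D := rayDist (zCrit q κ) θ R with hDdef
  set ρ := sigmaOne q κ / Real.cos θ with hρ
  have hρ0 : 0 < ρ := by positivity
  have hρc : ρ * Real.cos θ = sigmaOne q κ := by rw [hρ]; field_simp
  have hD : 0 < D := rayDist_pos hz hzR θ
  refine ⟨zCrit q κ + D + ρ + R, ?_⟩
  filter_upwards [eventually_mu_ge_one, (tendsto_mScale hp).eventually_ge_atTop 1] with N h1 h2
  have hm := mScale_pos hp h1
  have key : ∀ z : ℂ, zCrit q κ + (mu N ^ 4)⁻¹ ≤ z.re → ‖z - zCrit q κ‖ ≤ D + ρ →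
      (zCrit q κ ≤ ‖z‖ ∧ ‖z‖ ≤ zCrit q κ + D + ρ + R ∧
        (zCrit q κ + (mu N ^ 4)⁻¹ ≤ z.re ∨ ‖z‖ = R)) := by
    intro z hre hn
    refine ⟨?_, ?_, Or.inl hre⟩
    · have : 0 < (mu N ^ 4)⁻¹ := by positivity
      linarith [Complex.re_le_norm z]
    · have := norm_add_le (z - zCrit q κ) (zCrit q κ)
      rw [sub_add_cancel, Complex.norm_real, Real.norm_of_nonneg hz.le] at this
      linarith
  have hinv : (mu N ^ 4)⁻¹ = sigmaOne q κ / mScale q κ N := by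
    unfold mScale; field_simp
  intro i v hw z hzeq
  subst hzeq
  refine forall_scaledPoint_of (P := fun z => zCrit q κ ≤ ‖z‖ ∧ ‖z‖ ≤ zCrit q κ + D + ρ + R ∧
        (zCrit q κ + (mu N ^ 4)⁻¹ ≤ z.re ∨ ‖z‖ = R)) ?_ ?_ ?_ i v hw
  · intro ψ hψ v hv hvD
    have hv0 : 0 < v := hρ0.trans hv
    have hcψ : Real.cos ψ = Real.cos θ := by
      rcases hψ with rfl | rfl
      · rfl
      · exact Real.cos_neg θ
    rw [← rayPoint_div]
    apply key
    · rw [rayPoint_re, hcψ, hinv, div_mul_eq_mul_div]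
      have : sigmaOne q κ ≤ v * Real.cos θ := by
        rw [← hρc]; exact mul_le_mul_of_nonneg_right hv.le hcos.le
      gcongr
    · rw [rayPoint_eq_add, add_sub_cancel_left, norm_rayPoint_zero (by positivity)]
      have : v / mScale q κ N ≤ D := by rw [div_le_iff₀ hm]; linarith
      linarith
  · intro _ v hv
    apply key
    · rw [hinv, Complex.add_re, Complex.ofReal_re, Complex.div_ofReal_re]
      gcongr
      simp [segmentPath, rayPoint_re, hρc]
    · rw [add_sub_cancel_left, norm_div, Complex.norm_real, Real.norm_of_nonneg hm.le]
      have h3 := norm_segmentPath_symm_le θ hρ0.le hv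
      have : ‖segmentPath (rayPoint 0 (-θ) ρ) (rayPoint 0 θ ρ) v‖ / mScale q κ N ≤ ρ := by
        rw [div_le_iff₀ hm]; nlinarith
      linarith
  · intro v _
    rw [norm_arcPath (by linarith)]
    exact ⟨hzR.le, by linarith, Or.inr rfl⟩

theorem eventually_gammaTilde_geometry (hp : IsParam q κ) :
    ∀ᶠ N in atTop, ∀ i v,
      scaledWeight (zCrit q κ) (Real.pi / 2) (gammaTildeRadius q κ N) 0 (mScale q κ N) i v ≠ 0 →
      zCrit q κ ≤ ‖scaledPoint (zCrit q κ) (Real.pi / 2) (gammaTildeRadius q κ N) 0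
          (mScale q κ N) i v‖ := by
  filter_upwards [eventually_mu_ge_one] with N h1
  refine forall_scaledPoint_of (P := fun z => zCrit q κ ≤ ‖z‖) ?_ ?_ ?_
  · intro ψ hψ v hv hvD
    rw [← rayPoint_div]
    refine le_trans ?_ (Complex.re_le_norm _)
    rw [rayPoint_re]
    rcases hψ with rfl | rfl <;> simp
  · intro h; exact absurd (by simp [rayPoint]) h
  · intro v _
    have hr : zCrit q κ ≤ gammaTildeRadius q κ N := by
      rw [gammaTildeRadius_eq]
      refine le_trans ?_ (Complex.re_le_norm _)
      rw [rayPoint_re]; simp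
    rwa [norm_arcPath ((zCrit_pos hp).le.trans hr)]

theorem fract_mem (κ : ℝ) (N : ℕ) :
    0 ≤ κ * N - (⌊κ * N⌋ : ℝ) ∧ κ * N - (⌊κ * N⌋ : ℝ) ≤ 1 :=
  ⟨by linarith [Int.floor_le (κ * N)], by linarith [Int.sub_one_lt_floor (κ * N)]⟩

theorem norm_fracPow_le (hq : 0 < q) (N : ℕ) {z : ℂ} {B : ℝ} (hz : ‖z‖ ≤ B) :
    ‖fracPow q κ N z‖ ≤ 1 + q * B := by
  obtain ⟨h0, h1⟩ := fract_mem κ N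
  have hB : 0 ≤ B := (norm_nonneg z).trans hz
  unfold fracPow
  rw [Complex.norm_cpow_real]
  have hle : ‖1 - q * z‖ ≤ 1 + q * B := by
    refine (norm_sub_le _ _).trans ?_
    rw [norm_one, norm_mul, Complex.norm_real, Real.norm_of_nonneg hq.le]
    gcongr
  have hone : 1 ≤ 1 + q * B := by
    have : 0 ≤ q * B := by positivity
    linarith
  calc _ ≤ (1 + q * B) ^ (κ * N - (⌊κ * N⌋ : ℝ)) := by gcongr
    _ ≤ (1 + q * B) ^ (1 : ℝ) := Real.rpow_le_rpow_of_exponent_le hone h1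
    _ = _ := Real.rpow_one _

theorem le_norm_fracPow (N : ℕ) {z : ℂ} {d : ℝ} (hd : 0 < d) (hd1 : d ≤ 1)
    (hz : d ≤ ‖1 - q * z‖) : d ≤ ‖fracPow q κ N z‖ := by
  obtain ⟨h0, h1⟩ := fract_mem κ N
  unfold fracPow
  rw [Complex.norm_cpow_real]
  calc d = d ^ (1 : ℝ) := (Real.rpow_one _).symm
    _ ≤ d ^ (κ * N - (⌊κ * N⌋ : ℝ)) := Real.rpow_le_rpow_of_exponent_ge hd hd1 h1
    _ ≤ _ := by gcongr

theorem measurable_fracPow (q κ : ℝ) (N : ℕ) : Measurable (fracPow q κ N) := by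
  unfold fracPow; fun_prop

/-- The exponent `κN - ⌊κN⌋` need not converge, but it is bounded, and the logarithms of the two
bases have the same limit. -/
theorem tendsto_fracPow_div (hp : IsParam q κ) (Z W : ℂ) :
    Tendsto (fun N => fracPow q κ N (zCrit q κ + Z / mScale q κ N) /
      fracPow q κ N (zCrit q κ + W / mScale q κ N)) atTop (𝓝 1) := by
  have hqz := q_mul_zCrit_lt_one hp.q_pos hp.q_lt_one hp.κ_pos
  have hmem : (1 - q * zCrit q κ : ℂ) ∈ Complex.slitPlane := by
    left
    have : (1 - q * zCrit q κ : ℂ) = ((1 - q * zCrit q κ : ℝ) : ℂ) := by push_cast; rfl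
    rw [this, Complex.ofReal_re]; linarith
  have hbase : ∀ Y : ℂ, Tendsto (fun N => 1 - q * (zCrit q κ + Y / mScale q κ N)) atTop
      (𝓝 (1 - q * zCrit q κ)) := by
    intro Y
    simpa using (((tendsto_div_mScale hp Y).const_add (zCrit q κ : ℂ)).const_mul
      (q : ℂ)).const_sub 1
  have hlog : Tendsto (fun N => Complex.log (1 - q * (zCrit q κ + Z / mScale q κ N)) -
      Complex.log (1 - q * (zCrit q κ + W / mScale q κ N))) atTop (𝓝 0) := by
    simpa using ((hbase Z).clog hmem).sub ((hbase W).clog hmem)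
  have hexp : Tendsto (fun N : ℕ => (Complex.log (1 - q * (zCrit q κ + Z / mScale q κ N)) -
      Complex.log (1 - q * (zCrit q κ + W / mScale q κ N))) *
        ((κ * N - (⌊κ * N⌋ : ℝ) : ℝ) : ℂ)) atTop (𝓝 0) := by
    refine squeeze_zero_norm (a := fun N => ‖_‖) (fun N => ?_) (tendsto_zero_iff_norm_tendsto_zero.1 hlog)
    rw [norm_mul, Complex.norm_real, Real.norm_of_nonneg (fract_mem κ N).1]
    exact mul_le_of_le_one_right (norm_nonneg _) (fract_mem κ N).2
  have h1 := hexp.cexp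
  rw [Complex.exp_zero] at h1
  refine h1.congr' ?_
  filter_upwards [(hbase Z).eventually (Complex.isOpen_slitPlane.mem_nhds hmem),
    (hbase W).eventually (Complex.isOpen_slitPlane.mem_nhds hmem)] with N e1 e2
  unfold fracPow
  rw [Complex.cpow_def_of_ne_zero (Complex.slitPlane_ne_zero e1),
    Complex.cpow_def_of_ne_zero (Complex.slitPlane_ne_zero e2), ← Complex.exp_sub, sub_mul]

theorem measurable_uncurry_H11 (q c κ : ℝ) (N : ℕ) :
    Measurable (Function.uncurry (H11 q c κ N)) := by
  have h := measurable_fracPow q κ N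
  unfold Function.uncurry H11
  fun_prop

theorem measurable_uncurry_H12 (q c κ : ℝ) (N : ℕ) :
    Measurable (Function.uncurry (H12 q c κ N)) := by
  have h := measurable_fracPow q κ N
  unfold Function.uncurry H12
  fun_prop

theorem measurable_uncurry_H22 (q c κ : ℝ) (N : ℕ) :
    Measurable (Function.uncurry (H22 q c κ N)) := by
  have h := measurable_fracPow q κ N
  unfold Function.uncurry H22
  fun_prop

/-- `E_{s,x}`. -/
noncomputable def EPlus (q κ s : ℝ) (N : ℕ) (x : ℝ) (z : ℂ) : ℂ :=
  Complex.exp (phase q κ 1 (bigT N s) (-(scale q κ N * x)) N z)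

/-- `1 / E_{s,x}`. -/
noncomputable def EMinus (q κ s : ℝ) (N : ℕ) (x : ℝ) (z : ℂ) : ℂ :=
  Complex.exp (phase q κ (-1) (-bigT N s) (scale q κ N * x) N z)

theorem F11_eq (q κ : ℝ) (N : ℕ) (s x t y : ℝ) (z w : ℂ) :
    F11 q κ N s x t y z w = EPlus q κ s N x z * EPlus q κ t N y w := by
  unfold F11 EPlus phase
  simp only [← Complex.exp_add]
  congr 1; push_cast; ring

theorem F12_eq (q κ : ℝ) (N : ℕ) (s x t y : ℝ) (z w : ℂ) :
    F12 q κ N s x t y z w = EPlus q κ s N x z * EMinus q κ t N y w := by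
  unfold F12 EPlus EMinus phase
  simp only [← Complex.exp_add]
  congr 1; push_cast; ring

theorem F22_eq (q κ : ℝ) (N : ℕ) (s x t y : ℝ) (z w : ℂ) :
    F22 q κ N s x t y z w = EMinus q κ s N x z * EMinus q κ t N y w := by
  unfold F22 EMinus phase
  simp only [← Complex.exp_add]
  congr 1; push_cast; ring

theorem tendsto_scale_mul_div (q κ : ℝ) {xN : ℕ → ℝ} {x : ℝ} (hx : Tendsto xN atTop (𝓝 x)) :
    Tendsto (fun N => scale q κ N * xN N / mu N ^ 4) atTop
      (𝓝 (zCrit q κ * sigmaOne q κ * x)) := by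
  refine (hx.const_mul (zCrit q κ * sigmaOne q κ)).congr' ?_
  filter_upwards [eventually_mu_ge_one] with N hN
  rw [scale_eq]; unfold mScale; field_simp

theorem dominatedFamily_EPlus (hp : IsParam q κ) {θ R : ℝ} (h : IsDescentContour q κ θ R) (s : ℝ)
    {xN : ℕ → ℝ} {x : ℝ} (hx : Tendsto xN atTop (𝓝 x)) :
    DominatedFamily (zCrit q κ) θ (sigmaOne q κ / Real.cos θ) (fun _ => R) (mScale q κ)
      (fun N => EPlus q κ s N (xN N))
      (fun Z => Complex.exp (phaseLim q κ 1 s (-(zCrit q κ * sigmaOne q κ * x)) Z)) :=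
  dominatedFamily_Gamma hp h (tendsto_bigT_div s) (by
    simpa only [neg_div] using (tendsto_scale_mul_div q κ hx).neg)

theorem dominatedFamily_EMinus (hp : IsParam q κ) (s : ℝ)
    {xN : ℕ → ℝ} {x : ℝ} (hx : Tendsto xN atTop (𝓝 x)) :
    DominatedFamily (zCrit q κ) (2 * Real.pi / 3) 0 (gammaRadius q κ) (mScale q κ)
      (fun N => EMinus q κ s N (xN N))
      (fun Z => Complex.exp (phaseLim q κ (-1) (-s) (zCrit q κ * sigmaOne q κ * x) Z)) :=
  dominatedFamily_gamma hp (by simpa only [neg_div] using (tendsto_bigT_div s).neg)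
    (tendsto_scale_mul_div q κ hx)

theorem GammaN_eq (hp : IsParam q κ) (θ R : ℝ) (N : ℕ) :
    GammaN q κ θ R N = contourPiece (zCrit q κ) θ R
      (sigmaOne q κ / Real.cos θ / mScale q κ N) := by
  unfold GammaN mScale
  have h := rpow_neg_eq_mu_pow N 4
  rw [show (-(1 / 3) : ℝ) = -(((4 : ℕ) : ℝ) / 12) by norm_num, h]
  congr 1
  have := (sigma_pos hp).ne'
  field_simp

theorem gammaN_eq (q κ : ℝ) (N : ℕ) :
    gammaN q κ N = contourPiece (zCrit q κ) (2 * Real.pi / 3) (gammaRadius q κ N)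
      (0 / mScale q κ N) := by
  rw [zero_div]; rfl

theorem gammaTildeN_eq (q κ : ℝ) (N : ℕ) :
    gammaTildeN q κ N = contourPiece (zCrit q κ) (Real.pi / 2) (gammaTildeRadius q κ N)
      (0 / mScale q κ N) := by
  rw [zero_div]; rfl

theorem tendsto_const_div_mScale (hp : IsParam q κ) (C : ℝ) :
    Tendsto (fun N => C / mScale q κ N) atTop (𝓝 0) :=
  tendsto_const_nhds.div_atTop (tendsto_mScale hp)

theorem norm_scale (hp : IsParam q κ) {N : ℕ} (hN : 1 ≤ mu N) :
    ‖(scale q κ N : ℂ)‖ = zCrit q κ * mScale q κ N := by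
  rw [Complex.norm_real, scale_eq, Real.norm_of_nonneg]
  exact mul_nonneg (zCrit_pos hp).le (mScale_pos hp hN).le

theorem norm_sq_sub_one_ge {z : ℂ} {a : ℝ} (ha : 0 ≤ a) (hz : a ≤ ‖z‖) :
    a ^ 2 - 1 ≤ ‖z ^ 2 - 1‖ := by
  have h := norm_sub_norm_le (z ^ 2) 1
  rw [norm_pow, norm_one] at h
  have : a ^ 2 ≤ ‖z‖ ^ 2 := by gcongr
  linarith

theorem norm_mul_sub_one_ge {z w : ℂ} {a : ℝ} (ha : 0 ≤ a) (hz : a ≤ ‖z‖) (hw : a ≤ ‖w‖) :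
    a ^ 2 - 1 ≤ ‖z * w - 1‖ := by
  have h := norm_sub_norm_le (z * w) 1
  rw [norm_mul, norm_one] at h
  have : a ^ 2 ≤ ‖z‖ * ‖w‖ := by rw [sq]; gcongr
  linarith

/-- Since `|z|, |w| ≥ z_c > 1` on `Γ_N`, no denominator becomes small. The prefactor is `O(m)`, one
power short of the `m²` needed for a nonzero limit. -/
theorem tendsto_I11 (hp : IsParam q κ) {c : ℝ} (hc : 0 < c) {θ R : ℝ}
    (h : IsDescentContour q κ θ R) (s t : ℝ)
    {xN yN : ℕ → ℝ} {x y : ℝ} (hx : Tendsto xN atTop (𝓝 x)) (hy : Tendsto yN atTop (𝓝 y)) :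
    Tendsto (fun N => I11 q c κ θ R N s (xN N) t (yN N)) atTop (𝓝 0) := by
  have hz := zCrit_pos hp
  have hq := hp.q_pos
  have hz1 := one_lt_zCrit hp.q_pos hp.q_lt_one hp.κ_pos hp.κ_lt_one
  obtain ⟨B, hB⟩ := eventually_Gamma_geometry hp h
  have hd : 0 < zCrit q κ ^ 2 - 1 := by nlinarith
  set C := zCrit q κ * ((B + B) * (1 + c) * (1 + c) * (1 + q * B) * (1 + q * B) /
    ((zCrit q κ ^ 2 - 1) * (zCrit q κ ^ 2 - 1) * (zCrit q κ ^ 2 - 1))) with hC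
  have hmain := tendsto_contourIntegral₂_zero (dominatedFamily_EPlus hp h s hx)
    (dominatedFamily_EPlus hp h t hy) (K := H11 q c κ) (ε := fun N => C / mScale q κ N)
    (tendsto_const_div_mScale hp C) (measurable_uncurry_H11 q c κ) (by
      filter_upwards [hB, eventually_mu_ge_one] with N hN h1 i v j w hw hw'
      obtain ⟨a1, a2, -⟩ := hN i v hw _ rfl
      obtain ⟨b1, b2, -⟩ := hN j w hw' _ rfl
      have hm := mScale_pos hp h1
      have e : C / mScale q κ N * mScale q κ N ^ 2 = C * mScale q κ N := by field_simp
      rw [e, hC]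
      generalize scaledPoint (zCrit q κ) θ R (sigmaOne q κ / Real.cos θ) (mScale q κ N) i v = z
        at *
      generalize scaledPoint (zCrit q κ) θ R (sigmaOne q κ / Real.cos θ) (mScale q κ N) j w = w
        at *
      have g1 : ∀ u : ℂ, zCrit q κ ≤ ‖u‖ → ‖1 - c / u‖ ≤ 1 + c := by
        intro u hu
        refine (norm_sub_le _ _).trans ?_
        rw [norm_one, norm_div, Complex.norm_real, Real.norm_of_nonneg hc.le]
        have : c / ‖u‖ ≤ c := div_le_self hc.le (by linarith)
        linarith
      have g2 : ‖z - w‖ ≤ B + B := (norm_sub_le _ _).trans (add_le_add a2 b2)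
      have hB0 : 0 ≤ B := (norm_nonneg z).trans a2
      unfold H11
      rw [norm_mul, norm_scale hp h1, mul_right_comm (zCrit q κ)]
      gcongr
      rw [norm_div, norm_mul, norm_mul, norm_mul, norm_mul, norm_mul, norm_mul]
      gcongr
      · exact g1 z a1
      · exact g1 w b1
      · exact norm_fracPow_le hq N a2
      · exact norm_fracPow_le hq N b2
      · exact norm_sq_sub_one_ge hz.le a1
      · exact norm_sq_sub_one_ge hz.le b1
      · exact norm_mul_sub_one_ge hz.le a1 b1)
  have h2 := hmain.const_mul (1 / (2 * Real.pi * Complex.I) ^ 2)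
  rw [mul_zero] at h2
  refine h2.congr fun N => ?_
  unfold I11
  simp only [GammaN_eq hp, F11_eq]

/-- On `γ_N` the moduli lie between `(1 + z_c)/2 > 1` and `z_c < c`, so `zw - 1`, `z - c` and `w -
c` stay away from zero and the prefactor is again only `O(m)`. -/
theorem tendsto_I22 (hp : IsParam q κ) {c : ℝ} (hc : zCrit q κ < c) (s t : ℝ)
    {xN yN : ℕ → ℝ} {x y : ℝ} (hx : Tendsto xN atTop (𝓝 x)) (hy : Tendsto yN atTop (𝓝 y)) :
    Tendsto (fun N => I22 q c κ N s (xN N) t (yN N)) atTop (𝓝 0) := by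
  have hz := zCrit_pos hp
  have hq := hp.q_pos
  have hz1 := one_lt_zCrit hp.q_pos hp.q_lt_one hp.κ_pos hp.κ_lt_one
  have hqz := q_mul_zCrit_lt_one hq hp.q_lt_one hp.κ_pos
  set r := (1 + zCrit q κ) / 2 with hr
  have hd : 0 < r ^ 2 - 1 := by
    have : 1 < r := by rw [hr]; linarith
    nlinarith
  have hcz : 0 < c - zCrit q κ := by linarith
  set d := 1 - q * zCrit q κ with hdd
  have hd0 : 0 < d := by rw [hdd]; linarith
  have hd1 : d ≤ 1 := by
    have : 0 < q * zCrit q κ := by positivity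
    rw [hdd]; linarith
  set C := zCrit q κ * ((zCrit q κ + zCrit q κ) /
    ((r ^ 2 - 1) * (c - zCrit q κ) * (c - zCrit q κ) * d * d)) with hC
  have hmain := tendsto_contourIntegral₂_zero (dominatedFamily_EMinus hp s hx)
    (dominatedFamily_EMinus hp t hy) (K := H22 q c κ) (ε := fun N => C / mScale q κ N)
    (tendsto_const_div_mScale hp C) (measurable_uncurry_H22 q c κ) (by
      filter_upwards [eventually_gamma_geometry hp, eventually_mu_ge_one]
        with N hN h1 i v j w hw hw'
      obtain ⟨a1, a2⟩ := hN i v hw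
      obtain ⟨b1, b2⟩ := hN j w hw'
      have hm := mScale_pos hp h1
      have e : C / mScale q κ N * mScale q κ N ^ 2 = C * mScale q κ N := by field_simp
      rw [e, hC]
      generalize scaledPoint (zCrit q κ) (2 * Real.pi / 3) (gammaRadius q κ N) 0
        (mScale q κ N) i v = z at *
      generalize scaledPoint (zCrit q κ) (2 * Real.pi / 3) (gammaRadius q κ N) 0
        (mScale q κ N) j w = w at *
      have g1 : ∀ u : ℂ, ‖u‖ ≤ zCrit q κ → c - zCrit q κ ≤ ‖u - c‖ := by
        intro u hu
        have := norm_sub_norm_le (c : ℂ) u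
        rw [norm_sub_rev, Complex.norm_real, Real.norm_of_nonneg (by linarith)] at this
        linarith
      have g2 : ‖z - w‖ ≤ zCrit q κ + zCrit q κ := (norm_sub_le _ _).trans (add_le_add a2 b2)
      have g3 : ∀ u : ℂ, ‖u‖ ≤ zCrit q κ → d ≤ ‖fracPow q κ N u‖ := by
        intro u hu
        refine le_norm_fracPow N hd0 hd1 (le_trans ?_ (one_sub_le_norm hq u))
        rw [hdd]; gcongr
      have hr0 : 0 ≤ r := by rw [hr]; positivity
      unfold H22
      rw [norm_mul, norm_scale hp h1, mul_right_comm (zCrit q κ)]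
      gcongr
      rw [norm_div, norm_mul, norm_mul, norm_mul, norm_mul]
      gcongr
      · exact norm_mul_sub_one_ge hr0 a1 b1
      · exact g1 z a2
      · exact g1 w b2
      · exact g3 z a2
      · exact g3 w b2)
  have h2 := hmain.const_mul (1 / (2 * Real.pi * Complex.I) ^ 2)
  rw [mul_zero] at h2
  refine h2.congr fun N => ?_
  unfold I22
  simp only [gammaN_eq, F22_eq]

/-- The singular factor `1/(z - w) = m/(Z - W)` brings the prefactor to order `m²`. All other
factors converge to their values at `z_c`, where they cancel. -/
theorem tendsto_I12 (hp : IsParam q κ) {c : ℝ} (hc : zCrit q κ < c) {θ R : ℝ}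
    (h : IsDescentContour q κ θ R) (s t : ℝ)
    {xN yN : ℕ → ℝ} {x y : ℝ} (hx : Tendsto xN atTop (𝓝 x)) (hy : Tendsto yN atTop (𝓝 y)) :
    Tendsto (fun N => I12 q c κ θ R N s (xN N) t (yN N)) atTop
      (𝓝 (1 / (2 * Real.pi * Complex.I) ^ 2 *
        truncatedWedgeIntegral (sigmaOne q κ / Real.cos θ) θ fun Z =>
          wedgeIntegral 0 (2 * Real.pi / 3)
            (limitIntegrand (fOne q κ * s) (fOne q κ * t) x y Z))) := by
  have hz := zCrit_pos hp
  have hq := hp.q_pos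
  have hσ := sigma_pos hp
  have hz1 := one_lt_zCrit hp.q_pos hp.q_lt_one hp.κ_pos hp.κ_lt_one
  have hqz := q_mul_zCrit_lt_one hq hp.q_lt_one hp.κ_pos
  obtain ⟨hθ, hR, -⟩ := id h
  have hzR := zCrit_lt_of_inv_lt hp hR
  have hcos : 0 < Real.cos θ :=
    Real.cos_pos_of_mem_Ioo ⟨by linarith [hθ.1, Real.pi_pos], hθ.2⟩
  obtain ⟨B, hB⟩ := eventually_Gamma_geometry hp h
  have hcz : 0 < c - zCrit q κ := by linarith
  set d := 1 - q * zCrit q κ with hdd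
  have hd0 : 0 < d := by rw [hdd]; linarith
  have hd1 : d ≤ 1 := by
    have : 0 < q * zCrit q κ := by positivity
    rw [hdd]; linarith
  have hd : 0 < zCrit q κ ^ 2 - 1 := by nlinarith
  -- Off the arc `Re z ≥ z_c + σ₁/m` while `Re w ≤ |w| ≤ z_c`; on the arc `|z| - |w| ≥ R - z_c`.
  -- Hence `|z - w| ≥ b/m` in both cases.
  set b := min (sigmaOne q κ) (R - zCrit q κ) with hb
  have hb0 : 0 < b := lt_min hσ (by linarith)
  set C := zCrit q κ * ((B * zCrit q κ + 1) * (B + c) * (1 + q * B) /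
    (zCrit q κ * b * (zCrit q κ ^ 2 - 1) * (c - zCrit q κ) * d)) with hC
  have hmain := tendsto_contourIntegral₂_of_div (dominatedFamily_EPlus hp h s hx)
    (dominatedFamily_EMinus hp t hy) (K := H12 q c κ) (klim := fun Z W => 1 / (Z - W)) (C := C)
    (measurable_uncurry_H12 q c κ) (by
      filter_upwards [hB, eventually_gamma_geometry hp, eventually_mu_ge_one,
        (tendsto_mScale hp).eventually_ge_atTop 1] with N hN hN' h1 hm1 i v j w hw hw'
      obtain ⟨a1, a2, a3⟩ := hN i v hw _ rfl
      obtain ⟨b1, b2⟩ := hN' j w hw'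
      have hm := mScale_pos hp h1
      rw [hC]
      generalize scaledPoint (zCrit q κ) θ R (sigmaOne q κ / Real.cos θ) (mScale q κ N) i v = z
        at *
      generalize scaledPoint (zCrit q κ) (2 * Real.pi / 3) (gammaRadius q κ N) 0
        (mScale q κ N) j w = w at *
      have hB0 : 0 ≤ B := (norm_nonneg z).trans a2
      have g1 : c - zCrit q κ ≤ ‖w - c‖ := by
        have := norm_sub_norm_le (c : ℂ) w
        rw [norm_sub_rev, Complex.norm_real, Real.norm_of_nonneg (by linarith)] at this
        linarith
      have g2 : ‖z - c‖ ≤ B + c := by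
        refine (norm_sub_le _ _).trans ?_
        rw [Complex.norm_real, Real.norm_of_nonneg (by linarith)]
        linarith
      have g3 : d ≤ ‖fracPow q κ N w‖ := by
        refine le_norm_fracPow N hd0 hd1 (le_trans ?_ (one_sub_le_norm hq w))
        rw [hdd]; gcongr
      have g4 : ‖z * w - 1‖ ≤ B * zCrit q κ + 1 := by
        refine (norm_sub_le _ _).trans ?_
        rw [norm_mul, norm_one]; gcongr
      have g5 : b / mScale q κ N ≤ ‖z - w‖ := by
        rcases a3 with a3 | a3
        · have e1 : b / mScale q κ N ≤ (mu N ^ 4)⁻¹ := by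
            rw [div_le_iff₀ hm]
            have : (mu N ^ 4)⁻¹ * mScale q κ N = sigmaOne q κ := by unfold mScale; field_simp
            rw [this]; exact min_le_left _ _
          have e2 := Complex.re_le_norm (z - w)
          rw [Complex.sub_re] at e2
          have e3 := Complex.re_le_norm w
          linarith
        · have e1 : b / mScale q κ N ≤ b := div_le_self hb0.le hm1
          have e2 := norm_sub_norm_le z w
          have e3 : b ≤ R - zCrit q κ := min_le_right _ _
          linarith
      have e : zCrit q κ * ((B * zCrit q κ + 1) * (B + c) * (1 + q * B) /
          (zCrit q κ * b * (zCrit q κ ^ 2 - 1) * (c - zCrit q κ) * d)) * mScale q κ N ^ 2 =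
          zCrit q κ * mScale q κ N * ((B * zCrit q κ + 1) * (B + c) * (1 + q * B) /
          (zCrit q κ * (b / mScale q κ N) * (zCrit q κ ^ 2 - 1) * (c - zCrit q κ) * d)) := by
        field_simp
      rw [e]
      unfold H12
      rw [norm_mul, norm_scale hp h1]
      have hc0 : 0 < c := by linarith
      gcongr
      rw [norm_div, norm_mul, norm_mul, norm_mul, norm_mul, norm_mul, norm_mul]
      gcongr
      · exact norm_fracPow_le hq N a2
      · exact norm_sq_sub_one_ge hz.le a1) (by
      intro i v j w hw hw'
      -- The truncation of `Γ_N` keeps `Re Z > 0`, whereas `Re W ≤ 0`.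
      have hZW : limitPoint θ (sigmaOne q κ / Real.cos θ) i v -
          limitPoint (2 * Real.pi / 3) 0 j w ≠ 0 := by
        have hre : 0 < (limitPoint θ (sigmaOne q κ / Real.cos θ) i v).re := by
          have hρ : 0 < sigmaOne q κ / Real.cos θ := by positivity
          have hmem : ∀ {S : Set ℝ} {f : ℝ → ℂ}, S.indicator f v ≠ 0 → v ∈ S :=
            fun h => mem_of_indicator_ne_zero h
          fin_cases i
          · have hv : v ∈ Ioi (sigmaOne q κ / Real.cos θ) :=
              hmem (f := fun _ => -Complex.exp (-(θ * Complex.I))) hw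
            have hv0 : 0 < v := hρ.trans hv
            change 0 < (rayPoint 0 (-θ) v).re
            rw [rayPoint_re, Real.cos_neg]; positivity
          · change 0 < (segmentPath _ _ v).re
            simp [segmentPath, rayPoint_re]
            field_simp
            exact hσ
          · have hv : v ∈ Ioi (sigmaOne q κ / Real.cos θ) :=
              hmem (f := fun _ => Complex.exp (θ * Complex.I)) hw
            have hv0 : 0 < v := hρ.trans hv
            change 0 < (rayPoint 0 θ v).re
            rw [rayPoint_re]; positivity
          · exact absurd rfl hw
        have hre' : (limitPoint (2 * Real.pi / 3) 0 j w).re ≤ 0 := by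
          have hmem : ∀ {S : Set ℝ} {f : ℝ → ℂ}, S.indicator f w ≠ 0 → w ∈ S :=
            fun h => mem_of_indicator_ne_zero h
          fin_cases j
          · have hv : w ∈ Ioi (0 : ℝ) :=
              hmem (f := fun _ => -Complex.exp (-((2 * Real.pi / 3 : ℝ) * Complex.I))) hw'
            have hv0 : 0 < w := hv
            change (rayPoint 0 (-(2 * Real.pi / 3)) w).re ≤ 0
            rw [rayPoint_re, Real.cos_neg, cos_two_pi_div_three]; linarith
          · change (segmentPath _ _ w).re ≤ 0
            simp [segmentPath, rayPoint_re]
          · have hv : w ∈ Ioi (0 : ℝ) :=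
              hmem (f := fun _ => Complex.exp ((2 * Real.pi / 3 : ℝ) * Complex.I)) hw'
            have hv0 : 0 < w := hv
            change (rayPoint 0 (2 * Real.pi / 3) w).re ≤ 0
            rw [rayPoint_re, cos_two_pi_div_three]; linarith
          · exact absurd rfl hw'
        intro h0
        have := congrArg Complex.re h0
        rw [Complex.sub_re, Complex.zero_re] at this
        linarith
      generalize limitPoint θ (sigmaOne q κ / Real.cos θ) i v = Z at *
      generalize limitPoint (2 * Real.pi / 3) 0 j w = W at *
      have tz := (tendsto_div_mScale hp Z).const_add (zCrit q κ : ℂ)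
      have tw := (tendsto_div_mScale hp W).const_add (zCrit q κ : ℂ)
      rw [add_zero] at tz tw
      have hzc : (zCrit q κ : ℂ) ≠ 0 := by exact_mod_cast hz.ne'
      have hz2 : (zCrit q κ : ℂ) ^ 2 - 1 ≠ 0 := by exact_mod_cast hd.ne'
      have hzc' : (zCrit q κ : ℂ) - c ≠ 0 := by
        have : zCrit q κ - c ≠ 0 := by linarith
        exact_mod_cast this
      have l1 := (((tz.mul tw).sub_const 1).mul (tz.sub_const (c : ℂ))).div
        ((tz.mul ((tz.pow 2).sub_const 1)).mul (tw.sub_const (c : ℂ)))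
        (mul_ne_zero (mul_ne_zero hzc hz2) hzc')
      have l2 := (l1.mul (tendsto_fracPow_div hp Z W)).const_mul (zCrit q κ / (Z - W))
      have hlim : (zCrit q κ : ℂ) / (Z - W) * (((zCrit q κ : ℂ) * zCrit q κ - 1) *
          (zCrit q κ - c) / (zCrit q κ * ((zCrit q κ : ℂ) ^ 2 - 1) * (zCrit q κ - c)) * 1) =
          1 / (Z - W) := by
        rw [← sq]; field_simp
      rw [hlim] at l2
      refine l2.congr' ?_
      filter_upwards [eventually_mu_ge_one] with N h1
      have hm : (mScale q κ N : ℂ) ≠ 0 := by exact_mod_cast (mScale_pos hp h1).ne'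
      unfold H12
      have hsc : (scale q κ N : ℂ) = zCrit q κ * mScale q κ N := by
        rw [scale_eq]; push_cast; rfl
      have hdiff : (zCrit q κ : ℂ) + Z / mScale q κ N - (zCrit q κ + W / mScale q κ N) =
          (Z - W) / mScale q κ N := by ring
      rw [hsc, hdiff]
      simp only [Pi.div_apply]
      generalize (zCrit q κ : ℂ) + Z / mScale q κ N = z
      generalize (zCrit q κ : ℂ) + W / mScale q κ N = w
      simp only [div_eq_mul_inv, mul_inv, inv_inv]
      have hmm : (mScale q κ N : ℂ) * mScale q κ N * ((mScale q κ N : ℂ) ^ 2)⁻¹ = 1 := by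
        field_simp
      linear_combination (-(zCrit q κ * (Z - W)⁻¹ * (z * w - 1) * (z - c) * fracPow q κ N z *
        z⁻¹ * (z ^ 2 - 1)⁻¹ * (w - c)⁻¹ * (fracPow q κ N w)⁻¹)) * hmm)
  have h2 := hmain.const_mul (1 / (2 * Real.pi * Complex.I) ^ 2)
  refine (h2.congr fun N => ?_).trans (le_of_eq ?_)
  · unfold I12
    simp only [GammaN_eq hp, gammaN_eq, F12_eq]
  · congr 2
    rw [limitContourIntegral_eq]
    congr 1
    funext Z
    rw [limitContourIntegral_eq, truncatedWedgeIntegral_zero]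
    congr 1
    funext W
    unfold limitIntegrand phaseLim
    rw [mul_one_div]
    rw [show -(zCrit q κ * sigmaOne q κ * x) / (zCrit q κ * sigmaOne q κ) = -x by field_simp,
      show zCrit q κ * sigmaOne q κ * y / (zCrit q κ * sigmaOne q κ) = y by field_simp]
    congr 3
    · push_cast; ring
    · push_cast; ring

end Kernel


/-! ### Residue terms at `c`, the heat kernel, and the limit of the off-diagonal entry -/

section Residual

variable {q κ : ℝ}

/-- On the real interval `(z_c, 1/q)` every factor of `S₁'` is positive. -/
theorem SOneBar_re_pos (hp : IsParam q κ) {c : ℝ} (hc : zCrit q κ < c) (hqc : q * c < 1) :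
    0 < (SOneBar q κ c).re := by
  have hz := zCrit_pos hp
  have hq := hp.q_pos
  have hz1 := one_lt_zCrit hp.q_pos hp.q_lt_one hp.κ_pos hp.κ_lt_one
  have hs := sCoeff_pos hq hp.q_lt_one hp.κ_pos
  have hder : ∀ u ∈ Icc (zCrit q κ) c, HasDerivAt (fun u : ℝ => (SOne q κ u).re)
      (sCoeff q κ * (u - zCrit q κ) ^ 2 / (u * (u - q) * (1 - q * u))) u := by
    intro u hu
    have hu0 : 0 < u := hz.trans_le hu.1
    have hreg : IsRegular q (u : ℂ) := by
      refine isRegular_of hq (by simpa using hu0) ?_ (Or.inr ?_)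
      · rw [Complex.norm_real, Real.norm_of_nonneg hu0.le]; linarith [hu.1, hp.q_lt_one]
      · rw [Complex.ofReal_re]
        nlinarith [hu.2]
    convert (hasDerivAt_SOne hq hp.q_lt_one hp.κ_pos hreg).real_of_complex using 1
    rw [← Complex.ofReal_re (_ / _)]
    congr 1
    push_cast; rfl
  have hmono : StrictMonoOn (fun u : ℝ => (SOne q κ u).re) (Icc (zCrit q κ) c) := by
    refine strictMonoOn_of_deriv_pos (convex_Icc _ _)
      (fun u hu => (hder u hu).continuousAt.continuousWithinAt) ?_
    rw [interior_Icc]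
    intro u hu
    rw [(hder u (Ioo_subset_Icc_self hu)).deriv]
    have h1 : 0 < u - zCrit q κ := by linarith [hu.1]
    have h2 : 0 < u := by linarith
    have h3 : 0 < u - q := by linarith [hp.q_lt_one]
    have h4 : 0 < 1 - q * u := by nlinarith [hu.2]
    positivity
  have := hmono (left_mem_Icc.2 hc.le) (right_mem_Icc.2 hc.le) hc
  unfold SOneBar
  rw [Complex.sub_re]
  simp only at this
  linarith

/-- The term `-N Re S̄₁(c)` is of order `-μ¹²`, against at most `μ⁸` for the rest of the exponent.
-/
theorem tendsto_EMinus_zero (hp : IsParam q κ) {c : ℝ} (hc : zCrit q κ < c) (hqc : q * c < 1)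
    (t : ℝ) {yN : ℕ → ℝ} {y : ℝ} (hy : Tendsto yN atTop (𝓝 y)) :
    Tendsto (fun N => ‖EMinus q κ t N (yN N) c‖) atTop (𝓝 0) := by
  have hs := SOneBar_re_pos hp hc hqc
  set C := (|-t| + 1) * ‖GOneBar q κ c‖ + (|zCrit q κ * sigmaOne q κ * y| + 1) *
    ‖Complex.log ((c : ℂ) / zCrit q κ)‖ with hC
  have hT : Tendsto (fun N => -(bigT N t : ℝ) / mu N ^ 8) atTop (𝓝 (-t)) := by
    simpa only [neg_div] using (tendsto_bigT_div t).neg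
  refine squeeze_zero_norm' ?_ (tendsto_mScale_mul_exp q κ hs C (k := 11) (by norm_num))
  filter_upwards [eventually_mu_ge_one, (tendsto_mScale hp).eventually_ge_atTop 1,
    eventually_abs_le_of_tendsto_div hT,
    eventually_abs_le_of_tendsto_div (tendsto_scale_mul_div q κ hy)] with N h1 h2 h3 h4
  rw [norm_norm]
  unfold EMinus
  rw [Complex.norm_exp]
  refine le_trans ?_ (le_mul_of_one_le_left (Real.exp_pos _).le h2)
  gcongr
  refine (re_phase_le q κ _ _ _ N c).trans ?_
  rw [natCast_eq_mu_pow N]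
  have e1 : mu N ^ 8 ≤ mu N ^ 11 := pow_le_pow_right₀ h1 (by norm_num)
  have e2 : mu N ^ 4 ≤ mu N ^ 11 := pow_le_pow_right₀ h1 (by norm_num)
  have a1 : |-(bigT N t : ℝ)| * ‖GOneBar q κ c‖ ≤ (|-t| + 1) * mu N ^ 11 * ‖GOneBar q κ c‖ := by
    gcongr; exact h3.trans (by gcongr)
  have a2 : |scale q κ N * yN N| * ‖Complex.log ((c : ℂ) / zCrit q κ)‖ ≤
      (|zCrit q κ * sigmaOne q κ * y| + 1) * mu N ^ 11 *
        ‖Complex.log ((c : ℂ) / zCrit q κ)‖ := by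
    gcongr; exact h4.trans (by gcongr)
  refine (add_le_add (add_le_add le_rfl a1) a2).trans (le_of_eq ?_)
  rw [hC]; ring

theorem tendsto_residual_gamma (hp : IsParam q κ) {c : ℝ} (hc : zCrit q κ < c)
    (hqc : q * c < 1) (s t : ℝ) {xN yN : ℕ → ℝ} {x y : ℝ} (hx : Tendsto xN atTop (𝓝 x))
    (hy : Tendsto yN atTop (𝓝 y)) :
    Tendsto (fun N => scale q κ N / (2 * Real.pi * Complex.I) *
      contourIntegral (gammaN q κ N) fun z => EMinus q κ s N (xN N) z * EMinus q κ t N (yN N) c /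
        ((c * z - 1) * fracPow q κ N z * fracPow q κ N c)) atTop (𝓝 0) := by
  have hz := zCrit_pos hp
  have hq := hp.q_pos
  have hz1 := one_lt_zCrit hp.q_pos hp.q_lt_one hp.κ_pos hp.κ_lt_one
  have hqz := q_mul_zCrit_lt_one hq hp.q_lt_one hp.κ_pos
  set r := (1 + zCrit q κ) / 2 with hr
  have hr1 : 1 < r := by rw [hr]; linarith
  have hd : 0 < r ^ 2 - 1 := by nlinarith
  set d := 1 - q * c with hdd
  have hd0 : 0 < d := by rw [hdd]; linarith
  have hd1 : d ≤ 1 := by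
    have : 0 < q * c := mul_pos hq (by linarith)
    rw [hdd]; linarith
  set C := zCrit q κ * (1 / ((r ^ 2 - 1) * d * d)) with hC
  have hmain := tendsto_contourIntegral_zero (dominatedFamily_EMinus hp s hx)
    (K := fun N z => scale q κ N * (EMinus q κ t N (yN N) c /
        ((c * z - 1) * fracPow q κ N z * fracPow q κ N c)))
    (ε := fun N => C * ‖EMinus q κ t N (yN N) c‖)
    (by simpa using (tendsto_EMinus_zero hp hc hqc t hy).const_mul C)
    (fun N => by
      have h := measurable_fracPow q κ N
      fun_prop) (by
      filter_upwards [eventually_gamma_geometry hp, eventually_mu_ge_one]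
        with N hN h1 i v hw
      obtain ⟨a1, a2⟩ := hN i v hw
      have hm := mScale_pos hp h1
      generalize scaledPoint (zCrit q κ) (2 * Real.pi / 3) (gammaRadius q κ N) 0
        (mScale q κ N) i v = z at *
      have hcn : ‖(c : ℂ)‖ = c := by rw [Complex.norm_real, Real.norm_of_nonneg (by linarith)]
      have g3 : ∀ u : ℂ, ‖u‖ ≤ c → d ≤ ‖fracPow q κ N u‖ := by
        intro u hu
        refine le_norm_fracPow N hd0 hd1 (le_trans ?_ (one_sub_le_norm hq u))
        rw [hdd]; gcongr
      have g4 : r ^ 2 - 1 ≤ ‖(c : ℂ) * z - 1‖ :=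
        norm_mul_sub_one_ge (by linarith) (by rw [hcn, hr]; linarith) a1
      rw [norm_mul, norm_scale hp h1, norm_div, norm_mul, norm_mul]
      calc zCrit q κ * mScale q κ N * (‖EMinus q κ t N (yN N) c‖ /
            (‖(c : ℂ) * z - 1‖ * ‖fracPow q κ N z‖ * ‖fracPow q κ N c‖)) ≤
          zCrit q κ * mScale q κ N * (‖EMinus q κ t N (yN N) c‖ / ((r ^ 2 - 1) * d * d)) := by
            gcongr
            · exact g3 z (a2.trans hc.le)
            · exact g3 c hcn.le
        _ = _ := by rw [hC]; ring)
  have h2 := hmain.const_mul (1 / (2 * Real.pi * Complex.I))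
  rw [mul_zero] at h2
  refine h2.congr fun N => ?_
  rw [gammaN_eq, ← contourIntegral_const_mul, ← contourIntegral_const_mul]
  congr 1
  funext z
  ring

theorem tendsto_R22 (hp : IsParam q κ) {c : ℝ} (hc : zCrit q κ < c)
    (hqc : q * c < 1) (s t : ℝ) {xN yN : ℕ → ℝ} {x y : ℝ} (hx : Tendsto xN atTop (𝓝 x))
    (hy : Tendsto yN atTop (𝓝 y)) :
    Tendsto (fun N => R22 q c κ N s (xN N) t (yN N)) atTop (𝓝 0) := by
  have h := (tendsto_residual_gamma hp hc hqc s t hx hy).sub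
    (tendsto_residual_gamma hp hc hqc t s hy hx)
  rw [sub_zero] at h
  refine h.congr fun N => ?_
  unfold R22
  simp only [F22_eq]
  congr 2
  congr 1
  funext z
  ring

theorem tendsto_residual_Gamma (hp : IsParam q κ) {c : ℝ} (hc : zCrit q κ < c)
    (hqc : q * c < 1) {θ R : ℝ} (h : IsDescentContour q κ θ R) (s t : ℝ)
    {xN yN : ℕ → ℝ} {x y : ℝ} (hx : Tendsto xN atTop (𝓝 x)) (hy : Tendsto yN atTop (𝓝 y)) :
    Tendsto (fun N => scale q κ N / (2 * Real.pi * Complex.I) *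
      contourIntegral (GammaN q κ θ R N) fun z =>
        F12 q κ N s (xN N) t (yN N) z c * (z * c - 1) * fracPow q κ N z /
          (z * (z ^ 2 - 1) * fracPow q κ N c)) atTop (𝓝 0) := by
  have hz := zCrit_pos hp
  have hq := hp.q_pos
  have hz1 := one_lt_zCrit hp.q_pos hp.q_lt_one hp.κ_pos hp.κ_lt_one
  have hc0 : 0 < c := hz.trans hc
  obtain ⟨B, hB⟩ := eventually_Gamma_geometry hp h
  have hd : 0 < zCrit q κ ^ 2 - 1 := by nlinarith
  set d := 1 - q * c with hdd
  have hd0 : 0 < d := by rw [hdd]; linarith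
  have hd1 : d ≤ 1 := by
    have : 0 < q * c := mul_pos hq hc0
    rw [hdd]; linarith
  set C := zCrit q κ * ((B * c + 1) * (1 + q * B) /
    (zCrit q κ * (zCrit q κ ^ 2 - 1) * d)) with hC
  have hmain := tendsto_contourIntegral_zero (dominatedFamily_EPlus hp h s hx)
    (K := fun N z => scale q κ N * (EMinus q κ t N (yN N) c *
        ((z * c - 1) * fracPow q κ N z / (z * (z ^ 2 - 1) * fracPow q κ N c))))
    (ε := fun N => C * ‖EMinus q κ t N (yN N) c‖)
    (by simpa using (tendsto_EMinus_zero hp hc hqc t hy).const_mul C)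
    (fun N => by
      have h := measurable_fracPow q κ N
      fun_prop) (by
      filter_upwards [hB, eventually_mu_ge_one] with N hN h1 i v hw
      obtain ⟨a1, a2, -⟩ := hN i v hw _ rfl
      have hm := mScale_pos hp h1
      generalize scaledPoint (zCrit q κ) θ R (sigmaOne q κ / Real.cos θ) (mScale q κ N) i v = z
        at *
      have hcn : ‖(c : ℂ)‖ = c := by rw [Complex.norm_real, Real.norm_of_nonneg hc0.le]
      have hB0 : 0 ≤ B := (norm_nonneg z).trans a2
      have g3 : d ≤ ‖fracPow q κ N c‖ := by
        refine le_norm_fracPow N hd0 hd1 (le_trans ?_ (one_sub_le_norm hq _))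
        rw [hdd, hcn]
      have g4 : ‖z * c - 1‖ ≤ B * c + 1 := by
        refine (norm_sub_le _ _).trans ?_
        rw [norm_mul, norm_one, hcn]; gcongr
      rw [norm_mul, norm_scale hp h1, norm_mul, norm_div, norm_mul, norm_mul, norm_mul]
      calc zCrit q κ * mScale q κ N * (‖EMinus q κ t N (yN N) c‖ *
            (‖z * c - 1‖ * ‖fracPow q κ N z‖ / (‖z‖ * ‖z ^ 2 - 1‖ * ‖fracPow q κ N c‖))) ≤
          zCrit q κ * mScale q κ N * (‖EMinus q κ t N (yN N) c‖ *
            ((B * c + 1) * (1 + q * B) / (zCrit q κ * (zCrit q κ ^ 2 - 1) * d))) := by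
            gcongr
            · exact norm_fracPow_le hq N a2
            · exact norm_sq_sub_one_ge hz.le a1
        _ = _ := by rw [hC]; ring)
  have h2 := hmain.const_mul (1 / (2 * Real.pi * Complex.I))
  rw [mul_zero] at h2
  refine h2.congr fun N => ?_
  rw [GammaN_eq hp, ← contourIntegral_const_mul, ← contourIntegral_const_mul]
  congr 1
  funext z
  rw [F12_eq]
  ring

/-- The wedge of angle `π/2` is the imaginary axis, and `Z = is` gives the Fourier transform of a
Gaussian. -/
theorem wedgeIntegral_gaussian {τ : ℝ} (hτ : 0 < τ) (y : ℝ) :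
    wedgeIntegral 0 (Real.pi / 2) (fun Z => Complex.exp (τ * Z ^ 2 + y * Z)) =
      2 * Real.pi * Complex.I *
        ((1 / √(4 * Real.pi * τ) * Real.exp (-y ^ 2 / (4 * τ)) : ℝ) : ℂ) := by
  have hI : Complex.exp ((Real.pi / 2 : ℝ) * Complex.I) = Complex.I := by
    push_cast; exact Complex.exp_pi_div_two_mul_I
  have hI' : Complex.exp (-((Real.pi / 2 : ℝ) * Complex.I)) = -Complex.I := by
    rw [Complex.exp_neg, hI, Complex.inv_I]
  have hre : (-(τ : ℂ)).re < 0 := by simpa using hτ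
  have hint := integrable_cexp_quadratic' hre (Complex.I * y) 0
  set F : ℝ → ℂ := fun s => Complex.exp (-(τ : ℂ) * s ^ 2 + Complex.I * y * s + 0) with hF
  have h1 : ∀ s : ℝ, Complex.exp (τ * rayPoint 0 (Real.pi / 2) s ^ 2 +
      y * rayPoint 0 (Real.pi / 2) s) = F s := by
    intro s
    simp only [hF, rayPoint, hI]
    congr 1
    push_cast
    linear_combination (τ * s ^ 2 : ℂ) * Complex.I_sq
  have h2 : ∀ s : ℝ, Complex.exp (τ * rayPoint 0 (-(Real.pi / 2)) s ^ 2 +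
      y * rayPoint 0 (-(Real.pi / 2)) s) = F (-s) := by
    intro s
    simp only [hF, rayPoint]
    rw [Complex.ofReal_neg, neg_mul, hI']
    congr 1
    push_cast
    linear_combination (τ * s ^ 2 : ℂ) * Complex.I_sq
  unfold wedgeIntegral
  simp only [h1, h2, hI, hI', integral_mul_const]
  rw [integral_comp_neg_Ioi (0 : ℝ) F, neg_zero, mul_neg, sub_neg_eq_add, ← add_mul, add_comm,
    intervalIntegral.integral_Iic_add_Ioi hint.integrableOn hint.integrableOn, hF,
    integral_cexp_quadratic hre]
  rw [neg_neg, zero_sub]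
  have e1 : ((Real.pi : ℂ) / τ) ^ (1 / 2 : ℂ) = ((√(Real.pi / τ) : ℝ) : ℂ) := by
    rw [Real.sqrt_eq_rpow, Complex.ofReal_cpow (by positivity)]
    push_cast; rfl
  have e2 : -((Complex.I * y) ^ 2 / (4 * -(τ : ℂ))) = ((-y ^ 2 / (4 * τ) : ℝ) : ℂ) := by
    push_cast
    rw [mul_pow, Complex.I_sq]
    have : (τ : ℂ) ≠ 0 := by exact_mod_cast hτ.ne'
    field_simp
  rw [e1, e2, ← Complex.ofReal_exp]
  have e3 : √(Real.pi / τ) = 2 * Real.pi * (1 / √(4 * Real.pi * τ)) := by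
    rw [show 4 * Real.pi * τ = (2 * Real.pi) ^ 2 / (Real.pi / τ) by
      field_simp; ring, Real.sqrt_div (by positivity) (Real.pi / τ),
      Real.sqrt_sq (by positivity)]
    field_simp
  rw [e3]
  push_cast
  ring

theorem tendsto_heat (hp : IsParam q κ) {s t : ℝ} (hst : t < s)
    {xN yN : ℕ → ℝ} {x y : ℝ} (hx : Tendsto xN atTop (𝓝 x)) (hy : Tendsto yN atTop (𝓝 y)) :
    Tendsto (fun N => scale q κ N / (2 * Real.pi * Complex.I) *
      contourIntegral (gammaTildeN q κ N) fun z =>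
        1 / z * Complex.exp ((bigT N s - bigT N t) * GOneBar q κ z) *
          Complex.exp (scale q κ N * (yN N - xN N) * Complex.log (z / zCrit q κ))) atTop
      (𝓝 ((1 / √(4 * Real.pi * (fOne q κ * (s - t))) *
        Real.exp (-(y - x) ^ 2 / (4 * (fOne q κ * (s - t)))) : ℝ) : ℂ)) := by
  have hz := zCrit_pos hp
  have hσ := sigma_pos hp
  have hf := fOne_pos hp.q_pos hp.κ_pos
  have hT : Tendsto (fun N => ((bigT N s : ℝ) - bigT N t) / mu N ^ 8) atTop (𝓝 (s - t)) := by
    simpa only [sub_div] using (tendsto_bigT_div s).sub (tendsto_bigT_div t)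
  have hmain := tendsto_contourIntegral_of_div
    (dominatedFamily_gammaTilde hp (sub_pos.2 hst) hT (tendsto_scale_mul_div q κ (hy.sub hx)))
    (K := fun N z => scale q κ N / z) (klim := fun _ => 1) (C := 1)
    (fun N => by fun_prop) (by
      filter_upwards [eventually_gammaTilde_geometry hp, eventually_mu_ge_one] with N hN h1 i v hw
      have a := hN i v hw
      have hm := mScale_pos hp h1
      generalize scaledPoint (zCrit q κ) (Real.pi / 2) (gammaTildeRadius q κ N) 0
        (mScale q κ N) i v = z at *
      rw [norm_div, norm_scale hp h1, div_le_iff₀ (hz.trans_le a), one_mul, mul_comm]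
      gcongr) (by
      intro i v _
      generalize limitPoint (Real.pi / 2) 0 i v = Z
      have tz := (tendsto_div_mScale hp Z).const_add (zCrit q κ : ℂ)
      rw [add_zero] at tz
      have hzc : (zCrit q κ : ℂ) ≠ 0 := by exact_mod_cast hz.ne'
      have h1 := (tendsto_const_nhds (x := (zCrit q κ : ℂ))).div tz hzc
      rw [div_self hzc] at h1
      refine h1.congr' ?_
      filter_upwards [eventually_mu_ge_one] with N h1
      have hm : (mScale q κ N : ℂ) ≠ 0 := by exact_mod_cast (mScale_pos hp h1).ne'
      rw [Pi.div_apply, scale_eq]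
      push_cast
      rw [div_right_comm, mul_div_cancel_right₀ _ hm])
  have h2 := hmain.const_mul (1 / (2 * Real.pi * Complex.I))
  refine (h2.congr fun N => ?_).trans (le_of_eq ?_)
  · rw [gammaTildeN_eq, ← contourIntegral_const_mul, ← contourIntegral_const_mul]
    congr 1
    funext z
    have : Complex.exp (phase q κ 0 ((bigT N s : ℝ) - bigT N t) (scale q κ N * (yN N - xN N)) N z) =
        Complex.exp ((bigT N s - bigT N t) * GOneBar q κ z) *
          Complex.exp (scale q κ N * (yN N - xN N) * Complex.log (z / zCrit q κ)) := by
      unfold phase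
      rw [← Complex.exp_add]
      congr 1; push_cast; ring
    rw [this]
    ring
  · congr 1
    rw [limitContourIntegral_eq, truncatedWedgeIntegral_zero]
    have e : (fun Z => Complex.exp (phaseLim q κ 0 (s - t)
        (zCrit q κ * sigmaOne q κ * (y - x)) Z) * 1) =
        fun Z => Complex.exp ((fOne q κ * (s - t) : ℝ) * Z ^ 2 + (y - x : ℝ) * Z) := by
      funext Z
      unfold phaseLim
      rw [show zCrit q κ * sigmaOne q κ * (y - x) / (zCrit q κ * sigmaOne q κ) = y - x by
        field_simp, mul_one]
      congr 1; push_cast; ring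
    rw [e, wedgeIntegral_gaussian (mul_pos hf (sub_pos.2 hst)), ← mul_assoc,
      one_div_mul_cancel Complex.two_pi_I_ne_zero, one_mul]

/-- The conjugating exponential reduces the heat part of the extended Airy kernel to the plain heat
kernel at time `a - b`. -/
theorem heat_exponent {a b : ℝ} (hab : b < a) (x y : ℝ) :
    2 * a ^ 3 / 3 - 2 * b ^ 3 / 3 + a * x - b * y +
      (-((y + b ^ 2) - (x + a ^ 2)) ^ 2 / (4 * (a - b)) -
        (a - b) * ((y + b ^ 2) + (x + a ^ 2)) / 2 + (a - b) ^ 3 / 12) =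
      -(y - x) ^ 2 / (4 * (a - b)) := by
  have : a - b ≠ 0 := (sub_pos.2 hab).ne'
  field_simp
  ring

theorem tendsto_kernelN_zero_one (hp : IsParam q κ) {c : ℝ} (hc : zCrit q κ < c)
    (hqc : q * c < 1) {θ R : ℝ} (h : IsDescentContour q κ θ R) (s t : ℝ)
    {xN yN : ℕ → ℝ} {x y : ℝ} (hx : Tendsto xN atTop (𝓝 x)) (hy : Tendsto yN atTop (𝓝 y))
    {α β : ℝ} (hαβ : β + -fOne q κ * t < α + -fOne q κ * s) :
    Tendsto (fun N : ℕ => I12 q c κ θ R N s (xN N) t (yN N) + R12 q c κ θ R N s (xN N) t (yN N))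
      atTop (𝓝 (Complex.exp (2 * fOne q κ ^ 3 * s ^ 3 / 3 - 2 * fOne q κ ^ 3 * t ^ 3 / 3 +
          fOne q κ * s * x - fOne q κ * t * y) *
        airyKernel α β (-fOne q κ * s) (x + fOne q κ ^ 2 * s ^ 2)
          (-fOne q κ * t) (y + fOne q κ ^ 2 * t ^ 2))) := by
  have hf := fOne_pos hp.q_pos hp.κ_pos
  have hσ := sigma_pos hp
  obtain ⟨hθ1, hθ2⟩ := h.1
  have hpi := Real.pi_pos
  have hcos : 0 < Real.cos θ := Real.cos_pos_of_mem_Ioo ⟨by linarith, hθ2⟩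
  -- The condition `θ > π/4` places the limiting contour in the sectors where the cubic exponential
  -- was shown to decay.
  have hcs : Real.cos θ < Real.sin θ := by
    rw [← Real.sin_pi_div_two_sub]
    exact Real.sin_lt_sin_of_lt_of_le_pi_div_two (by linarith) hθ2.le (by linarith)
  have hI := tendsto_I12 hp hc h s t hx hy
  -- Undoing the shift that completes the cube moves the vertices to these values; admissibility of
  -- `α`, `β` says exactly that they are in the required order.
  rw [truncatedWedge_limitIntegrand (α := α - fOne q κ * s) (β := β - fOne q κ * t) _ _ _ _
    (by linarith) hcos hcs (by positivity), ← airy_doubleIntegral_eq, sub_add_cancel,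
    sub_add_cancel] at hI
  have hR := tendsto_residual_Gamma hp hc hqc h s t hx hy
  have hH : Tendsto (fun N => -(if t < s then 1 else 0) * scale q κ N / (2 * Real.pi * Complex.I) *
      (contourIntegral (gammaTildeN q κ N) fun z =>
        1 / z * Complex.exp ((bigT N s - bigT N t) * GOneBar q κ z) *
          Complex.exp (scale q κ N * ((yN N : ℂ) - xN N) * Complex.log (z / zCrit q κ)))) atTop
      (𝓝 (Complex.exp (2 * fOne q κ ^ 3 * s ^ 3 / 3 - 2 * fOne q κ ^ 3 * t ^ 3 / 3 +
          fOne q κ * s * x - fOne q κ * t * y) *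
        -(((if -fOne q κ * s < -fOne q κ * t then 1 else 0) /
            √(4 * Real.pi * (-fOne q κ * t - -fOne q κ * s)) *
          Real.exp (-((y + fOne q κ ^ 2 * t ^ 2) - (x + fOne q κ ^ 2 * s ^ 2)) ^ 2 /
              (4 * (-fOne q κ * t - -fOne q κ * s)) - (-fOne q κ * t - -fOne q κ * s) *
              ((y + fOne q κ ^ 2 * t ^ 2) + (x + fOne q κ ^ 2 * s ^ 2)) / 2 +
            (-fOne q κ * t - -fOne q κ * s) ^ 3 / 12) : ℝ) : ℂ))) := by
    by_cases hst : t < s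
    · have hst' : fOne q κ * t < fOne q κ * s := mul_lt_mul_of_pos_left hst hf
      rw [if_pos hst, if_pos (by linarith)]
      refine ((tendsto_heat hp hst hx hy).neg.congr fun N => ?_).trans (le_of_eq ?_)
      · ring
      · congr 1
        rw [mul_neg, neg_inj]
        have e := heat_exponent hst' x y
        have e2 : Complex.exp (2 * fOne q κ ^ 3 * s ^ 3 / 3 - 2 * fOne q κ ^ 3 * t ^ 3 / 3 +
            fOne q κ * s * x - fOne q κ * t * y) =
            ((Real.exp (2 * (fOne q κ * s) ^ 3 / 3 - 2 * (fOne q κ * t) ^ 3 / 3 +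
              fOne q κ * s * x - fOne q κ * t * y) : ℝ) : ℂ) := by
          push_cast; congr 1; ring
        rw [e2, ← Complex.ofReal_mul, mul_left_comm (Real.exp _), ← Real.exp_add,
          show -fOne q κ * t - -fOne q κ * s = fOne q κ * s - fOne q κ * t by ring,
          ← mul_pow, ← mul_pow, e, mul_sub]
    · have hst' : ¬ -fOne q κ * s < -fOne q κ * t := by
        push Not at hst ⊢
        nlinarith
      rw [if_neg hst, if_neg hst']
      simp
  have := hI.add (hH.add hR)
  refine (this.congr fun N => ?_).trans (le_of_eq ?_)
  · unfold R12
    congr! 2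
  · congr 1
    unfold airyKernel
    rw [add_zero]
    refine (add_comm _ _).trans (Eq.trans ?_ (mul_add _ _ _).symm)
    congr 1
    rw [mul_left_comm]
    congr 1
    · congr 1; push_cast; ring
    · congr 1
      congr 1
      funext z
      congr 1
      funext w
      congr 1
      · congr 1; push_cast; ring
      · push_cast; ring

end Residual


/-! ### Existence of descent pairs -/

section Descent

variable {q κ : ℝ}

/-- `Re (e^{3iθ} conj P(z))` as a function of `t`, where `z = z_c + t e^{iθ}`, `cos θ = c` and
`P(z) = z (z - q) (1 - q z)`. -/
noncomputable def rayCubic (q κ c t : ℝ) : ℝ :=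
  zCrit q κ * (zCrit q κ - q) * (1 - q * zCrit q κ) * (4 * c ^ 3 - 3 * c) +
    t * ((zCrit q κ + (zCrit q κ - q)) * (1 - q * zCrit q κ) -
      q * (zCrit q κ * (zCrit q κ - q))) * (2 * c ^ 2 - 1) +
    t ^ 2 * (1 - q * zCrit q κ - q * (zCrit q κ + (zCrit q κ - q))) * c - q * t ^ 3

/-- This is applied with `a = z_c`, `b = z_c - q`, `d = 1 - q z_c`. For `0 < c` with `2c² < 1` the
constant and cubic terms are negative, and only the linear term, with coefficient `P (2c² - 1)`, and
the quadratic term, with coefficient `M c`, can be harmful. If `P < 0`, then `M < 0`, and `2c²`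
close to `1` makes the linear term small. If `P ≥ 0`, the linear term is harmless, and a small `c`
controls the quadratic one. -/
theorem exists_cos_cubic_neg {a b d q : ℝ} (ha : 0 < a) (hb : 0 < b) (hd : 0 < d) (hd1 : d < 1)
    (hq : 0 < q) : ∃ c : ℝ, 0 < c ∧ 2 * c ^ 2 < 1 ∧ ∀ t > 0,
      a * b * d * (4 * c ^ 3 - 3 * c) + t * ((a + b) * d - q * (a * b)) * (2 * c ^ 2 - 1) +
        t ^ 2 * (d - q * (a + b)) * c - q * t ^ 3 < 0 := by
  have hA : 0 < a * b * d := by positivity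
  set A := a * b * d with hAdef
  rcases lt_or_ge ((a + b) * d - q * (a * b)) 0 with hP | hP
  · have hM : d - q * (a + b) < 0 := by
      -- The left side equals `P - q (a² + ab + b²)`, where `P` is the assumed negative quantity.
      have h1 : (a + b) * (d - q * (a + b)) < 0 := by nlinarith [sq_nonneg a, sq_nonneg b]
      by_contra hcon
      push Not at hcon
      have : 0 ≤ (a + b) * (d - q * (a + b)) := by positivity
      linarith
    set P := (a + b) * d - q * (a * b) with hPdef
    set M := d - q * (a + b) with hMdef
    -- With this `m`, the linear term is at most `A/2` for `t ≤ 1` and at most `q t³` for `t ≥ 1`.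
    set m := min (A / 2) q with hm
    have hm0 : 0 < m := lt_min (by positivity) hq
    set η := min (1 / 2) (m / (2 * -P)) with hη
    have hη0 : 0 < η := lt_min (by norm_num) (div_pos hm0 (by linarith))
    have hη1 : η ≤ 1 / 2 := min_le_left _ _
    have hηP : η * -P < m := by
      have : η ≤ m / (2 * -P) := min_le_right _ _
      rw [le_div_iff₀ (by linarith)] at this
      linarith
    have hc2 : √((1 - η) / 2) ^ 2 = (1 - η) / 2 := Real.sq_sqrt (by linarith)
    have hc0 : 0 < √((1 - η) / 2) := Real.sqrt_pos.2 (by linarith)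
    set c := √((1 - η) / 2) with hc
    have hch : 1 / 2 ≤ c := by nlinarith
    refine ⟨c, hc0, by linarith, fun t ht => ?_⟩
    have e1 : 2 * c ^ 2 - 1 = -η := by linarith
    have e2 : 1 / 2 ≤ c * (3 - 4 * c ^ 2) := by
      have : 1 ≤ 3 - 4 * c ^ 2 := by linarith
      nlinarith
    have e3 : A / 2 ≤ A * (c * (3 - 4 * c ^ 2)) := by nlinarith
    have e4 : t ^ 2 * M * c ≤ 0 := by
      have : 0 ≤ t ^ 2 * c := by positivity
      nlinarith
    have e5 : t * (η * -P) < A / 2 + q * t ^ 3 := by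
      have h1 : t * (η * -P) < t * m := mul_lt_mul_of_pos_left hηP ht
      have hmA : m ≤ A / 2 := min_le_left _ _
      have hmq : m ≤ q := min_le_right _ _
      rcases le_total t 1 with h | h
      · have : 0 < q * t ^ 3 := by positivity
        have : t * m ≤ A / 2 := by nlinarith
        linarith
      · have h3 : t ≤ t ^ 3 := le_self_pow₀ h (by norm_num)
        have : t * m ≤ q * t ^ 3 := by
          calc t * m ≤ t ^ 3 * q := by gcongr
            _ = _ := mul_comm _ _
        linarith
    rw [e1]
    have e6 : A * (4 * c ^ 3 - 3 * c) = -(A * (c * (3 - 4 * c ^ 2))) := by ring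
    rw [e6]
    nlinarith
  · have hM : d - q * (a + b) ≤ 1 := by
      have : 0 < q * (a + b) := by positivity
      linarith
    set P := (a + b) * d - q * (a * b) with hPdef
    set M := d - q * (a + b) with hMdef
    -- For `qt ≥ c` the cubic term dominates `c t²`; for `qt ≤ c` this choice gives `t² ≤ A`, and
    -- the constant term dominates.
    set c := min (1 / 2) (A * q ^ 2) with hc
    have hc0 : 0 < c := lt_min (by norm_num) (by positivity)
    have hch : c ≤ 1 / 2 := min_le_left _ _
    have hcA : c ≤ A * q ^ 2 := min_le_right _ _
    refine ⟨c, hc0, by nlinarith, fun t ht => ?_⟩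
    have e1 : t * P * (2 * c ^ 2 - 1) ≤ 0 :=
      mul_nonpos_of_nonneg_of_nonpos (by positivity) (by nlinarith)
    have e2 : t ^ 2 * M * c ≤ t ^ 2 * c := by
      have : 0 ≤ t ^ 2 * c := by positivity
      nlinarith
    have e3 : 2 * c * A ≤ A * (c * (3 - 4 * c ^ 2)) := by
      have h1 : 2 ≤ 3 - 4 * c ^ 2 := by nlinarith
      have h2 : 0 < A * c := by positivity
      nlinarith
    have e4 : t ^ 2 * c < 2 * c * A + q * t ^ 3 := by
      rcases le_total c (q * t) with h | h
      · have h1 : t ^ 2 * c ≤ t ^ 2 * (q * t) := by gcongr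
        have h2 : 0 < 2 * c * A := by positivity
        nlinarith
      · have h1 : (q * t) ^ 2 ≤ A * q ^ 2 := by
          have : (q * t) ^ 2 ≤ c ^ 2 := by gcongr
          nlinarith
        have h2 : t ^ 2 ≤ A := by
          rw [mul_pow, mul_comm] at h1
          exact le_of_mul_le_mul_right h1 (by positivity)
        have h3 : t ^ 2 * c ≤ A * c := by gcongr
        have h4 : 0 < A * c := by positivity
        have h5 : 0 < q * t ^ 3 := by positivity
        nlinarith
    have e6 : A * (4 * c ^ 3 - 3 * c) = -(A * (c * (3 - 4 * c ^ 2))) := by ring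
    rw [e6]
    linarith

/-- Writing `1/P = conj P / |P|²` and `(z - z_c)² e^{iψ} = t² e^{3iψ}` isolates the real part as a
cubic polynomial in `t`. -/
theorem re_ray_derivative (q κ ψ t : ℝ) {z : ℂ} (hz : z = rayPoint (zCrit q κ) ψ t) :
    ((sCoeff q κ * (z - zCrit q κ) ^ 2 / (z * (z - q) * (1 - q * z))) *
      Complex.exp (ψ * Complex.I)).re =
      sCoeff q κ * t ^ 2 * (Complex.normSq (z * (z - q) * (1 - q * z)))⁻¹ *
        rayCubic q κ (Real.cos ψ) t := by
  set e := Complex.exp (ψ * Complex.I) with he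
  have hconj : (starRingEnd ℂ) e = Complex.exp ((-ψ : ℝ) * Complex.I) := by
    rw [he, ← Complex.exp_conj]; simp
  have hone : e * (starRingEnd ℂ) e = 1 := by
    rw [hconj, he, ← Complex.exp_add]; simp
  have hzc : z - zCrit q κ = t * e := by rw [hz]; simp [rayPoint, he]
  have hcz : (starRingEnd ℂ) z = zCrit q κ + t * (starRingEnd ℂ) e := by
    rw [hz]; simp [rayPoint, he]
  have p2 : (e ^ 2).re = 2 * Real.cos ψ ^ 2 - 1 := by
    rw [he, ← Complex.exp_nat_mul, ← Real.cos_two_mul, ← Complex.exp_ofReal_mul_I_re]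
    congr 2; push_cast; ring
  have p3 : (e ^ 3).re = 4 * Real.cos ψ ^ 3 - 3 * Real.cos ψ := by
    rw [he, ← Complex.exp_nat_mul, ← Real.cos_three_mul, ← Complex.exp_ofReal_mul_I_re]
    congr 2; push_cast; ring
  have p1 : e.re = Real.cos ψ := Complex.exp_ofReal_mul_I_re ψ
  have h1 : sCoeff q κ * (z - zCrit q κ) ^ 2 / (z * (z - q) * (1 - q * z)) * e =
      ((sCoeff q κ * t ^ 2 * (Complex.normSq (z * (z - q) * (1 - q * z)))⁻¹ : ℝ) : ℂ) *
        (e ^ 3 * (starRingEnd ℂ) (z * (z - q) * (1 - q * z))) := by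
    rw [div_eq_mul_inv, Complex.inv_def, hzc]; push_cast; ring
  rw [h1, Complex.re_ofReal_mul]
  congr 1
  have h2 : e ^ 3 * (starRingEnd ℂ) (z * (z - q) * (1 - q * z)) =
      ((zCrit q κ * (zCrit q κ - q) * (1 - q * zCrit q κ) : ℝ) : ℂ) * e ^ 3 +
        ((t * ((zCrit q κ + (zCrit q κ - q)) * (1 - q * zCrit q κ) -
          q * (zCrit q κ * (zCrit q κ - q))) : ℝ) : ℂ) * e ^ 2 +
        ((t ^ 2 * (1 - q * zCrit q κ - q * (zCrit q κ + (zCrit q κ - q))) : ℝ) : ℂ) * e -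
        ((q * t ^ 3 : ℝ) : ℂ) := by
    simp only [map_mul, map_sub, map_one, Complex.conj_ofReal, hcz]
    generalize (starRingEnd ℂ) e = g at hone
    push_cast
    linear_combination ((t * ((zCrit q κ + (zCrit q κ - q)) * (1 - q * zCrit q κ) -
          q * (zCrit q κ * (zCrit q κ - q))) : ℂ) * e ^ 2 +
        (t ^ 2 * (1 - q * zCrit q κ - q * (zCrit q κ + (zCrit q κ - q))) : ℂ) * e *
          (e * g + 1) - (q * t ^ 3 : ℂ) * (e ^ 2 * g ^ 2 + e * g + 1)) * hone
  rw [h2, Complex.sub_re, Complex.add_re, Complex.add_re, Complex.re_ofReal_mul,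
    Complex.re_ofReal_mul, Complex.re_ofReal_mul, Complex.ofReal_re, p1, p2, p3]
  rfl

theorem strictAntiOn_SOne_ray (hp : IsParam q κ) {ψ : ℝ} (hcos : 0 < Real.cos ψ)
    (hsin : Real.sin ψ ≠ 0) (hneg : ∀ t > 0, rayCubic q κ (Real.cos ψ) t < 0) :
    StrictAntiOn (fun t : ℝ => (SOne q κ (rayPoint (zCrit q κ) ψ t)).re) (Ici 0) := by
  have hz := zCrit_pos hp
  have hq := hp.q_pos
  have hz1 := one_lt_zCrit hp.q_pos hp.q_lt_one hp.κ_pos hp.κ_lt_one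
  have hs := sCoeff_pos hq hp.q_lt_one hp.κ_pos
  have hqz := q_mul_zCrit_lt_one hq hp.q_lt_one hp.κ_pos
  have hreg : ∀ t ∈ Ici (0 : ℝ), IsRegular q (rayPoint (zCrit q κ) ψ t) := by
    intro t ht
    have ht0 : 0 ≤ t := ht
    have hre : zCrit q κ ≤ (rayPoint (zCrit q κ) ψ t).re := by
      rw [rayPoint_re]
      have : 0 ≤ t * Real.cos ψ := by positivity
      linarith
    refine isRegular_of hq (hz.trans_le hre) ?_ ?_
    · exact (hp.q_lt_one.trans hz1).trans_le (hre.trans (Complex.re_le_norm _))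
    · rcases ht0.eq_or_lt with rfl | ht'
      · right; rw [rayPoint_re]; simpa using hqz
      · left; rw [rayPoint_im]; exact mul_ne_zero ht'.ne' hsin
  have hder : ∀ t ∈ Ici (0 : ℝ), HasDerivAt
      (fun t : ℝ => (SOne q κ (rayPoint (zCrit q κ) ψ t)).re)
      (sCoeff q κ * t ^ 2 * (Complex.normSq (rayPoint (zCrit q κ) ψ t *
        (rayPoint (zCrit q κ) ψ t - q) * (1 - q * rayPoint (zCrit q κ) ψ t)))⁻¹ *
        rayCubic q κ (Real.cos ψ) t) t := by
    intro t ht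
    have h1 := hasDerivAt_SOne hq hp.q_lt_one hp.κ_pos (hreg t ht)
    have h2 : HasDerivAt (fun t : ℝ => rayPoint (zCrit q κ) ψ t)
        (Complex.exp (ψ * Complex.I)) t := by
      simpa [rayPoint] using ((Complex.ofRealCLM.hasDerivAt (x := t)).mul_const
        (Complex.exp (ψ * Complex.I))).const_add (zCrit q κ : ℂ)
    have h3 := Complex.reCLM.hasFDerivAt.comp_hasDerivAt t (h1.comp t h2)
    rw [← re_ray_derivative q κ ψ t rfl]
    exact h3
  refine strictAntiOn_of_deriv_neg (convex_Ici 0)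
    (fun t ht => (hder t ht).continuousAt.continuousWithinAt) ?_
  rw [interior_Ici]
  intro t ht
  have ht0 : 0 < t := ht
  rw [(hder t ht0.le).deriv]
  have hr := hreg t ht0.le
  have hne : 0 < Complex.normSq (rayPoint (zCrit q κ) ψ t *
      (rayPoint (zCrit q κ) ψ t - q) * (1 - q * rayPoint (zCrit q κ) ψ t)) := by
    have n1 := Complex.slitPlane_ne_zero hr.1
    refine Complex.normSq_pos.2 (mul_ne_zero (mul_ne_zero n1 ?_) (Complex.slitPlane_ne_zero hr.2.2))
    intro h0
    apply Complex.slitPlane_ne_zero hr.2.1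
    rw [← sub_eq_zero.1 h0, div_self n1, sub_self]
  exact mul_neg_of_pos_of_neg (by positivity) (hneg t ht)

/-- On `|z| = R` the term `-κ log |1 - qz|` tends to `-∞` with `R`, while the first logarithm is at
most `log 2` and `-h₁ log R ≤ 0`. -/
theorem exists_radius_SOne_re_le (hp : IsParam q κ) (L : ℝ) :
    ∃ R, q⁻¹ < R ∧ ∀ z : ℂ, ‖z‖ = R → (SOne q κ z).re ≤ L := by
  obtain ⟨hq, hq1, hκ, hκ1⟩ := hp
  have ht : Tendsto (fun R : ℝ => κ * Real.log (q * R + -1)) atTop atTop :=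
    (Real.tendsto_log_atTop.comp (tendsto_atTop_add_const_right _ (-1)
      (tendsto_id.const_mul_atTop hq))).const_mul_atTop hκ
  obtain ⟨R, hR1, hR2⟩ := ((ht.eventually_ge_atTop (Real.log 2 - L)).and
    (eventually_gt_atTop q⁻¹)).exists
  refine ⟨R, hR2, fun z hz => ?_⟩
  have hqR : 1 < q * R := by rw [← inv_mul_lt_iff₀ hq]; simpa using hR2
  have hR : 1 < R := by nlinarith
  have hz0 : z ≠ 0 := by rw [← norm_pos_iff, hz]; linarith
  have hh : 0 ≤ hOne q κ := by
    unfold hOne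
    have : 0 < 1 - q ^ 2 := by nlinarith
    positivity
  rw [SOne_re z hz0, hz]
  have h1 : q * R - 1 ≤ ‖1 - q * z‖ := by
    have h := norm_sub_norm_le ((q : ℂ) * z) 1
    rwa [norm_one, norm_mul, Complex.norm_real, Real.norm_of_nonneg hq.le, hz,
      norm_sub_rev] at h
  have h2 : Real.log (q * R + -1) ≤ Real.log ‖1 - q * z‖ :=
    Real.log_le_log (by linarith) (by linarith)
  have h3 : Real.log (‖z - q‖ / R) ≤ Real.log 2 := by
    have hle : ‖z - q‖ / R ≤ 2 := by
      rw [div_le_iff₀ (by linarith)]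
      refine (norm_sub_le _ _).trans ?_
      rw [hz, Complex.norm_real, Real.norm_of_nonneg hq.le]; linarith
    have hpos : 0 < ‖z - q‖ / R := by
      refine div_pos (norm_pos_iff.2 (sub_ne_zero.2 ?_)) (by linarith)
      rintro rfl
      rw [Complex.norm_real, Real.norm_of_nonneg hq.le] at hz
      linarith
    exact Real.log_le_log hpos hle
  have h4 : κ * Real.log (q * R + -1) ≤ κ * Real.log ‖1 - q * z‖ := by gcongr
  have h5 : 0 ≤ hOne q κ * Real.log R := mul_nonneg hh (Real.log_nonneg hR.le)
  linarith

theorem exists_isDescentContour (hp : IsParam q κ) : ∃ θ R : ℝ, IsDescentContour q κ θ R := by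
  have hz := zCrit_pos hp
  have hq := hp.q_pos
  have hz1 := one_lt_zCrit hp.q_pos hp.q_lt_one hp.κ_pos hp.κ_lt_one
  have hqz := q_mul_zCrit_lt_one hq hp.q_lt_one hp.κ_pos
  have hpi := Real.pi_pos
  obtain ⟨c, hc0, hc1, hneg⟩ := exists_cos_cubic_neg hz
    (show 0 < zCrit q κ - q by linarith [hp.q_lt_one])
    (show 0 < 1 - q * zCrit q κ by linarith) (by nlinarith) hq
  obtain ⟨R, hR, hRz⟩ := exists_radius_SOne_re_le hp ((SOne q κ (zCrit q κ)).re - 1)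
  have hcθ : Real.cos (Real.arccos c) = c := Real.cos_arccos (by linarith) (by nlinarith)
  have hθ2 : Real.arccos c < Real.pi / 2 := Real.arccos_lt_pi_div_two.2 hc0
  have hθ1 : Real.pi / 4 < Real.arccos c := by
    by_contra hcon
    push Not at hcon
    have h := Real.cos_le_cos_of_nonneg_of_le_pi (Real.arccos_nonneg c) (by linarith) hcon
    rw [hcθ, Real.cos_pi_div_four] at h
    have : (√2 / 2) ^ 2 ≤ c ^ 2 := by gcongr
    rw [div_pow, Real.sq_sqrt (by norm_num)] at this
    linarith
  set θ := Real.arccos c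
  have hsin : 0 < Real.sin θ := Real.sin_pos_of_pos_of_lt_pi (by linarith) (by linarith)
  have hanti : ∀ ψ, ψ = θ ∨ ψ = -θ →
      StrictAntiOn (fun t : ℝ => (SOne q κ (rayPoint (zCrit q κ) ψ t)).re) (Ici 0) := by
    rintro ψ (rfl | rfl)
    · exact strictAntiOn_SOne_ray hp (by rw [hcθ]; exact hc0) hsin.ne' (by rw [hcθ]; exact hneg)
    · refine strictAntiOn_SOne_ray hp ?_ ?_ ?_
      · rw [Real.cos_neg, hcθ]; exact hc0
      · rw [Real.sin_neg]; exact neg_ne_zero.2 hsin.ne'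
      · rw [Real.cos_neg, hcθ]; exact hneg
  have hray0 : ∀ ψ, rayPoint (zCrit q κ) ψ 0 = zCrit q κ := by intro ψ; simp [rayPoint]
  set F : ℝ → ℝ → ℝ := fun ψ t =>
    (SOne q κ (zCrit q κ)).re - (SOne q κ (rayPoint (zCrit q κ) ψ t)).re with hF
  have hFpos : ∀ ψ, ψ = θ ∨ ψ = -θ → ∀ ε > 0, 0 < F ψ ε := by
    intro ψ hψ ε hε
    have := hanti ψ hψ (mem_Ici.2 le_rfl) (mem_Ici.2 hε.le) hε
    simp only [hray0] at this
    simp only [hF]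
    linarith
  -- Strict decrease along the rays makes the drop at distance `ε` a lower bound for the drop
  -- farther out; the `1` is the margin built into the choice of `R` for the arc.
  refine ⟨θ, R, ⟨hθ1, hθ2⟩, hR, fun ε => min 1 (min (F θ ε) (F (-θ) ε)), fun ε hε =>
    ⟨lt_min one_pos (lt_min (hFpos θ (Or.inl rfl) ε hε) (hFpos (-θ) (Or.inr rfl) ε hε)), ?_⟩⟩
  have hrayle : ∀ ψ, ψ = θ ∨ ψ = -θ → ∀ t, 0 ≤ t →
      ε ≤ ‖rayPoint (zCrit q κ) ψ t - zCrit q κ‖ →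
      (SOne q κ (rayPoint (zCrit q κ) ψ t) - SOne q κ (zCrit q κ)).re ≤
        -min 1 (min (F θ ε) (F (-θ) ε)) := by
    intro ψ hψ t ht hεt
    rw [rayPoint_eq_add, add_sub_cancel_left, norm_rayPoint_zero ht] at hεt
    have h1 := (hanti ψ hψ).antitoneOn (mem_Ici.2 hε.le) (mem_Ici.2 ht) hεt
    have h2 : min 1 (min (F θ ε) (F (-θ) ε)) ≤ F ψ ε := by
      refine (min_le_right _ _).trans ?_
      rcases hψ with rfl | rfl
      · exact min_le_left _ _
      · exact min_le_right _ _
    rw [Complex.sub_re]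
    simp only [hF] at h1 h2 ⊢
    linarith
  have hD : ∀ ψ, 0 ≤ rayDist (zCrit q κ) ψ R := fun ψ => Real.sInf_nonneg fun t ht => ht.1
  intro z hzmem hεz
  obtain ⟨i, u, hu, rfl⟩ := mem_iUnion.1 hzmem
  fin_cases i
  · have e : contourPiece (zCrit q κ) θ R 0 0 u =
        rayPoint (zCrit q κ) (-θ) ((1 - u) * rayDist (zCrit q κ) (-θ) R) := by
      simp only [contourPiece, segmentPath, rayPoint, Matrix.cons_val_zero]
      push_cast; ring
    simp only [Fin.zero_eta, e] at hεz ⊢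
    exact hrayle _ (Or.inr rfl) _ (mul_nonneg (by linarith [hu.2]) (hD _)) hεz
  · have e : contourPiece (zCrit q κ) θ R 0 1 u = zCrit q κ := by
      simp [contourPiece, segmentPath, rayPoint]
    simp only [Fin.mk_one, e, sub_self, norm_zero] at hεz
    linarith
  · have e : contourPiece (zCrit q κ) θ R 0 2 u =
        rayPoint (zCrit q κ) θ (u * rayDist (zCrit q κ) θ R) := by
      simp only [contourPiece, segmentPath, rayPoint, Matrix.cons_val]
      push_cast; ring
    simp only [Fin.reduceFinMk, e] at hεz ⊢
    exact hrayle _ (Or.inl rfl) _ (mul_nonneg hu.1 (hD _)) hεz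
  · have e : ‖contourPiece (zCrit q κ) θ R 0 3 u‖ = R :=
      norm_arcPath ((hz.trans (zCrit_lt_of_inv_lt hp hR)).le) _ _
    have h1 := hRz _ e
    have h2 : min 1 (min (F θ ε) (F (-θ) ε)) ≤ 1 := min_le_left _ _
    simp only [Fin.reduceFinMk, Complex.sub_re]
    linarith

end Descent

end BulkScaling

/-! ### The theorem -/

open BulkScaling Filter Topology in
theorem mainTheorem5 (q c κ : ℝ) (hq : q ∈ Set.Ioo (0 : ℝ) 1) (hc : c ∈ Set.Ioo 1 q⁻¹)
    (hκ : κ ∈ Set.Ioo (kappaZero q c) 1) :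
    (∃ θ R : ℝ, IsDescentContour q κ θ R) ∧
    ∀ θ R : ℝ, IsDescentContour q κ θ R →
      ∀ (s t x y : ℝ) (xN yN : ℕ → ℝ),
        Tendsto xN atTop (𝓝 x) → Tendsto yN atTop (𝓝 y) →
          Tendsto (fun N : ℕ => kernelN q c κ θ R N s (xN N) t (yN N) 0 0) atTop (𝓝 0) ∧
          Tendsto (fun N : ℕ => kernelN q c κ θ R N s (xN N) t (yN N) 1 1) atTop (𝓝 0) ∧
          ∀ α β : ℝ, β + -fOne q κ * t < α + -fOne q κ * s →
            Tendsto (fun N : ℕ => kernelN q c κ θ R N s (xN N) t (yN N) 0 1) atTop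
              (𝓝 (Complex.exp (2 * fOne q κ ^ 3 * s ^ 3 / 3 - 2 * fOne q κ ^ 3 * t ^ 3 / 3 +
                  fOne q κ * s * x - fOne q κ * t * y) *
                airyKernel α β (-fOne q κ * s) (x + fOne q κ ^ 2 * s ^ 2)
                  (-fOne q κ * t) (y + fOne q κ ^ 2 * t ^ 2))) := by
  have hκ0 : 0 < κ := lt_of_le_of_lt (sq_nonneg _) hκ.1
  have hp : IsParam q κ := ⟨hq.1, hq.2, hκ0, hκ.2⟩
  have hzc : zCrit q κ < c := zCrit_lt_of_kappaZero_lt hq.1 hq.2 hc hκ.1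
  have hqc : q * c < 1 := by
    have h := mul_lt_mul_of_pos_left hc.2 hq.1
    rwa [mul_inv_cancel₀ hq.1.ne'] at h
  refine ⟨exists_isDescentContour hp, fun θ R h s t x y xN yN hx hy => ⟨?_, ?_, ?_⟩⟩
  · simpa [kernelN] using tendsto_I11 hp (zero_lt_one.trans hc.1) h s t hx hy
  · simpa [kernelN] using (tendsto_I22 hp hzc s t hx hy).add (tendsto_R22 hp hzc hqc s t hx hy)
  · intro α β hαβ
    exact tendsto_kernelN_zero_one hp hzc hqc h s t hx hy hαβ
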